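/- Let $Q$ be a finite-dimensional smooth (Hausdorff, second countable) manifold, $L:TQ\times\mathbb R\to\mathbb R$ a smooth Lagrangian $L(q,\dot q,z)$, $k\ge 0$, and let $\phi^1,\dots,\phi^k:T(Q\times\mathbb R)\to\mathbb R$ be smooth functions of $(q,\dot q,z,\dot z)$. Put $\phi^0=\dot z-L$ and $\tilde N=\{\phi^0=\phi^1=\dots=\phi^k=0\}\subseteq N=\{\dot z=L\}\subseteq T(Q\times\mathbb R)$. Fix $q_0,q_1\in Q$, $z_0\in\mathbb R$. Let $\bar\Omega$ be the space of smooth curves $\bar c=(c,c_z):[0,1]\to Q\times\mathbb R$ with $c(0)=q_0$, $c(1)=q_1$, $c_z(0)=z_0$ ($c_z(1)$ is free), and $\bar\Omega_{\tilde N}\subseteq\bar\Omega$ the set of those with $\dot{\bar c}(t)\in\tilde N$ for all $t$. A curve $\bar c\in\bar\Omega_{\tilde N}$ is a *critical point* of $\bar{\mathcal A}(\bar c)=c_z(1)-z_0$ restricted to $\bar\Omega_{\tilde N}$ if $\frac{d}{ds}\big|_{s=0}\bar{\mathcal A}(\bar c_s)=0$ for every smooth one-parameter family $\bar c_s\in\bar\Omega_{\tilde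 N}$ with $\bar c_0=\bar c$. A curve $\bar c\in\bar\Omega$ is called *regular* if the constraint map $g(\bar c)=(\phi^a(\bar c,\dot{\bar c}))_{a=0}^k$ is a submersion at $\bar c$ in the following sense: at each $t\in[0,1]$ the derivatives of $\phi^0,\dots,\phi^k$ with respect to $(\dot q,\dot z)$ at $\dot{\bar c}(t)$ are linearly independent, and every smooth $h:[0,1]\to\mathbb R^{k+1}$ is equal to $\frac{d}{ds}\big|_{s=0}g(\bar c_s)$ for some smooth family $\bar c_s\in\bar\Omega$ with $\bar c_0=\bar c$. For $\bar c=(c,c_z)\in\bar\Omega$ and $\lambda=(\lambda_0,\dots,\lambda_k)$ on $[0,1]$ consider, with everything evaluated along $(\bar c(t),\dot{\bar c}(t))$, in all charts of the atlas of $Q$, and summing over $a=0,\dots,k$, $$\text{(EL)}\quad \frac{d}{dt}\Big(\lambda_a\frac{\partial\phi^a}{\partial\dot q^i}\Big)-\lambda_a\frac{\partial\phi^a}{\partial q^i}=0,\qquad \frac{d}{dt}\Big(\lambda_a\frac{\partial\phi^a}{\partial\dot z}\Big)-\lambda_a\frac{\partial\phi^a}{\partial z}=0,\qquad \phi^a=0,$$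 and the natural boundary condition $$\text{(B)}\quad 1-\lambda_a(1)\frac{\partial\phi^a}{\partial\dot z}(\bar c(1),\dot{\bar c}(1))=0.$$ Put $\psi^\alpha(q,\dot q,z)=\phi^\alpha(q,\dot q,z,L(q,\dot q,z))$ for $1\le\alpha\le k$, and, for $\mu=(\mu_1,\dots,\mu_k)$ on $[0,1]$, $\mathcal L_\mu(q,\dot q,z,t)=L-\mu_\alpha(t)\psi^\alpha$. Then for every $\bar c\in\bar\Omega$: 1. If (EL) and (B) hold for some $\lambda$, then $\bar c$ is a critical point of $\bar{\mathcal A}$ restricted to $\bar\Omega_{\tilde N}$. If $\bar c$ is regular, then $\bar c$ is such a critical point if and only if (EL) and (B) hold for some smooth $\lambda$. 2. The functions $\phi^0,\psi^1,\dots,\psi^k$ have the same common zero set $\tilde N$. If $\lambda'_0=\lambda_a\,\partial\phi^a/\partial\dot z$ along $\bar c$ and $\lambda'_\alpha=\lambda_\alpha$ for $\alpha\ge1$, then (EL) for $(\phi^a)$ and $\lambda$ is equivalent to (EL) for $(\phi^0,\psi^\alpha)$ and $\lambda'$, and likewise for (B). So $\phi^1,\dots,\phi^k$ can be chosen independent of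 $\dot z$. 3. Suppose that $\phi^1,\dots,\phi^k$ do not depend on $\dot z$. Then (B) says $\lambda_0(1)=1$. If $\lambda_0$ vanishes nowhere on $[0,1]$ and $\mu_\alpha=\lambda_\alpha/\lambda_0$, then (EL) is equivalent to $$-\frac{d}{dt}\Big(\lambda_0\frac{\partial\mathcal L_\mu}{\partial\dot q^i}\Big)+\lambda_0\frac{\partial\mathcal L_\mu}{\partial q^i}=0,\quad \frac{d\lambda_0}{dt}=-\lambda_0\frac{\partial\mathcal L_\mu}{\partial z},\quad \psi^\alpha(\bar c,\dot c)=0,\quad \dot c_z=\mathcal L_\mu(\bar c,\dot c,t),$$ and also to $\frac{d\lambda_0}{dt}=-\lambda_0\frac{\partial\mathcal L_\mu}{\partial z}$ together with $$\text{(H)}\quad \frac{d}{dt}\Big(\frac{\partial\mathcal L_\mu}{\partial\dot q^i}\Big)-\frac{\partial\mathcal L_\mu}{\partial q^i}=\frac{\partial\mathcal L_\mu}{\partial\dot q^i}\frac{\partial\mathcal L_\mu}{\partial z},\quad \psi^\alpha(\bar c,\dot c)=0,\quad \dot c_z=\mathcal L_\mu(\bar c,\dot c,t).$$ Moreover, a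 smooth $\mu$ satisfies (H) if and only if there is a smooth $\lambda$ with $\lambda_0$ nowhere zero on $[0,1]$ and $\mu_\alpha=\lambda_\alpha/\lambda_0$ that satisfies (EL) and (B). 4. For smooth $\mu$, the system (H) holds if and only if the curve $(c,\mu)$ in $Q\times\mathbb R^k$ and $c_z$ satisfy the Herglotz equations of the extended Lagrangian $\mathcal L(q,\mu,\dot q,\dot\mu,z)=L(q,\dot q,z)-\mu_\alpha\psi^\alpha(q,\dot q,z)$ on $T(Q\times\mathbb R^k)\times\mathbb R$, together with $\dot c_z=\mathcal L$. -/

import Mathlib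

open Set Manifold
open scoped ContDiff

noncomputable section

namespace VakonomicContact

section Curves

variable {E : Type*} [NormedAddCommGroup E] [NormedSpace ℝ E]
  {H : Type*} [TopologicalSpace H] (I : ModelWithCorners ℝ E H)
  {M : Type*} [TopologicalSpace M] [ChartedSpace H M]

/-- The velocity `(c t, ċ t) ∈ TM` of a curve defined on `[0,1]`.  Curves are functions on `ℝ` of
which only the restriction to `[0,1]` matters. -/
def velocity (c : ℝ → M) (t : ℝ) : TangentBundle I M :=
  ⟨c t, mfderivWithin 𝓘(ℝ, ℝ) I c (Icc 0 1) t (1 : ℝ)⟩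

/-- The derivative `ż` of a real function on `[0,1]`. -/
def zdot (z : ℝ → ℝ) (t : ℝ) : ℝ := derivWithin z (Icc 0 1) t

/-- The smooth curves `(c, z) : [0,1] → M × ℝ` with `c 0 = q₀`, `c 1 = q₁`, `z 0 = z₀` (and `z 1`
free) whose velocity stays in `N ⊆ T(M × ℝ) = TM × ℝ × ℝ`, a point of which is written
`((q, q̇), z, ż)`. -/
def pathSpace (q₀ q₁ : M) (z₀ : ℝ) (N : Set (TangentBundle I M × (ℝ × ℝ))) :
    Set ((ℝ → M) × (ℝ → ℝ)) :=
  {p | ContMDiffOn 𝓘(ℝ, ℝ) I ∞ p.1 (Icc 0 1) ∧ ContDiffOn ℝ ∞ p.2 (Icc 0 1) ∧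
    p.1 0 = q₀ ∧ p.1 1 = q₁ ∧ p.2 0 = z₀ ∧
    ∀ t ∈ Icc (0 : ℝ) 1, (velocity I p.1 t, (p.2 t, zdot p.2 t)) ∈ N}

/-- The action `z(1) - z(0)`. -/
def action (p : (ℝ → M) × (ℝ → ℝ)) : ℝ := p.2 1 - p.2 0

/-- `Γ` is a smooth variation of the curve `p` inside `pathSpace I q₀ q₁ z₀ N`: a smooth
one-parameter family of members of that space that passes through `p` at parameter `0`. -/
def IsVariation (q₀ q₁ : M) (z₀ : ℝ) (N : Set (TangentBundle I M × (ℝ × ℝ)))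
    (p : (ℝ → M) × (ℝ → ℝ)) (Γ : ℝ → (ℝ → M) × (ℝ → ℝ)) : Prop :=
  ∃ ε > 0,
    ContMDiffOn 𝓘(ℝ, ℝ × ℝ) I ∞ (fun x : ℝ × ℝ => (Γ x.1).1 x.2) (Ioo (-ε) ε ×ˢ Icc 0 1) ∧
    ContDiffOn ℝ ∞ (fun x : ℝ × ℝ => (Γ x.1).2 x.2) (Ioo (-ε) ε ×ˢ Icc 0 1) ∧
    (∀ s ∈ Ioo (-ε) ε, Γ s ∈ pathSpace I q₀ q₁ z₀ N) ∧
    EqOn (Γ 0).1 p.1 (Icc 0 1) ∧ EqOn (Γ 0).2 p.2 (Icc 0 1)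

/-- Critical points of the action restricted to the curves tangent to `N`. -/
def IsCritical (q₀ q₁ : M) (z₀ : ℝ) (N : Set (TangentBundle I M × (ℝ × ℝ)))
    (p : (ℝ → M) × (ℝ → ℝ)) : Prop :=
  p ∈ pathSpace I q₀ q₁ z₀ N ∧
    ∀ Γ, IsVariation I q₀ q₁ z₀ N p Γ → HasDerivAt (fun s => action (Γ s)) 0 0

/-- The point of `TM` with coordinates `(x, v)` in the chart `e`. -/
def chartPoint (e : OpenPartialHomeomorph M H) (x v : E) : TangentBundle I M :=
  ⟨(e.extend I).symm x, mfderiv 𝓘(ℝ, E) I (e.extend I).symm x v⟩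

/-- The velocity of the curve `c` in the coordinates of the chart `e`. -/
def chartVelocity (e : OpenPartialHomeomorph M H) (c : ℝ → M) (t : ℝ) : E :=
  derivWithin (fun s => e.extend I (c s)) (Icc 0 1) t

/-- The covector `(∂F/∂qⁱ)ᵢ` at `(c t, ċ t)`, in the coordinates of the chart `e`. -/
def partialQ (e : OpenPartialHomeomorph M H) (F : TangentBundle I M → ℝ) (c : ℝ → M) (t : ℝ) :
    E →L[ℝ] ℝ :=
  fderiv ℝ (fun x => F (chartPoint I e x (chartVelocity I e c t))) (e.extend I (c t))

/-- The covector `(∂F/∂q̇ⁱ)ᵢ` at `(c t, ċ t)`, in the coordinates of the chart `e`. -/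
def partialV (e : OpenPartialHomeomorph M H) (F : TangentBundle I M → ℝ) (c : ℝ → M) (t : ℝ) :
    E →L[ℝ] ℝ :=
  fderiv ℝ (fun v => F (chartPoint I e (e.extend I (c t)) v)) (chartVelocity I e c t)

/-- The Herglotz equations
`d/dt (∂𝓛/∂q̇ⁱ) - ∂𝓛/∂qⁱ = (∂𝓛/∂q̇ⁱ) (∂𝓛/∂z)` on `[0,1]`, in every chart of the atlas, for a
possibly time-dependent Lagrangian `𝓛 t : TM × ℝ → ℝ`. -/
def HerglotzEq (𝓛 : ℝ → TangentBundle I M × ℝ → ℝ) (c : ℝ → M) (z : ℝ → ℝ) : Prop :=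
  ∀ e ∈ atlas H M, ∀ t ∈ Icc (0 : ℝ) 1, c t ∈ e.source →
    HasDerivWithinAt (fun s => partialV I e (fun p => 𝓛 s (p, z s)) c s)
      (partialQ I e (fun p => 𝓛 t (p, z t)) c t +
        deriv (fun y => 𝓛 t (velocity I c t, y)) (z t) •
          partialV I e (fun p => 𝓛 t (p, z t)) c t)
      (Icc 0 1) t

end Curves

section Constraints

variable {E : Type*} [NormedAddCommGroup E] [NormedSpace ℝ E]
  {H : Type*} [TopologicalSpace H] (I : ModelWithCorners ℝ E H)
  {M : Type*} [TopologicalSpace M] [ChartedSpace H M] {k : ℕ}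

/-- The common zero set of a family of constraints. -/
def zeroSet (φ : Fin (k + 1) → TangentBundle I M × (ℝ × ℝ) → ℝ) :
    Set (TangentBundle I M × (ℝ × ℝ)) :=
  {x | ∀ a, φ a x = 0}

/-- The constraints `φ⁰ = ż - L` and `φ¹, …, φᵏ`. -/
def constraints (L : TangentBundle I M × ℝ → ℝ)
    (Φ : Fin k → TangentBundle I M × (ℝ × ℝ) → ℝ) :
    Fin (k + 1) → TangentBundle I M × (ℝ × ℝ) → ℝ :=
  Fin.cons (fun x => x.2.2 - L (x.1, x.2.1)) Φ

/-- `ψ^α(q, q̇, z) = φ^α(q, q̇, z, L(q, q̇, z))`. -/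
def psi (L : TangentBundle I M × ℝ → ℝ) (Φ : Fin k → TangentBundle I M × (ℝ × ℝ) → ℝ)
    (α : Fin k) (x : TangentBundle I M × ℝ) : ℝ :=
  Φ α (x.1, (x.2, L x))

/-- The functions `ψ^α`, regarded as constraints on `T(M × ℝ)` that do not involve `ż`. -/
def psiConstraint (L : TangentBundle I M × ℝ → ℝ)
    (Φ : Fin k → TangentBundle I M × (ℝ × ℝ) → ℝ) (α : Fin k)
    (x : TangentBundle I M × (ℝ × ℝ)) : ℝ :=
  psi I L Φ α (x.1, x.2.1)

/-- `∂φ/∂z` along the curve. -/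
def partialZ (φ : TangentBundle I M × (ℝ × ℝ) → ℝ) (c : ℝ → M) (z : ℝ → ℝ) (t : ℝ) : ℝ :=
  deriv (fun y => φ (velocity I c t, (y, zdot z t))) (z t)

/-- `∂φ/∂ż` along the curve. -/
def partialZdot (φ : TangentBundle I M × (ℝ × ℝ) → ℝ) (c : ℝ → M) (z : ℝ → ℝ) (t : ℝ) : ℝ :=
  deriv (fun w => φ (velocity I c t, (z t, w))) (zdot z t)

/-- The Euler–Lagrange-type equations with multipliers `λ_a`, in every chart of the atlas. -/
structure IsVakonomicSolution (φ : Fin (k + 1) → TangentBundle I M × (ℝ × ℝ) → ℝ)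
    (lam : ℝ → Fin (k + 1) → ℝ) (c : ℝ → M) (z : ℝ → ℝ) : Prop where
  eq_q : ∀ e ∈ atlas H M, ∀ t ∈ Icc (0 : ℝ) 1, c t ∈ e.source →
    HasDerivWithinAt
      (fun s => ∑ a, lam s a • partialV I e (fun p => φ a (p, (z s, zdot z s))) c s)
      (∑ a, lam t a • partialQ I e (fun p => φ a (p, (z t, zdot z t))) c t) (Icc 0 1) t
  eq_z : ∀ t ∈ Icc (0 : ℝ) 1,
    HasDerivWithinAt (fun s => ∑ a, lam s a * partialZdot I (φ a) c z s)
      (∑ a, lam t a * partialZ I (φ a) c z t) (Icc 0 1) t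
  eq_constraint : ∀ t ∈ Icc (0 : ℝ) 1, ∀ a, φ a (velocity I c t, (z t, zdot z t)) = 0

/-- The natural boundary condition `1 - λ_a(1) ∂φ^a/∂ż = 0` at the free end point `z(1)`. -/
def NaturalBoundary (φ : Fin (k + 1) → TangentBundle I M × (ℝ × ℝ) → ℝ)
    (lam : ℝ → Fin (k + 1) → ℝ) (c : ℝ → M) (z : ℝ → ℝ) : Prop :=
  1 - ∑ a, lam 1 a * partialZdot I (φ a) c z 1 = 0

/-- The map `g : (c, z) ↦ (φ^a(c, ċ, z, ż))_a` on the smooth curves with the given end points is a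
submersion at the curve `p`.  First, the `φ^a` are independent in the velocities `(q̇, ż)` along
`p`.  Second, every smooth `h : [0,1] → ℝ^{k+1}` is the derivative of `g` along a variation of
`p` with the same end points `q₀, q₁, z₀` (with no constraint). -/
structure IsRegularCurve (φ : Fin (k + 1) → TangentBundle I M × (ℝ × ℝ) → ℝ)
    (q₀ q₁ : M) (z₀ : ℝ) (p : (ℝ → M) × (ℝ → ℝ)) : Prop where
  independent : ∀ t ∈ Icc (0 : ℝ) 1, LinearIndependent ℝ (fun a =>
    fderiv ℝ (fun y : E × ℝ => φ a ((⟨p.1 t, y.1⟩ : TangentBundle I M), (p.2 t, y.2)))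
      ((velocity I p.1 t).2, zdot p.2 t))
  surjective : ∀ h : ℝ → Fin (k + 1) → ℝ, ContDiffOn ℝ ∞ h (Icc 0 1) →
    ∃ Γ, IsVariation I q₀ q₁ z₀ univ p Γ ∧ ∀ t ∈ Icc (0 : ℝ) 1, ∀ a,
      HasDerivAt (fun s => φ a (velocity I (Γ s).1 t, ((Γ s).2 t, zdot (Γ s).2 t))) (h t a) 0

/-- `𝓛_μ(q, q̇, z, t) = L(q, q̇, z) - μ_α(t) ψ^α(q, q̇, z)`. -/
def lagrangianMu (L : TangentBundle I M × ℝ → ℝ)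
    (Φ : Fin k → TangentBundle I M × (ℝ × ℝ) → ℝ) (mu : ℝ → Fin k → ℝ)
    (t : ℝ) (x : TangentBundle I M × ℝ) : ℝ :=
  L x - ∑ α, mu t α * psi I L Φ α x

/-- `∂𝓛_μ/∂z` along the curve. -/
def lagrangianMuZ (L : TangentBundle I M × ℝ → ℝ)
    (Φ : Fin k → TangentBundle I M × (ℝ × ℝ) → ℝ) (mu : ℝ → Fin k → ℝ)
    (c : ℝ → M) (z : ℝ → ℝ) (t : ℝ) : ℝ :=
  deriv (fun y => lagrangianMu I L Φ mu t (velocity I c t, y)) (z t)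

/-- The vakonomic equations written with `λ₀` and `𝓛_μ`. -/
structure IsReducedSolution (L : TangentBundle I M × ℝ → ℝ)
    (Φ : Fin k → TangentBundle I M × (ℝ × ℝ) → ℝ) (lam₀ : ℝ → ℝ) (mu : ℝ → Fin k → ℝ)
    (c : ℝ → M) (z : ℝ → ℝ) : Prop where
  eq_q : ∀ e ∈ atlas H M, ∀ t ∈ Icc (0 : ℝ) 1, c t ∈ e.source →
    HasDerivWithinAt
      (fun s => lam₀ s • partialV I e (fun p => lagrangianMu I L Φ mu s (p, z s)) c s)
      (lam₀ t • partialQ I e (fun p => lagrangianMu I L Φ mu t (p, z t)) c t) (Icc 0 1) t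
  eq_z : ∀ t ∈ Icc (0 : ℝ) 1,
    HasDerivWithinAt lam₀ (-(lam₀ t * lagrangianMuZ I L Φ mu c z t)) (Icc 0 1) t
  eq_psi : ∀ t ∈ Icc (0 : ℝ) 1, ∀ α, psi I L Φ α (velocity I c t, z t) = 0
  eq_zdot : ∀ t ∈ Icc (0 : ℝ) 1, zdot z t = lagrangianMu I L Φ mu t (velocity I c t, z t)

/-- The vakonomic Herglotz equations for `𝓛_μ`, with `ψ^α = 0` and `ż = 𝓛_μ`. -/
structure IsHerglotzSolution (L : TangentBundle I M × ℝ → ℝ)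
    (Φ : Fin k → TangentBundle I M × (ℝ × ℝ) → ℝ) (mu : ℝ → Fin k → ℝ)
    (c : ℝ → M) (z : ℝ → ℝ) : Prop where
  herglotz : HerglotzEq I (lagrangianMu I L Φ mu) c z
  eq_psi : ∀ t ∈ Icc (0 : ℝ) 1, ∀ α, psi I L Φ α (velocity I c t, z t) = 0
  eq_zdot : ∀ t ∈ Icc (0 : ℝ) 1, zdot z t = lagrangianMu I L Φ mu t (velocity I c t, z t)

/-- The extended Lagrangian `𝓛(q, μ, q̇, μ̇, z) = L(q, q̇, z) - μ_α ψ^α(q, q̇, z)` on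
`T(M × ℝᵏ) × ℝ`. -/
def extendedLagrangian (L : TangentBundle I M × ℝ → ℝ)
    (Φ : Fin k → TangentBundle I M × (ℝ × ℝ) → ℝ)
    (x : TangentBundle (I.prod 𝓘(ℝ, Fin k → ℝ)) (M × (Fin k → ℝ)) × ℝ) : ℝ :=
  let p := (equivTangentBundleProd I M 𝓘(ℝ, Fin k → ℝ) (Fin k → ℝ) x.1).1
  L (p, x.2) - ∑ α, x.1.proj.2 α * psi I L Φ α (p, x.2)

end Constraints

end VakonomicContact

end

open Set Manifold
open scoped ContDiff

noncomputable section

namespace VakonomicContact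

/-! ### Smooth functions on `TM × W` in a chart. -/

section
variable {E : Type*} [NormedAddCommGroup E] [NormedSpace ℝ E]
  {M : Type*} [TopologicalSpace M] [ChartedSpace E M]
  {W : Type*} [NormedAddCommGroup W] [NormedSpace ℝ W]

/-! Sufficiency is the first variation formula. Pair the momentum `λ_a ∂φ^a/∂(q̇, ż)` with the
variation field of a family of curves. By (EL) and the equality of mixed derivatives, this pairing
has derivative `λ_a δφ^a` (`hasDerivWithinAt_momentum`). For a variation inside the constraint set
that is zero, so the pairing is constant. It vanishes at `t = 0`, and at `t = 1` it equals, by (B),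
the derivative of the action.

Necessity is a Lagrange multiplier rule. A finite-dimensional tube of curves `F(t, y)` around `c`,
with `∂F/∂y` onto along `c` (`exists_tube`), replaces curves in `Q × ℝ` by curves `x` in a vector
space that solve an underdetermined system `G(t, x, ẋ) = 0`. Its linearisation is `A δ' + B δ = 0`,
with `A` onto because the velocity derivatives are independent. Let `R` be the space of end points
`δ(1)` of linear solutions with `δ(0) = 0`, and `κ` the differential of the right end point in `Q`.
Three facts carry the argument. A covector that annihilates `R` equals `λ(1) A(1)` for a smooth `λ`
with `(λA)' = λB`, which is (EL) seen in the tube (`exists_multiplier`). For a regular curve, `κ`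
maps `R` onto the whole tangent space (`exists_reachable_of_isRegularCurve`). Otherwise some `η ∘ κ`
with `η ≠ 0` annihilates `R` and yields a `λ`; a variation with `δφ = λ` then has a pairing with
derivative `|λ|²` that vanishes at both ends, which forces `λ = 0` and `η = 0`. If `κ δ(1) = 0`,
there is a smooth family of true solutions with fixed ends in `Q` whose right end point moves with
velocity `δ(1)` (`exists_family_of_linearSolution`). Criticality therefore makes the `z`-component
of `δ(1)` vanish whenever `κ δ(1) = 0`, so on `R` it factors as `η ∘ κ`. The multiplier attached to
the covector "`z`-component minus `η ∘ κ`" is the required one, and its value in the direction of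
`z` is (B).

The true solutions are found in `C([0,1])`. A right inverse of `A` completes `G` to a square system
whose linearisation is the identity plus a Volterra operator, hence invertible. The inverse function
theorem yields continuous velocities depending smoothly on the parameter, and differentiating the
implicit equation repeatedly gives joint smoothness (`contDiffOn_of_implicit_family`).

The rest is calculus along one curve. Where `ż = L`, the derivatives of `ψ^α` are those of `φ^α`
plus `∂φ^α/∂ż` times those of `L`, and `λ'_0` absorbs the difference. Without `ż` in the `φ^α` one
has `𝓛_μ = ż - φ⁰ - μ_α ψ^α`, so `λ₀` is an integrating factor for the Herglotz equation, and
conversely `λ₀ = exp ∫ₜ¹ ∂𝓛_μ/∂z` works. The extended Lagrangian does not involve `μ̇`, so its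
equations in the directions of `μ` read `ψ^α = 0`. -/

theorem contMDiff_tangentBundle_mk :
    ContMDiff 𝓘(ℝ, E × E) 𝓘(ℝ, E).tangent ∞
      (fun p : E × E => (⟨p.1, p.2⟩ : TangentBundle 𝓘(ℝ, E) E)) := by
  have h2 : ContMDiff (M' := ModelProd E E) 𝓘(ℝ, E × E) 𝓘(ℝ, E).tangent ∞
      (fun p : E × E => p) := by
    rw [ModelWithCorners.tangent, modelWithCornersSelf_prod]
    exact contMDiff_id
  exact (contMDiff_tangentBundleModelSpaceHomeomorph_symm (I := 𝓘(ℝ, E)) (n := ∞)).comp h2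

/-- The expression `(x, v, ω) ↦ φ (x, v, ω)` of a function on `TM × W` in the chart `e`. -/
def chartRep (e : OpenPartialHomeomorph M E) (φ : TangentBundle 𝓘(ℝ, E) M × W → ℝ)
    (p : E × E × W) : ℝ :=
  φ (chartPoint 𝓘(ℝ, E) e p.1 p.2.1, p.2.2)

/-- The differential of the inverse of the chart `e` at `e x`, as a map `E → T_x M = E`. -/
def chartFrame (e : OpenPartialHomeomorph M E) (x : M) : E →L[ℝ] E :=
  mfderiv 𝓘(ℝ, E) 𝓘(ℝ, E) e.symm (e x)

theorem chartPoint_apply {e : OpenPartialHomeomorph M E} {x : M} (hx : x ∈ e.source) (v : E) :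
    chartPoint 𝓘(ℝ, E) e (e x) v = ⟨x, chartFrame e x v⟩ := by
  have : e.symm (e x) = x := e.left_inv hx
  simp only [chartPoint, chartFrame]
  exact Bundle.TotalSpace.ext this HEq.rfl

variable [IsManifold 𝓘(ℝ, E) ∞ M]

theorem contMDiffOn_chartPoint {e : OpenPartialHomeomorph M E} (he : e ∈ atlas E M) :
    ContMDiffOn 𝓘(ℝ, E × E) 𝓘(ℝ, E).tangent ∞
      (fun p : E × E => chartPoint 𝓘(ℝ, E) e p.1 p.2) (e.target ×ˢ univ) := by
  have h1 : ContMDiffOn 𝓘(ℝ, E) 𝓘(ℝ, E) ∞ e.symm e.target :=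
    contMDiffOn_symm_of_mem_maximalAtlas (IsManifold.subset_maximalAtlas he)
  have h2 := h1.contMDiffOn_tangentMapWithin (m := ∞) (by simp) e.open_target.uniqueMDiffOn
  have h3 := contMDiff_tangentBundle_mk (E := E)
  refine (h2.comp h3.contMDiffOn (s := e.target ×ˢ univ) ?_).congr ?_
  · intro p hp; simpa using hp.1
  · intro p hp
    simp only [chartPoint, tangentMapWithin, Function.comp_def, mfderivWithin_of_isOpen e.open_target hp.1]
    rfl

/-- The tangent map of the inverse chart is smooth, and `chartRep` is composition with it. This
turns all the partial derivatives of the statement into restrictions of one Fréchet derivative on `E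
× E × W`. -/
theorem contDiffOn_chartRep {e : OpenPartialHomeomorph M E} (he : e ∈ atlas E M)
    {φ : TangentBundle 𝓘(ℝ, E) M × W → ℝ}
    (hφ : ContMDiff (𝓘(ℝ, E).tangent.prod 𝓘(ℝ, W)) 𝓘(ℝ, ℝ) ∞ φ) :
    ContDiffOn ℝ ∞ (chartRep e φ) (e.target ×ˢ univ) := by
  rw [← contMDiffOn_iff_contDiffOn]
  have h1 : ContMDiff 𝓘(ℝ, E × E × W) 𝓘(ℝ, E × E) ∞ (fun p : E × E × W => (p.1, p.2.1)) :=
    ContDiff.contMDiff (by fun_prop)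
  have h2 : ContMDiff 𝓘(ℝ, E × E × W) 𝓘(ℝ, W) ∞ (fun p : E × E × W => p.2.2) :=
    ContDiff.contMDiff (by fun_prop)
  exact hφ.comp_contMDiffOn (((contMDiffOn_chartPoint he).comp h1.contMDiffOn
    (fun p hp => ⟨hp.1, trivial⟩)).prodMk h2.contMDiffOn)

theorem contDiffAt_chartRep {e : OpenPartialHomeomorph M E} (he : e ∈ atlas E M)
    {φ : TangentBundle 𝓘(ℝ, E) M × W → ℝ}
    (hφ : ContMDiff (𝓘(ℝ, E).tangent.prod 𝓘(ℝ, W)) 𝓘(ℝ, ℝ) ∞ φ) {p : E × E × W}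
    (hp : p.1 ∈ e.target) : ContDiffAt ℝ ∞ (chartRep e φ) p :=
  (contDiffOn_chartRep he hφ).contDiffAt
    ((e.open_target.prod isOpen_univ).mem_nhds ⟨hp, trivial⟩)

theorem contMDiffAt_chart {e : OpenPartialHomeomorph M E} (he : e ∈ atlas E M) {x : M}
    (hx : x ∈ e.source) : ContMDiffAt 𝓘(ℝ, E) 𝓘(ℝ, E) ∞ e x :=
  contMDiffAt_of_mem_maximalAtlas (IsManifold.subset_maximalAtlas he) hx

theorem contMDiffAt_chart_symm {e : OpenPartialHomeomorph M E} (he : e ∈ atlas E M) {x : E}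
    (hx : x ∈ e.target) : ContMDiffAt 𝓘(ℝ, E) 𝓘(ℝ, E) ∞ e.symm x :=
  contMDiffAt_symm_of_mem_maximalAtlas (IsManifold.subset_maximalAtlas he) hx

variable {F : Type*} [NormedAddCommGroup F] [NormedSpace ℝ F]

/-- Chain rule for `e ∘ f`, followed by the fact that the differentials of `e` and of `e.symm` are
inverse to each other. It translates between intrinsic velocities or variation fields and their
coordinates. -/
theorem chartFrame_mfderivWithin {e : OpenPartialHomeomorph M E} (he : e ∈ atlas E M)
    {f : F → M} {s : Set F} {p : F} (hf : ContMDiffWithinAt 𝓘(ℝ, F) 𝓘(ℝ, E) ∞ f s p)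
    (hs : UniqueDiffWithinAt ℝ s p) (hp : f p ∈ e.source) (v : F) :
    chartFrame e (f p) (fderivWithin ℝ (fun q => e (f q)) s p v) =
      mfderivWithin 𝓘(ℝ, F) 𝓘(ℝ, E) f s p v := by
  have h1 : MDifferentiableWithinAt 𝓘(ℝ, F) 𝓘(ℝ, E) f s p := hf.mdifferentiableWithinAt (by simp)
  have h2 := (contMDiffAt_chart he hp).mdifferentiableAt (by simp)
  have hd := mdifferentiable_of_mem_atlas (I := 𝓘(ℝ, E)) he
  have h3 : fderivWithin ℝ (fun q => e (f q)) s p = _ :=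
    mfderivWithin_eq_fderivWithin.symm.trans (mfderiv_comp_mfderivWithin p h2 h1 hs.uniqueMDiffWithinAt)
  rw [h3]
  have := hd.symm_comp_deriv hp
  exact DFunLike.congr_fun this (mfderivWithin 𝓘(ℝ, F) 𝓘(ℝ, E) f s p v)

theorem bijective_chartFrame {e : OpenPartialHomeomorph M E} (he : e ∈ atlas E M) {x : M}
    (hx : x ∈ e.source) : Function.Bijective (chartFrame e x) :=
  (mdifferentiable_of_mem_atlas (I := 𝓘(ℝ, E)) he).symm.mfderiv_bijective (e.map_source hx)
end

/-! ### Partial derivatives along a curve, in charts and in the fibre. -/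

section
variable {E : Type*} [NormedAddCommGroup E] [NormedSpace ℝ E]
  {M : Type*} [TopologicalSpace M] [ChartedSpace E M]
  {W : Type*} [NormedAddCommGroup W] [NormedSpace ℝ W]

theorem uniqueDiffWithinAt_unitInterval {t : ℝ} (ht : t ∈ Icc (0 : ℝ) 1) :
    UniqueDiffWithinAt ℝ (Icc (0 : ℝ) 1) t :=
  uniqueDiffOn_Icc zero_lt_one t ht

/-- The derivative of `φ` along the fibre of `TM` at the velocity of the curve `c`. -/
def fibreDeriv (φ : TangentBundle 𝓘(ℝ, E) M × W → ℝ) (c : ℝ → M) (u : W) (t : ℝ) : E →L[ℝ] ℝ :=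
  fderiv ℝ (fun v : E => φ ((⟨c t, v⟩ : TangentBundle 𝓘(ℝ, E) M), u)) (velocity 𝓘(ℝ, E) c t).2

variable {e : OpenPartialHomeomorph M E} {c : ℝ → M} {t : ℝ}

theorem eventually_mem_source (hc : ContMDiffOn 𝓘(ℝ, ℝ) 𝓘(ℝ, E) ∞ c (Icc 0 1))
    (ht : t ∈ Icc (0 : ℝ) 1) (hs : c t ∈ e.source) :
    ∀ᶠ s in nhdsWithin t (Icc 0 1), s ∈ Icc (0 : ℝ) 1 ∧ c s ∈ e.source :=
  (eventually_mem_nhdsWithin).and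
    ((hc.continuousOn t ht).eventually (e.open_source.mem_nhds hs))

variable [IsManifold 𝓘(ℝ, E) ∞ M]

theorem contDiffWithinAt_chart_comp (he : e ∈ atlas E M)
    (hc : ContMDiffOn 𝓘(ℝ, ℝ) 𝓘(ℝ, E) ∞ c (Icc 0 1))
    (ht : t ∈ Icc (0 : ℝ) 1) (hs : c t ∈ e.source) :
    ContDiffWithinAt ℝ ∞ (fun s => e (c s)) (Icc 0 1) t := by
  rw [← contMDiffWithinAt_iff_contDiffWithinAt]
  exact (contMDiffAt_chart he hs).comp_contMDiffWithinAt t (hc t ht)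

theorem contDiffWithinAt_chartVelocity (he : e ∈ atlas E M)
    (hc : ContMDiffOn 𝓘(ℝ, ℝ) 𝓘(ℝ, E) ∞ c (Icc 0 1))
    (ht : t ∈ Icc (0 : ℝ) 1) (hs : c t ∈ e.source) :
    ContDiffWithinAt ℝ ∞ (chartVelocity 𝓘(ℝ, E) e c) (Icc 0 1) t :=
  ((contDiffWithinAt_chart_comp he hc ht hs).derivWithin
    (uniqueDiffOn_Icc zero_lt_one) (m := ∞) (by simp) ht :)

theorem contDiffOn_zdot {z : ℝ → ℝ} (hz : ContDiffOn ℝ ∞ z (Icc 0 1)) :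
    ContDiffOn ℝ ∞ (zdot z) (Icc 0 1) :=
  hz.derivWithin (uniqueDiffOn_Icc zero_lt_one) (by simp)

theorem chartFrame_chartVelocity (he : e ∈ atlas E M)
    (hc : ContMDiffOn 𝓘(ℝ, ℝ) 𝓘(ℝ, E) ∞ c (Icc 0 1))
    (ht : t ∈ Icc (0 : ℝ) 1) (hs : c t ∈ e.source) :
    chartFrame e (c t) (chartVelocity 𝓘(ℝ, E) e c t) = (velocity 𝓘(ℝ, E) c t).2 := by
  rw [velocity, ← chartFrame_mfderivWithin he (hc t ht) (uniqueDiffWithinAt_unitInterval ht) hs]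
  rfl

theorem chartPoint_velocity (he : e ∈ atlas E M)
    (hc : ContMDiffOn 𝓘(ℝ, ℝ) 𝓘(ℝ, E) ∞ c (Icc 0 1))
    (ht : t ∈ Icc (0 : ℝ) 1) (hs : c t ∈ e.source) :
    chartPoint 𝓘(ℝ, E) e (e (c t)) (chartVelocity 𝓘(ℝ, E) e c t) = velocity 𝓘(ℝ, E) c t := by
  rw [chartPoint_apply hs, chartFrame_chartVelocity he hc ht hs]
  rfl

variable {φ : TangentBundle 𝓘(ℝ, E) M × W → ℝ}
    (hφ : ContMDiff (𝓘(ℝ, E).tangent.prod 𝓘(ℝ, W)) 𝓘(ℝ, ℝ) ∞ φ)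

theorem differentiableAt_chartRep (he : e ∈ atlas E M)
    (hφ : ContMDiff (𝓘(ℝ, E).tangent.prod 𝓘(ℝ, W)) 𝓘(ℝ, ℝ) ∞ φ) (hs : c t ∈ e.source)
    (v : E) (u : W) : DifferentiableAt ℝ (chartRep e φ) (e (c t), v, u) :=
  (contDiffAt_chartRep he hφ (e.map_source hs)).differentiableAt (by simp)

theorem partialQ_eq (he : e ∈ atlas E M)
    (hφ : ContMDiff (𝓘(ℝ, E).tangent.prod 𝓘(ℝ, W)) 𝓘(ℝ, ℝ) ∞ φ) (hs : c t ∈ e.source) (u : W) :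
    partialQ 𝓘(ℝ, E) e (fun p => φ (p, u)) c t =
      (fderiv ℝ (chartRep e φ) (e (c t), chartVelocity 𝓘(ℝ, E) e c t, u)).comp
        (.inl ℝ E (E × W)) :=
  HasFDerivAt.fderiv (HasFDerivAt.comp (f := fun x => (x, chartVelocity 𝓘(ℝ, E) e c t, u))
    (e (c t)) (differentiableAt_chartRep he hφ hs _ u).hasFDerivAt
    (hasFDerivAt_prodMk_left (𝕜 := ℝ) (e (c t)) (chartVelocity 𝓘(ℝ, E) e c t, u)))

theorem partialV_eq (he : e ∈ atlas E M)
    (hφ : ContMDiff (𝓘(ℝ, E).tangent.prod 𝓘(ℝ, W)) 𝓘(ℝ, ℝ) ∞ φ) (hs : c t ∈ e.source) (u : W) :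
    partialV 𝓘(ℝ, E) e (fun p => φ (p, u)) c t =
      (fderiv ℝ (chartRep e φ) (e (c t), chartVelocity 𝓘(ℝ, E) e c t, u)).comp
        ((ContinuousLinearMap.inr ℝ E (E × W)).comp (.inl ℝ E W)) :=
  HasFDerivAt.fderiv (HasFDerivAt.comp (f := fun v => (e (c t), v, u))
    (chartVelocity 𝓘(ℝ, E) e c t) (differentiableAt_chartRep he hφ hs _ u).hasFDerivAt
    (HasFDerivAt.comp (f := fun v => (v, u)) (chartVelocity 𝓘(ℝ, E) e c t)
      (hasFDerivAt_prodMk_right (𝕜 := ℝ) (e (c t)) (chartVelocity 𝓘(ℝ, E) e c t, u))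
      (hasFDerivAt_prodMk_left (𝕜 := ℝ) (chartVelocity 𝓘(ℝ, E) e c t) u)))

theorem exists_inverse_chartFrame (he : e ∈ atlas E M) {x : M} (hx : x ∈ e.source) :
    ∃ T : E →L[ℝ] E, (∀ v, T (chartFrame e x v) = v) ∧ ∀ v, chartFrame e x (T v) = v := by
  have hd := mdifferentiable_of_mem_atlas (I := 𝓘(ℝ, E)) he
  refine ⟨(mfderiv 𝓘(ℝ, E) 𝓘(ℝ, E) e x : E →L[ℝ] E), fun v => ?_, fun v => ?_⟩
  · have h := hd.comp_symm_deriv (e.map_source hx)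
    rw [e.left_inv hx] at h
    exact DFunLike.congr_fun h v
  · exact DFunLike.congr_fun (hd.symm_comp_deriv hx) v

/-- The derivative of `φ` in the fibre of `TM` and in the parameter. -/
theorem exists_hasFDerivAt_fibre (he : e ∈ atlas E M)
    (hφ : ContMDiff (𝓘(ℝ, E).tangent.prod 𝓘(ℝ, W)) 𝓘(ℝ, ℝ) ∞ φ)
    (hc : ContMDiffOn 𝓘(ℝ, ℝ) 𝓘(ℝ, E) ∞ c (Icc 0 1))
    (ht : t ∈ Icc (0 : ℝ) 1) (hs : c t ∈ e.source) (u : W) :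
    ∃ D : E × W →L[ℝ] ℝ,
      HasFDerivAt (fun y : E × W => φ ((⟨c t, y.1⟩ : TangentBundle 𝓘(ℝ, E) M), y.2)) D
        ((velocity 𝓘(ℝ, E) c t).2, u) ∧
      ∀ v y, D (chartFrame e (c t) v, y) =
        fderiv ℝ (chartRep e φ) (e (c t), chartVelocity 𝓘(ℝ, E) e c t, u) (0, v, y) := by
  obtain ⟨T, hT, hT'⟩ := exists_inverse_chartFrame he hs
  have hv : T (velocity 𝓘(ℝ, E) c t).2 = chartVelocity 𝓘(ℝ, E) e c t := by
    rw [← chartFrame_chartVelocity he hc ht hs, hT]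
  have h1 : (fun y : E × W => φ ((⟨c t, y.1⟩ : TangentBundle 𝓘(ℝ, E) M), y.2)) =
      fun y : E × W => chartRep e φ (e (c t), T y.1, y.2) := by
    funext y
    rw [chartRep, chartPoint_apply hs, hT']
  have h2 : HasFDerivAt (fun y : E × W => (e (c t), T y.1, y.2))
      ((0 : E × W →L[ℝ] E).prod ((T.comp (.fst ℝ E W)).prod (.snd ℝ E W)))
      ((velocity 𝓘(ℝ, E) c t).2, u) :=
    (hasFDerivAt_const _ _).prodMk
      ((T.comp (.fst ℝ E W)).prod (.snd ℝ E W)).hasFDerivAt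
  have h3 : HasFDerivAt (chartRep e φ)
      (fderiv ℝ (chartRep e φ) (e (c t), chartVelocity 𝓘(ℝ, E) e c t, u))
      (e (c t), T (velocity 𝓘(ℝ, E) c t).2, u) := by
    rw [hv]
    exact (differentiableAt_chartRep he hφ hs _ u).hasFDerivAt
  rw [h1]
  refine ⟨_, HasFDerivAt.comp (f := fun y : E × W => (e (c t), T y.1, y.2))
    (g := chartRep e φ) _ h3 h2, fun v y => ?_⟩
  simp [hT]

theorem fibreDeriv_chartFrame (he : e ∈ atlas E M)
    (hφ : ContMDiff (𝓘(ℝ, E).tangent.prod 𝓘(ℝ, W)) 𝓘(ℝ, ℝ) ∞ φ)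
    (hc : ContMDiffOn 𝓘(ℝ, ℝ) 𝓘(ℝ, E) ∞ c (Icc 0 1))
    (ht : t ∈ Icc (0 : ℝ) 1) (hs : c t ∈ e.source) (u : W) (v : E) :
    fibreDeriv φ c u t (chartFrame e (c t) v) =
      partialV 𝓘(ℝ, E) e (fun p => φ (p, u)) c t v := by
  obtain ⟨D, hD, h⟩ := exists_hasFDerivAt_fibre he hφ hc ht hs u
  have h1 := HasFDerivAt.comp (E := E) (velocity 𝓘(ℝ, E) c t).2 hD
    (hasFDerivAt_prodMk_left (𝕜 := ℝ) (E := E) (velocity 𝓘(ℝ, E) c t).2 u)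
  have h2 : fibreDeriv φ c u t = _ := h1.fderiv
  rw [h2, partialV_eq he hφ hs]
  simpa using h v 0

theorem hasFDerivAt_parameter (he : e ∈ atlas E M)
    (hφ : ContMDiff (𝓘(ℝ, E).tangent.prod 𝓘(ℝ, W)) 𝓘(ℝ, ℝ) ∞ φ)
    (hc : ContMDiffOn 𝓘(ℝ, ℝ) 𝓘(ℝ, E) ∞ c (Icc 0 1))
    (ht : t ∈ Icc (0 : ℝ) 1) (hs : c t ∈ e.source) (u : W) :
    HasFDerivAt (fun y : W => φ (velocity 𝓘(ℝ, E) c t, y))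
      ((fderiv ℝ (chartRep e φ) (e (c t), chartVelocity 𝓘(ℝ, E) e c t, u)).comp
        ((ContinuousLinearMap.inr ℝ E (E × W)).comp (.inr ℝ E W))) u := by
  rw [← chartPoint_velocity he hc ht hs]
  exact (differentiableAt_chartRep he hφ hs _ u).hasFDerivAt.comp u
    ((hasFDerivAt_prodMk_right (𝕜 := ℝ) (e (c t)) (chartVelocity 𝓘(ℝ, E) e c t, u)).comp _
      (hasFDerivAt_prodMk_right (𝕜 := ℝ) (chartVelocity 𝓘(ℝ, E) e c t) u))

theorem partialZ_eq {φ : TangentBundle 𝓘(ℝ, E) M × (ℝ × ℝ) → ℝ} (he : e ∈ atlas E M)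
    (hφ : ContMDiff (𝓘(ℝ, E).tangent.prod 𝓘(ℝ, ℝ × ℝ)) 𝓘(ℝ, ℝ) ∞ φ)
    (hc : ContMDiffOn 𝓘(ℝ, ℝ) 𝓘(ℝ, E) ∞ c (Icc 0 1))
    (ht : t ∈ Icc (0 : ℝ) 1) (hs : c t ∈ e.source) (z : ℝ → ℝ) :
    partialZ 𝓘(ℝ, E) φ c z t =
      fderiv ℝ (chartRep e φ) (e (c t), chartVelocity 𝓘(ℝ, E) e c t, z t, zdot z t)
        (0, 0, 1, 0) := by
  have h := (hasFDerivAt_parameter he hφ hc ht hs (z t, zdot z t)).comp (z t)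
    (hasFDerivAt_prodMk_left (𝕜 := ℝ) (z t) (zdot z t))
  exact h.hasDerivAt.deriv

theorem partialZdot_eq {φ : TangentBundle 𝓘(ℝ, E) M × (ℝ × ℝ) → ℝ} (he : e ∈ atlas E M)
    (hφ : ContMDiff (𝓘(ℝ, E).tangent.prod 𝓘(ℝ, ℝ × ℝ)) 𝓘(ℝ, ℝ) ∞ φ)
    (hc : ContMDiffOn 𝓘(ℝ, ℝ) 𝓘(ℝ, E) ∞ c (Icc 0 1))
    (ht : t ∈ Icc (0 : ℝ) 1) (hs : c t ∈ e.source) (z : ℝ → ℝ) :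
    partialZdot 𝓘(ℝ, E) φ c z t =
      fderiv ℝ (chartRep e φ) (e (c t), chartVelocity 𝓘(ℝ, E) e c t, z t, zdot z t)
        (0, 0, 0, 1) := by
  have h := (hasFDerivAt_parameter he hφ hc ht hs (z t, zdot z t)).comp (zdot z t)
    (hasFDerivAt_prodMk_right (𝕜 := ℝ) (z t) (zdot z t))
  exact h.hasDerivAt.deriv

/-- The coordinates of `(c, ċ, z, ż)` in the chart `e`. -/
def chartJet (e : OpenPartialHomeomorph M E) (c : ℝ → M) (z : ℝ → ℝ) (t : ℝ) : E × E × ℝ × ℝ :=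
  (e (c t), chartVelocity 𝓘(ℝ, E) e c t, z t, zdot z t)

theorem contDiffWithinAt_chartJet (he : e ∈ atlas E M)
    (hc : ContMDiffOn 𝓘(ℝ, ℝ) 𝓘(ℝ, E) ∞ c (Icc 0 1)) {z : ℝ → ℝ}
    (hz : ContDiffOn ℝ ∞ z (Icc 0 1)) (ht : t ∈ Icc (0 : ℝ) 1) (hs : c t ∈ e.source) :
    ContDiffWithinAt ℝ ∞ (chartJet e c z) (Icc 0 1) t :=
  (contDiffWithinAt_chart_comp he hc ht hs).prodMk
    ((contDiffWithinAt_chartVelocity he hc ht hs).prodMk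
      ((hz t ht).prodMk (contDiffOn_zdot hz t ht)))

theorem contDiffWithinAt_fderiv_chartJet {φ : TangentBundle 𝓘(ℝ, E) M × (ℝ × ℝ) → ℝ}
    (he : e ∈ atlas E M) (hφ : ContMDiff (𝓘(ℝ, E).tangent.prod 𝓘(ℝ, ℝ × ℝ)) 𝓘(ℝ, ℝ) ∞ φ)
    (hc : ContMDiffOn 𝓘(ℝ, ℝ) 𝓘(ℝ, E) ∞ c (Icc 0 1)) {z : ℝ → ℝ}
    (hz : ContDiffOn ℝ ∞ z (Icc 0 1)) (ht : t ∈ Icc (0 : ℝ) 1) (hs : c t ∈ e.source) :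
    ContDiffWithinAt ℝ ∞ (fun s => fderiv ℝ (chartRep e φ) (chartJet e c z s)) (Icc 0 1) t :=
  ((contDiffAt_chartRep he hφ (p := chartJet e c z t) (e.map_source hs)).fderiv_right
    (m := ∞) (by simp)).comp_contDiffWithinAt t (contDiffWithinAt_chartJet he hc hz ht hs)
end

/-! ### Mixed derivatives on a strip. -/

section
variable {F : Type*} [NormedAddCommGroup F] [NormedSpace ℝ F]

theorem uniqueDiffOn_strip (ε : ℝ) :
    UniqueDiffOn ℝ (Ioo (-ε) ε ×ˢ Icc (0 : ℝ) 1) :=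
  isOpen_Ioo.uniqueDiffOn.prod (uniqueDiffOn_Icc zero_lt_one)

theorem hasDerivAt_left_of_hasFDerivWithinAt {g : ℝ × ℝ → F} {ε s t : ℝ} {D : ℝ × ℝ →L[ℝ] F}
    (hs : s ∈ Ioo (-ε) ε) (ht : t ∈ Icc (0 : ℝ) 1)
    (hg : HasFDerivWithinAt g D (Ioo (-ε) ε ×ˢ Icc (0 : ℝ) 1) (s, t)) :
    HasDerivAt (fun r => g (r, t)) (D (1, 0)) s := by
  have h1 : HasDerivWithinAt (fun r : ℝ => (r, t)) ((1 : ℝ), (0 : ℝ)) (Ioo (-ε) ε) s :=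
    (hasDerivWithinAt_id _ _).prodMk (hasDerivWithinAt_const _ _ _)
  have h2 : MapsTo (fun r : ℝ => (r, t)) (Ioo (-ε) ε) (Ioo (-ε) ε ×ˢ Icc (0 : ℝ) 1) :=
    fun r hr => ⟨hr, ht⟩
  exact (hg.comp_hasDerivWithinAt s h1 h2).hasDerivAt (isOpen_Ioo.mem_nhds hs)

theorem hasDerivWithinAt_right_of_hasFDerivWithinAt {g : ℝ × ℝ → F} {ε s t : ℝ}
    {D : ℝ × ℝ →L[ℝ] F} (hs : s ∈ Ioo (-ε) ε)
    (hg : HasFDerivWithinAt g D (Ioo (-ε) ε ×ˢ Icc (0 : ℝ) 1) (s, t)) :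
    HasDerivWithinAt (fun r => g (s, r)) (D (0, 1)) (Icc 0 1) t := by
  have h1 : HasDerivWithinAt (fun r : ℝ => (s, r)) ((0 : ℝ), (1 : ℝ)) (Icc 0 1) t :=
    (hasDerivWithinAt_const _ _ _).prodMk (hasDerivWithinAt_id _ _)
  exact hg.comp_hasDerivWithinAt t h1 (fun r hr => ⟨hs, hr⟩)

/-- Equality of the mixed partial derivatives on a strip that is closed in the second variable. -/
theorem exists_mixed_derivative {g : ℝ × ℝ → F} {ε t : ℝ} (hε : 0 < ε) (ht : t ∈ Icc (0 : ℝ) 1)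
    (hg : ContDiffWithinAt ℝ ∞ g (Ioo (-ε) ε ×ˢ Icc (0 : ℝ) 1) (0, t)) :
    ∃ V' : F, HasDerivWithinAt (fun r => deriv (fun s => g (s, r)) 0) V' (Icc 0 1) t ∧
      HasDerivAt (fun s => derivWithin (fun r => g (s, r)) (Icc 0 1) t) V' 0 ∧
      HasDerivAt (fun s => g (s, t)) (deriv (fun s => g (s, t)) 0) 0 := by
  set u := Ioo (-ε) ε ×ˢ Icc (0 : ℝ) 1 with hu
  have hud : UniqueDiffOn ℝ u := uniqueDiffOn_strip ε
  have h0 : (0 : ℝ) ∈ Ioo (-ε) ε := ⟨by linarith, hε⟩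
  have hmem : ((0 : ℝ), t) ∈ u := ⟨h0, ht⟩
  -- Symmetry of the second derivative within a set needs a limit of interior points; the strip
  -- provides this also at `t = 0` and `t = 1`.
  have hcl : ((0 : ℝ), t) ∈ closure (interior u) := by
    rw [hu, interior_prod_eq, closure_prod_eq, interior_Ioo, interior_Icc, closure_Ioo (by intro h; linarith),
      closure_Ioo zero_ne_one]
    exact ⟨Ioo_subset_Icc_self h0, ht⟩
  have hsymm := hg.isSymmSndFDerivWithinAt
    (by simpa using! (ENat.LEInfty.out : (2 : WithTop ℕ∞) ≤ ∞)) hud hcl hmem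
  have hD2 : HasFDerivWithinAt (fderivWithin ℝ g u) (fderivWithin ℝ (fderivWithin ℝ g u) u (0, t))
      u (0, t) :=
    ((hg.fderivWithin_right hud (m := 1) (by norm_num; exact ENat.LEInfty.out) hmem).differentiableWithinAt
      (by simp)).hasFDerivWithinAt
  have hev : ∀ᶠ p in nhdsWithin ((0 : ℝ), t) u, HasFDerivWithinAt g (fderivWithin ℝ g u p) u p := by
    have h1 := (hg.of_le (m := 1) (by simp)).eventually (by simp)
    rw [insert_eq_of_mem hmem] at h1
    filter_upwards [h1] with p hp
    exact (hp.differentiableWithinAt (by simp)).hasFDerivWithinAt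
  have ht0 : Filter.Tendsto (fun r : ℝ => ((0 : ℝ), r)) (nhdsWithin t (Icc 0 1))
      (nhdsWithin (0, t) u) :=
    (Continuous.continuousWithinAt (by fun_prop)).tendsto_nhdsWithin (fun r hr => ⟨h0, hr⟩)
  have hs0 : Filter.Tendsto (fun s : ℝ => (s, t)) (nhds 0) (nhdsWithin (0, t) u) := by
    refine tendsto_nhdsWithin_iff.2 ⟨Continuous.tendsto' (by fun_prop) _ _ rfl, ?_⟩
    filter_upwards [isOpen_Ioo.mem_nhds h0] with s hs using ⟨hs, ht⟩
  refine ⟨fderivWithin ℝ (fderivWithin ℝ g u) u (0, t) (0, 1) (1, 0), ?_, ?_, ?_⟩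
  · have h1 := (hasDerivWithinAt_right_of_hasFDerivWithinAt h0 hD2).clm_apply
      (hasDerivWithinAt_const t (Icc 0 1) ((1 : ℝ), (0 : ℝ)))
    simp only [map_zero, add_zero] at h1
    have h2 : ∀ᶠ r in nhdsWithin t (Icc 0 1),
        deriv (fun s => g (s, r)) 0 = fderivWithin ℝ g u (0, r) (1, 0) := by
      filter_upwards [ht0.eventually hev, self_mem_nhdsWithin] with r hr hr'
      exact (hasDerivAt_left_of_hasFDerivWithinAt h0 hr' hr).deriv
    exact h1.congr_of_eventuallyEq h2 (h2.self_of_nhdsWithin ht)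
  · have h1 := (hasDerivAt_left_of_hasFDerivWithinAt h0 ht hD2).clm_apply
      (hasDerivAt_const (0 : ℝ) ((0 : ℝ), (1 : ℝ)))
    simp only [map_zero, add_zero] at h1
    rw [hsymm.eq]
    refine h1.congr_of_eventuallyEq ?_
    filter_upwards [hs0.eventually hev, isOpen_Ioo.mem_nhds h0] with s hs hs'
    exact (hasDerivWithinAt_right_of_hasFDerivWithinAt hs' hs).derivWithin
      (uniqueDiffWithinAt_unitInterval ht)
  · have h1 := hasDerivAt_left_of_hasFDerivWithinAt h0 ht (hev.self_of_nhdsWithin hmem)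
    rwa [h1.deriv]
end

/-! ### Families of curves and the first variation. -/

section
variable (E : Type*) [NormedAddCommGroup E] [NormedSpace ℝ E]
  {M : Type*} [TopologicalSpace M] [ChartedSpace E M]

/-- The data of a smooth one-parameter family of curves through `(c, z)`, without any condition at
the end points. -/
structure IsFamily (c : ℝ → M) (z : ℝ → ℝ) (ε : ℝ) (Γ : ℝ → (ℝ → M) × (ℝ → ℝ)) : Prop where
  pos : 0 < ε
  smooth_fst : ContMDiffOn 𝓘(ℝ, ℝ × ℝ) 𝓘(ℝ, E) ∞ (fun x : ℝ × ℝ => (Γ x.1).1 x.2)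
    (Ioo (-ε) ε ×ˢ Icc 0 1)
  smooth_snd : ContDiffOn ℝ ∞ (fun x : ℝ × ℝ => (Γ x.1).2 x.2) (Ioo (-ε) ε ×ˢ Icc 0 1)
  eq_fst : EqOn (Γ 0).1 c (Icc 0 1)
  eq_snd : EqOn (Γ 0).2 z (Icc 0 1)

/-- The variation vector field of a family of curves. -/
def variationField (Γ : ℝ → (ℝ → M) × (ℝ → ℝ)) (t : ℝ) : E :=
  mfderiv 𝓘(ℝ, ℝ) 𝓘(ℝ, E) (fun s => (Γ s).1 t) 0 (1 : ℝ)

variable {E}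

/-- The `z`-component of the variation vector field of a family of curves. -/
def variationZ (Γ : ℝ → (ℝ → M) × (ℝ → ℝ)) (t : ℝ) : ℝ :=
  deriv (fun s => (Γ s).2 t) 0

/-- The variation vector field in the coordinates of the chart `e`. -/
def chartVariation (e : OpenPartialHomeomorph M E) (Γ : ℝ → (ℝ → M) × (ℝ → ℝ)) (t : ℝ) : E :=
  deriv (fun s => e ((Γ s).1 t)) 0

namespace IsFamily

variable {c : ℝ → M} {z : ℝ → ℝ} {ε : ℝ} {Γ : ℝ → (ℝ → M) × (ℝ → ℝ)} {t : ℝ}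

theorem zero_mem (h : IsFamily E c z ε Γ) : (0 : ℝ) ∈ Ioo (-ε) ε :=
  ⟨by linarith [h.pos], h.pos⟩

theorem contMDiffOn_fst (h : IsFamily E c z ε Γ) {s : ℝ} (hs : s ∈ Ioo (-ε) ε) :
    ContMDiffOn 𝓘(ℝ, ℝ) 𝓘(ℝ, E) ∞ (Γ s).1 (Icc 0 1) := by
  have h1 : ContMDiff 𝓘(ℝ, ℝ) 𝓘(ℝ, ℝ × ℝ) ∞ (fun r : ℝ => (s, r)) :=
    ContDiff.contMDiff (by fun_prop)
  exact h.smooth_fst.comp h1.contMDiffOn (fun r hr => ⟨hs, hr⟩)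

theorem contMDiffAt_parameter (h : IsFamily E c z ε Γ) (ht : t ∈ Icc (0 : ℝ) 1) :
    ContMDiffAt 𝓘(ℝ, ℝ) 𝓘(ℝ, E) ∞ (fun s => (Γ s).1 t) 0 := by
  have h1 : ContMDiff 𝓘(ℝ, ℝ) 𝓘(ℝ, ℝ × ℝ) ∞ (fun s : ℝ => (s, t)) :=
    ContDiff.contMDiff (by fun_prop)
  have h2 : ContMDiffOn 𝓘(ℝ, ℝ) 𝓘(ℝ, E) ∞ (fun s => (Γ s).1 t) (Ioo (-ε) ε) :=
    h.smooth_fst.comp h1.contMDiffOn (fun r hr => ⟨hr, ht⟩)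
  exact h2.contMDiffAt (isOpen_Ioo.mem_nhds h.zero_mem)

variable [IsManifold 𝓘(ℝ, E) ∞ M] {e : OpenPartialHomeomorph M E}

theorem chartFrame_chartVariation (h : IsFamily E c z ε Γ) (he : e ∈ atlas E M)
    (ht : t ∈ Icc (0 : ℝ) 1) (hs : c t ∈ e.source) :
    chartFrame e (c t) (chartVariation e Γ t) = variationField E Γ t := by
  have h1 := chartFrame_mfderivWithin he (h.contMDiffAt_parameter ht).contMDiffWithinAt
    uniqueDiffWithinAt_univ (by rwa [h.eq_fst ht]) (1 : ℝ)
  rw [mfderivWithin_univ, fderivWithin_univ, h.eq_fst ht] at h1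
  exact h1

/-- The vector `V'` plays two roles: it is the time derivative of the variation and the parameter
derivative of the velocity. The equality of mixed derivatives identifies them, and then the chain
rule for `chartRep e φ` gives the first variation of every `φ` at once. -/
theorem exists_hasDerivAt (h : IsFamily E c z ε Γ) (he : e ∈ atlas E M)
    (ht : t ∈ Icc (0 : ℝ) 1) (hs : c t ∈ e.source) :
    ∃ (V' : E) (ζ' : ℝ), HasDerivWithinAt (chartVariation e Γ) V' (Icc 0 1) t ∧
      HasDerivWithinAt (variationZ Γ) ζ' (Icc 0 1) t ∧
      ∀ φ : TangentBundle 𝓘(ℝ, E) M × (ℝ × ℝ) → ℝ,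
        ContMDiff (𝓘(ℝ, E).tangent.prod 𝓘(ℝ, ℝ × ℝ)) 𝓘(ℝ, ℝ) ∞ φ →
        HasDerivAt (fun s => φ (velocity 𝓘(ℝ, E) (Γ s).1 t, ((Γ s).2 t, zdot (Γ s).2 t)))
          (partialQ 𝓘(ℝ, E) e (fun p => φ (p, (z t, zdot z t))) c t (chartVariation e Γ t) +
            partialV 𝓘(ℝ, E) e (fun p => φ (p, (z t, zdot z t))) c t V' +
            partialZ 𝓘(ℝ, E) φ c z t * variationZ Γ t + partialZdot 𝓘(ℝ, E) φ c z t * ζ') 0 := by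
  have hmem : ((0 : ℝ), t) ∈ Ioo (-ε) ε ×ˢ Icc (0 : ℝ) 1 := ⟨h.zero_mem, ht⟩
  have hs0 : (Γ 0).1 t ∈ e.source := by rwa [h.eq_fst ht]
  have hc : ContMDiffOn 𝓘(ℝ, ℝ) 𝓘(ℝ, E) ∞ c (Icc 0 1) :=
    (h.contMDiffOn_fst h.zero_mem).congr fun r hr => (h.eq_fst hr).symm
  have hg : ContDiffWithinAt ℝ ∞ (fun x : ℝ × ℝ => e ((Γ x.1).1 x.2))
      (Ioo (-ε) ε ×ˢ Icc (0 : ℝ) 1) (0, t) := by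
    rw [← contMDiffWithinAt_iff_contDiffWithinAt]
    exact (contMDiffAt_chart he (x := (Γ 0).1 t) hs0).comp_contMDiffWithinAt
      ((0 : ℝ), t) (h.smooth_fst _ hmem)
  obtain ⟨V', hV1, hV2, hV3⟩ := exists_mixed_derivative h.pos ht hg
  obtain ⟨ζ', hζ1, hζ2, hζ3⟩ := exists_mixed_derivative h.pos ht (h.smooth_snd _ hmem)
  refine ⟨V', ζ', hV1, hζ1, fun φ hφ => ?_⟩
  have hcv : derivWithin (fun r => e ((Γ 0).1 r)) (Icc 0 1) t = chartVelocity 𝓘(ℝ, E) e c t :=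
    derivWithin_congr (fun r hr => by simp [h.eq_fst hr]) (by simp [h.eq_fst ht])
  have hzd : derivWithin (fun r => (Γ 0).2 r) (Icc 0 1) t = zdot z t :=
    derivWithin_congr (fun r hr => by simp [h.eq_snd hr]) (by simp [h.eq_snd ht])
  -- For small `s` the point of the deformed curve at time `t` stays in the chart domain, so its
  -- velocity can be read in `e`.
  have hrep : (fun s => φ (velocity 𝓘(ℝ, E) (Γ s).1 t, ((Γ s).2 t, zdot (Γ s).2 t))) =ᶠ[nhds 0]
      fun s => chartRep e φ (e ((Γ s).1 t), derivWithin (fun r => e ((Γ s).1 r)) (Icc 0 1) t,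
        (Γ s).2 t, derivWithin (fun r => (Γ s).2 r) (Icc 0 1) t) := by
    filter_upwards [isOpen_Ioo.mem_nhds h.zero_mem,
      (h.contMDiffAt_parameter ht).continuousAt.eventually (e.open_source.mem_nhds hs0)] with s h1 h2
    rw [← chartPoint_velocity he (h.contMDiffOn_fst h1) ht h2]
    rfl
  refine HasDerivAt.congr_of_eventuallyEq ?_ hrep
  have hd := (differentiableAt_chartRep he hφ hs (chartVelocity 𝓘(ℝ, E) e c t)
    (z t, zdot z t)).hasFDerivAt
  have hcurve := hV3.prodMk (hV2.prodMk (hζ3.prodMk hζ2))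
  have heq : ((e (c t), chartVelocity 𝓘(ℝ, E) e c t, z t, zdot z t) : E × E × ℝ × ℝ) =
      (e ((Γ 0).1 t), derivWithin (fun r => e ((Γ 0).1 r)) (Icc 0 1) t,
        (Γ 0).2 t, derivWithin (fun r => (Γ 0).2 r) (Icc 0 1) t) := by
    rw [hcv, hzd, h.eq_fst ht, h.eq_snd ht]
  rw [heq] at hd
  have hfin := hd.comp_hasDerivAt (0 : ℝ) hcurve
  convert! hfin using 1
  rw [← heq, partialQ_eq he hφ hs, partialV_eq he hφ hs, partialZ_eq he hφ hc ht hs,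
    partialZdot_eq he hφ hc ht hs]
  set D := fderiv ℝ (chartRep e φ) (e (c t), chartVelocity 𝓘(ℝ, E) e c t, z t, zdot z t)
  have hsplit : ∀ (a b : E) (y w : ℝ), D (a, b, y, w) =
      D (a, 0, 0, 0) + D (0, b, 0, 0) + D (0, 0, 1, 0) * y + D (0, 0, 0, 1) * w := by
    intro a b y w
    have : ((a, b, y, w) : E × E × ℝ × ℝ) = (a, 0, 0, 0) + (0, b, 0, 0) +
        y • ((0, 0, 1, 0) : E × E × ℝ × ℝ) + w • ((0, 0, 0, 1) : E × E × ℝ × ℝ) := by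
      simp
    rw [this, map_add, map_add, map_add, map_smul, map_smul, smul_eq_mul, smul_eq_mul,
      mul_comm y, mul_comm w]
  exact (hsplit _ _ _ _).symm

end IsFamily
end

/-! ### The momentum pairing; sufficiency of the multiplier equations. -/

section
variable {E : Type*} [NormedAddCommGroup E] [NormedSpace ℝ E]
  {M : Type*} [TopologicalSpace M] [ChartedSpace E M] {k : ℕ}

/-- The pairing of the momentum `λ_a ∂φ^a/∂(q̇, ż)` with the variation field of a family. -/
def momentum (φ : Fin (k + 1) → TangentBundle 𝓘(ℝ, E) M × (ℝ × ℝ) → ℝ)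
    (lam : ℝ → Fin (k + 1) → ℝ) (c : ℝ → M) (z : ℝ → ℝ) (Γ : ℝ → (ℝ → M) × (ℝ → ℝ)) (t : ℝ) : ℝ :=
  ∑ a, lam t a * (fibreDeriv (φ a) c (z t, zdot z t) t (variationField E Γ t) +
    partialZdot 𝓘(ℝ, E) (φ a) c z t * variationZ Γ t)

variable {e : OpenPartialHomeomorph M E}
  {φ : Fin (k + 1) → TangentBundle 𝓘(ℝ, E) M × (ℝ × ℝ) → ℝ}
  {lam : ℝ → Fin (k + 1) → ℝ}
  {c : ℝ → M} {z : ℝ → ℝ} {ε : ℝ} {Γ : ℝ → (ℝ → M) × (ℝ → ℝ)} {t : ℝ}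

theorem IsFamily.contMDiffOn_base (h : IsFamily E c z ε Γ) :
    ContMDiffOn 𝓘(ℝ, ℝ) 𝓘(ℝ, E) ∞ c (Icc 0 1) :=
  (h.contMDiffOn_fst h.zero_mem).congr fun _ hr => (h.eq_fst hr).symm

theorem IsVariation.isFamily {q₀ q₁ : M} {z₀ : ℝ} {N : Set (TangentBundle 𝓘(ℝ, E) M × (ℝ × ℝ))}
    (h : IsVariation 𝓘(ℝ, E) q₀ q₁ z₀ N (c, z) Γ) :
    ∃ ε, IsFamily E c z ε Γ ∧ (∀ s ∈ Ioo (-ε) ε, Γ s ∈ pathSpace 𝓘(ℝ, E) q₀ q₁ z₀ N) ∧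
      variationField E Γ 0 = 0 ∧ variationField E Γ 1 = 0 ∧ variationZ Γ 0 = 0 ∧
      HasDerivAt (fun s => action (Γ s)) (variationZ Γ 1) 0 := by
  obtain ⟨ε, hε, h1, h2, h3, h4, h5⟩ := h
  have hF : IsFamily E c z ε Γ := ⟨hε, h1, h2, h4, h5⟩
  have hev : ∀ᶠ s in nhds (0 : ℝ), s ∈ Ioo (-ε) ε := isOpen_Ioo.mem_nhds hF.zero_mem
  refine ⟨ε, hF, h3, ?_, ?_, ?_, ?_⟩
  · have : (fun s => (Γ s).1 0) =ᶠ[nhds 0] fun _ => q₀ := by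
      filter_upwards [hev] with s hs using (h3 s hs).2.2.1
    rw [variationField, this.mfderiv_eq, mfderiv_const]
    rfl
  · have : (fun s => (Γ s).1 1) =ᶠ[nhds 0] fun _ => q₁ := by
      filter_upwards [hev] with s hs using (h3 s hs).2.2.2.1
    rw [variationField, this.mfderiv_eq, mfderiv_const]
    rfl
  · have : (fun s => (Γ s).2 0) =ᶠ[nhds 0] fun _ => z₀ := by
      filter_upwards [hev] with s hs using (h3 s hs).2.2.2.2.1
    rw [variationZ, this.deriv_eq, deriv_const]
  · have hact : (fun s => action (Γ s)) =ᶠ[nhds 0] fun s => (Γ s).2 1 - z₀ := by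
      filter_upwards [hev] with s hs
      rw [action, (h3 s hs).2.2.2.2.1]
    refine HasDerivAt.congr_of_eventuallyEq ?_ hact
    obtain ⟨V', -, -, h6⟩ := exists_mixed_derivative hε (right_mem_Icc.2 zero_le_one)
      (h2 (0, 1) ⟨hF.zero_mem, right_mem_Icc.2 zero_le_one⟩)
    exact h6.sub_const z₀

variable [IsManifold 𝓘(ℝ, E) ∞ M]

/-- The factors `chartFrame` in the fibre derivative and in the variation field cancel. The
intrinsic pairing makes sense on all of `[0,1]`, whereas (EL) is stated chart by chart; this formula
links the two. -/
theorem momentum_eq_chart (hφ : ∀ a, ContMDiff (𝓘(ℝ, E).tangent.prod 𝓘(ℝ, ℝ × ℝ)) 𝓘(ℝ, ℝ) ∞ (φ a))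
    (h : IsFamily E c z ε Γ) (he : e ∈ atlas E M) (ht : t ∈ Icc (0 : ℝ) 1) (hs : c t ∈ e.source) :
    momentum φ lam c z Γ t =
      (∑ a, lam t a • partialV 𝓘(ℝ, E) e (fun p => φ a (p, (z t, zdot z t))) c t)
        (chartVariation e Γ t) +
      (∑ a, lam t a * partialZdot 𝓘(ℝ, E) (φ a) c z t) * variationZ Γ t := by
  rw [momentum, sum_apply, Finset.sum_mul, ← Finset.sum_add_distrib]
  refine Finset.sum_congr rfl fun a _ => ?_
  rw [← h.chartFrame_chartVariation he ht hs,
    fibreDeriv_chartFrame he (hφ a) h.contMDiffOn_base ht hs, smul_apply,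
    smul_eq_mul]
  ring

theorem momentum_eventuallyEq_chart
    (hφ : ∀ a, ContMDiff (𝓘(ℝ, E).tangent.prod 𝓘(ℝ, ℝ × ℝ)) 𝓘(ℝ, ℝ) ∞ (φ a))
    (h : IsFamily E c z ε Γ) (he : e ∈ atlas E M) (ht : t ∈ Icc (0 : ℝ) 1) (hs : c t ∈ e.source) :
    momentum φ lam c z Γ =ᶠ[nhdsWithin t (Icc 0 1)] fun r =>
      (∑ a, lam r a • partialV 𝓘(ℝ, E) e (fun p => φ a (p, (z r, zdot z r))) c r)
        (chartVariation e Γ r) +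
      (∑ a, lam r a * partialZdot 𝓘(ℝ, E) (φ a) c z r) * variationZ Γ r := by
  filter_upwards [eventually_mem_source h.contMDiffOn_base ht hs] with r hr
  exact momentum_eq_chart hφ h he hr.1 hr.2

/-- Along a solution of the Euler–Lagrange equations with multipliers `λ`, the momentum paired with
a variation has derivative `λ_a δφ^a`. -/
theorem hasDerivWithinAt_momentum
    (hφ : ∀ a, ContMDiff (𝓘(ℝ, E).tangent.prod 𝓘(ℝ, ℝ × ℝ)) 𝓘(ℝ, ℝ) ∞ (φ a))
    (h : IsFamily E c z ε Γ) (ht : t ∈ Icc (0 : ℝ) 1)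
    (hq : ∀ e ∈ atlas E M, c t ∈ e.source → HasDerivWithinAt
      (fun s => ∑ a, lam s a • partialV 𝓘(ℝ, E) e (fun p => φ a (p, (z s, zdot z s))) c s)
      (∑ a, lam t a • partialQ 𝓘(ℝ, E) e (fun p => φ a (p, (z t, zdot z t))) c t) (Icc 0 1) t)
    (hz : HasDerivWithinAt (fun s => ∑ a, lam s a * partialZdot 𝓘(ℝ, E) (φ a) c z s)
      (∑ a, lam t a * partialZ 𝓘(ℝ, E) (φ a) c z t) (Icc 0 1) t)
    {g : Fin (k + 1) → ℝ}
    (hg : ∀ a, HasDerivAt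
      (fun s => φ a (velocity 𝓘(ℝ, E) (Γ s).1 t, ((Γ s).2 t, zdot (Γ s).2 t))) (g a) 0) :
    HasDerivWithinAt (momentum φ lam c z Γ) (∑ a, lam t a * g a) (Icc 0 1) t := by
  have he : chartAt E (c t) ∈ atlas E M := chart_mem_atlas E (c t)
  have hs : c t ∈ (chartAt E (c t)).source := mem_chart_source E (c t)
  set e := chartAt E (c t)
  obtain ⟨V', ζ', hV, hζ, hvar⟩ := h.exists_hasDerivAt he ht hs
  have h1 := ((hq e he hs).clm_apply hV).add (hz.mul hζ)
  have h2 := momentum_eventuallyEq_chart (lam := lam) hφ h he ht hs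
  refine (h1.congr_of_eventuallyEq h2 (h2.self_of_nhdsWithin ht)).congr_deriv ?_
  rw [sum_apply, sum_apply, Finset.sum_mul,
    Finset.sum_mul, ← Finset.sum_add_distrib, ← Finset.sum_add_distrib, ← Finset.sum_add_distrib]
  refine Finset.sum_congr rfl fun a _ => ?_
  rw [(hg a).unique (hvar (φ a) (hφ a))]
  simp only [smul_apply, smul_eq_mul]
  ring

/-- If the momentum paired with enough variations has derivative `λ_a δφ^a`, then the
Euler–Lagrange equation holds at `t` in the chart `e`. -/
theorem hasDerivWithinAt_of_momentum
    (hφ : ∀ a, ContMDiff (𝓘(ℝ, E).tangent.prod 𝓘(ℝ, ℝ × ℝ)) 𝓘(ℝ, ℝ) ∞ (φ a))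
    (hc : ContMDiffOn 𝓘(ℝ, ℝ) 𝓘(ℝ, E) ∞ c (Icc 0 1)) (hcz : ContDiffOn ℝ ∞ z (Icc 0 1))
    (hlam : ContDiffOn ℝ ∞ lam (Icc 0 1)) (ht : t ∈ Icc (0 : ℝ) 1)
    (he : e ∈ atlas E M) (hs : c t ∈ e.source)
    (hfam : ∀ v : E, ∃ ε Γ, IsFamily E c z ε Γ ∧ variationField E Γ t = v ∧
      (∀ r ∈ Icc (0 : ℝ) 1, variationZ Γ r = 0) ∧ ∃ g : Fin (k + 1) → ℝ,
      (∀ a, HasDerivAt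
        (fun s => φ a (velocity 𝓘(ℝ, E) (Γ s).1 t, ((Γ s).2 t, zdot (Γ s).2 t))) (g a) 0) ∧
      HasDerivWithinAt (momentum φ lam c z Γ) (∑ a, lam t a * g a) (Icc 0 1) t) :
    HasDerivWithinAt
      (fun s => ∑ a, lam s a • partialV 𝓘(ℝ, E) e (fun p => φ a (p, (z s, zdot z s))) c s)
      (∑ a, lam t a • partialQ 𝓘(ℝ, E) e (fun p => φ a (p, (z t, zdot z t))) c t) (Icc 0 1) t := by
  have hV0 : ∀ a, ContDiffWithinAt ℝ ∞
      (fun s => partialV 𝓘(ℝ, E) e (fun p => φ a (p, (z s, zdot z s))) c s) (Icc 0 1) t := by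
    intro a
    refine ((contDiffWithinAt_fderiv_chartJet he (hφ a) hc hcz ht hs).clm_comp
      (contDiffWithinAt_const
        (c := (ContinuousLinearMap.inr ℝ E (E × ℝ × ℝ)).comp (.inl ℝ E (ℝ × ℝ))))).congr_of_eventuallyEq
      ?_ (partialV_eq he (hφ a) hs _)
    filter_upwards [eventually_mem_source hc ht hs] with r hr
    exact partialV_eq he (hφ a) hr.2 _
  -- Existence of the derivative comes from the smoothness of `λ` and of the momenta; testing with
  -- variations is only needed to identify its value.
  have hP : DifferentiableWithinAt ℝ
      (fun s => ∑ a, lam s a • partialV 𝓘(ℝ, E) e (fun p => φ a (p, (z s, zdot z s))) c s)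
      (Icc 0 1) t := by
    refine ContDiffWithinAt.differentiableWithinAt (n := ∞) ?_ (by simp)
    exact ContDiffWithinAt.sum fun a _ => (contDiffWithinAt_pi.1 (hlam t ht) a).smul (hV0 a)
  have hP1 := hP.hasDerivWithinAt
  refine hP1.congr_deriv ?_
  ext v
  obtain ⟨ε, Γ, h, hv, hζ, g, hg, hmom⟩ := hfam (chartFrame e (c t) v)
  obtain ⟨V', ζ', hV, hζ', hvar⟩ := h.exists_hasDerivAt he ht hs
  have hv' : chartVariation e Γ t = v :=
    (bijective_chartFrame he hs).1 ((h.chartFrame_chartVariation he ht hs).trans hv)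
  have hmom2 : HasDerivWithinAt (fun r =>
      (∑ a, lam r a • partialV 𝓘(ℝ, E) e (fun p => φ a (p, (z r, zdot z r))) c r)
        (chartVariation e Γ r)) (∑ a, lam t a * g a) (Icc 0 1) t := by
    have h2 : momentum φ lam c z Γ =ᶠ[nhdsWithin t (Icc 0 1)] fun r =>
        (∑ a, lam r a • partialV 𝓘(ℝ, E) e (fun p => φ a (p, (z r, zdot z r))) c r)
          (chartVariation e Γ r) := by
      filter_upwards [eventually_mem_source hc ht hs] with r hr
      rw [momentum_eq_chart hφ h he hr.1 hr.2, hζ r hr.1, mul_zero, add_zero]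
    exact hmom.congr_of_eventuallyEq h2.symm (h2.symm.self_of_nhdsWithin ht)
  -- Both expressions for the derivative of the pairing contain the term `λ_a ∂φ^a/∂q̇ V'`; after it
  -- cancels, the equation of the covectors tested on `v` remains.
  have huniq := (uniqueDiffWithinAt_unitInterval ht).eq_deriv _ (hP1.clm_apply hV) hmom2
  have hζ0 : ζ' = 0 := (uniqueDiffWithinAt_unitInterval ht).eq_deriv _ hζ'
    ((hasDerivWithinAt_const t (Icc 0 1) (0 : ℝ)).congr hζ (hζ t ht))
  have hga : ∀ a, g a = _ := fun a => (hg a).unique (hvar (φ a) (hφ a))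
  simp only [hga, hζ0, hζ t ht, mul_zero, add_zero, hv', mul_add, Finset.sum_add_distrib] at huniq
  simp only [sum_apply, smul_apply, smul_eq_mul] at huniq ⊢
  linarith

/-- The `z`-component of `hasDerivWithinAt_of_momentum`. -/
theorem hasDerivWithinAt_z_of_momentum
    (hφ : ∀ a, ContMDiff (𝓘(ℝ, E).tangent.prod 𝓘(ℝ, ℝ × ℝ)) 𝓘(ℝ, ℝ) ∞ (φ a))
    (ht : t ∈ Icc (0 : ℝ) 1) (h : IsFamily E c z ε Γ)
    (hv : ∀ r ∈ Icc (0 : ℝ) 1, variationField E Γ r = 0)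
    (hζ : ∀ r ∈ Icc (0 : ℝ) 1, variationZ Γ r = 1) {g : Fin (k + 1) → ℝ}
    (hg : ∀ a, HasDerivAt
        (fun s => φ a (velocity 𝓘(ℝ, E) (Γ s).1 t, ((Γ s).2 t, zdot (Γ s).2 t))) (g a) 0)
    (hmom : HasDerivWithinAt (momentum φ lam c z Γ) (∑ a, lam t a * g a) (Icc 0 1) t) :
    HasDerivWithinAt (fun s => ∑ a, lam s a * partialZdot 𝓘(ℝ, E) (φ a) c z s)
      (∑ a, lam t a * partialZ 𝓘(ℝ, E) (φ a) c z t) (Icc 0 1) t := by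
  have he : chartAt E (c t) ∈ atlas E M := chart_mem_atlas E (c t)
  have hs : c t ∈ (chartAt E (c t)).source := mem_chart_source E (c t)
  set e := chartAt E (c t)
  obtain ⟨V', ζ', hV, hζ', hvar⟩ := h.exists_hasDerivAt he ht hs
  have hcv : ∀ r ∈ Icc (0 : ℝ) 1, c r ∈ e.source → chartVariation e Γ r = 0 := fun r hr hrs =>
    (bijective_chartFrame he hrs).1
      (((h.chartFrame_chartVariation he hr hrs).trans (hv r hr)).trans (map_zero _).symm)
  have hV0 : V' = 0 := by
    refine (uniqueDiffWithinAt_unitInterval ht).eq_deriv _ hV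
      ((hasDerivWithinAt_const t (Icc 0 1) (0 : E)).congr_of_eventuallyEq ?_ (hcv t ht hs))
    filter_upwards [eventually_mem_source h.contMDiffOn_base ht hs] with r hr
    exact hcv r hr.1 hr.2
  have hζ0 : ζ' = 0 := (uniqueDiffWithinAt_unitInterval ht).eq_deriv _ hζ'
    ((hasDerivWithinAt_const t (Icc 0 1) (1 : ℝ)).congr hζ (hζ t ht))
  have hga : ∀ a, g a = partialZ 𝓘(ℝ, E) (φ a) c z t := fun a => by
    rw [(hg a).unique (hvar (φ a) (hφ a)), hcv t ht hs, hV0, hζ0, hζ t ht]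
    simp
  simp only [hga] at hmom
  refine hmom.congr (fun r hr => ?_) ?_
  · simp [momentum, hv r hr, hζ r hr]
  · simp [momentum, hv t ht, hζ t ht]

/-- A curve that satisfies the Euler–Lagrange equations with multipliers and the natural boundary
condition is critical. -/
theorem isCritical_of_isVakonomicSolution
    (hφ : ∀ a, ContMDiff (𝓘(ℝ, E).tangent.prod 𝓘(ℝ, ℝ × ℝ)) 𝓘(ℝ, ℝ) ∞ (φ a))
    {q₀ q₁ : M} {z₀ : ℝ} (hcz : (c, z) ∈ pathSpace 𝓘(ℝ, E) q₀ q₁ z₀ univ)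
    (hsol : IsVakonomicSolution 𝓘(ℝ, E) φ lam c z)
    (hbd : NaturalBoundary 𝓘(ℝ, E) φ lam c z) :
    IsCritical 𝓘(ℝ, E) q₀ q₁ z₀ (zeroSet 𝓘(ℝ, E) φ) (c, z) := by
  obtain ⟨h1, h2, h3, h4, h5, -⟩ := hcz
  refine ⟨⟨h1, h2, h3, h4, h5, fun t ht a => hsol.eq_constraint t ht a⟩, fun Γ hΓ => ?_⟩
  obtain ⟨ε, hF, hpath, hv0, hv1, hz0, hact⟩ := hΓ.isFamily
  have hderiv : ∀ t ∈ Icc (0 : ℝ) 1, HasDerivWithinAt (momentum φ lam c z Γ) 0 (Icc 0 1) t := by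
    intro t ht
    have h0 : ∀ a, HasDerivAt
        (fun s => φ a (velocity 𝓘(ℝ, E) (Γ s).1 t, ((Γ s).2 t, zdot (Γ s).2 t)))
        ((fun _ => 0 : Fin (k + 1) → ℝ) a) 0 := by
      intro a
      refine (hasDerivAt_const (0 : ℝ) (0 : ℝ)).congr_of_eventuallyEq ?_
      filter_upwards [isOpen_Ioo.mem_nhds hF.zero_mem] with s hs
      exact (hpath s hs).2.2.2.2.2 t ht a
    simpa using hasDerivWithinAt_momentum hφ hF ht (fun e he hs => hsol.eq_q e he t ht hs)
      (hsol.eq_z t ht) h0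
  have hconst := constant_of_derivWithin_zero (fun t ht => (hderiv t ht).differentiableWithinAt)
    (fun t ht => (hderiv t (Ico_subset_Icc_self ht)).derivWithin
      (uniqueDiffWithinAt_unitInterval (Ico_subset_Icc_self ht))) 1 (right_mem_Icc.2 zero_le_one)
  have hm0 : momentum φ lam c z Γ 0 = 0 := by simp [momentum, hv0, hz0]
  have hm1 : momentum φ lam c z Γ 1 = variationZ Γ 1 := by
    rw [NaturalBoundary, sub_eq_zero] at hbd
    simp only [momentum, hv1, map_zero, zero_add, ← mul_assoc, ← Finset.sum_mul, ← hbd, one_mul]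
  rw [← hm1, hconst, hm0] at hact
  exact hact
end

/-! ### Volterra operators and linear differential equations on `[0,1]`. -/

section
variable {X X' : Type*} [NormedAddCommGroup X] [NormedSpace ℝ X]
  [NormedAddCommGroup X'] [NormedSpace ℝ X']

/-- The primitive that vanishes at `0` of a continuous function on `[0,1]`. -/
def primitive (u : C(Icc (0 : ℝ) 1, X)) (t : ℝ) : X :=
  ∫ r in (0 : ℝ)..t, IccExtend zero_le_one u r

theorem hasDerivAt_primitive [CompleteSpace X] (u : C(Icc (0 : ℝ) 1, X)) (t : ℝ) :
    HasDerivAt (primitive u) (IccExtend zero_le_one u t) t :=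
  intervalIntegral.integral_hasDerivAt_right
    ((u.continuous.Icc_extend' (h := zero_le_one)).intervalIntegrable _ _)
    (u.continuous.Icc_extend' (h := zero_le_one)).stronglyMeasurable.stronglyMeasurableAtFilter
    (u.continuous.Icc_extend' (h := zero_le_one)).continuousAt

theorem primitive_zero (u : C(Icc (0 : ℝ) 1, X)) : primitive u 0 = 0 :=
  intervalIntegral.integral_same

theorem continuous_primitive (u : C(Icc (0 : ℝ) 1, X)) : Continuous (primitive u) :=
  intervalIntegral.continuous_primitive
    (fun _ _ => (u.continuous.Icc_extend' (h := zero_le_one)).intervalIntegrable _ _) 0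

theorem norm_primitive_le {u : C(Icc (0 : ℝ) 1, X)} {t C : ℝ} {n : ℕ} (ht : t ∈ Icc (0 : ℝ) 1)
    (hu : ∀ r : Icc (0 : ℝ) 1, ‖u r‖ ≤ C * (r : ℝ) ^ n) :
    ‖primitive u t‖ ≤ C * (t ^ (n + 1) / (n + 1)) := by
  have h1 : ‖primitive u t‖ ≤ ∫ r in (0 : ℝ)..t, C * r ^ n := by
    refine intervalIntegral.norm_integral_le_of_norm_le ht.1 ?_
      ((by fun_prop : Continuous fun r : ℝ => C * r ^ n).intervalIntegrable _ _)
    filter_upwards with r hr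
    have hr' : r ∈ Icc (0 : ℝ) 1 := ⟨hr.1.le, hr.2.trans ht.2⟩
    rw [IccExtend_of_mem _ _ hr']
    exact hu ⟨r, hr'⟩
  simpa using h1

/-- The Volterra operator `u ↦ ∫₀ᵗ u`. -/
def volterra : C(Icc (0 : ℝ) 1, X) →L[ℝ] C(Icc (0 : ℝ) 1, X) :=
  LinearMap.mkContinuous
    { toFun := fun u => ⟨fun t => primitive u t, (continuous_primitive u).comp continuous_subtype_val⟩
      map_add' := fun u v => by
        ext t
        simp only [primitive, ContinuousMap.coe_mk, ContinuousMap.add_apply]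
        rw [← intervalIntegral.integral_add
          ((u.continuous.Icc_extend' (h := zero_le_one)).intervalIntegrable _ _)
          ((v.continuous.Icc_extend' (h := zero_le_one)).intervalIntegrable _ _)]
        rfl
      map_smul' := fun a u => by
        ext t
        simp only [primitive, ContinuousMap.coe_mk, ContinuousMap.smul_apply, RingHom.id_apply]
        rw [← intervalIntegral.integral_smul]
        rfl } 1 fun u => by
    rw [one_mul, ContinuousMap.norm_le _ (norm_nonneg u)]
    intro t
    have h := norm_primitive_le (n := 0) (C := ‖u‖) t.2 fun r => by simpa using u.norm_coe_le_norm r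
    refine h.trans ?_
    have := t.2.2
    simp only [zero_add, pow_one, CharP.cast_eq_zero, div_one]
    exact mul_le_of_le_one_right (norm_nonneg u) this

theorem volterra_apply (u : C(Icc (0 : ℝ) 1, X)) (t : Icc (0 : ℝ) 1) :
    volterra u t = primitive u t := rfl

/-- Pointwise application of a continuous family of operators. -/
def pointwiseApply (A : C(Icc (0 : ℝ) 1, X →L[ℝ] X')) :
    C(Icc (0 : ℝ) 1, X) →L[ℝ] C(Icc (0 : ℝ) 1, X') :=
  LinearMap.mkContinuous
    { toFun := fun u => ⟨fun t => A t (u t), by fun_prop⟩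
      map_add' := fun u v => by ext t; simp
      map_smul' := fun a u => by ext t; simp } ‖A‖ fun u => by
    rw [ContinuousMap.norm_le _ (by positivity)]
    intro t
    exact (A t).le_of_opNorm_le_of_le (A.norm_coe_le_norm t) (u.norm_coe_le_norm t)

theorem pointwiseApply_apply (A : C(Icc (0 : ℝ) 1, X →L[ℝ] X')) (u : C(Icc (0 : ℝ) 1, X))
    (t : Icc (0 : ℝ) 1) : pointwiseApply A u t = A t (u t) := rfl

/-- Each integration turns `rⁿ` into `tⁿ⁺¹/(n+1)`, which builds up the factorial. The factor `tⁿ`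
has to be kept for the induction to close. -/
theorem norm_pow_volterra_apply_le (A : C(Icc (0 : ℝ) 1, X →L[ℝ] X)) (u : C(Icc (0 : ℝ) 1, X))
    (n : ℕ) (t : Icc (0 : ℝ) 1) :
    ‖(((pointwiseApply A).comp volterra) ^ n) u t‖ ≤ (‖A‖ ^ n / n.factorial * ‖u‖) * (t : ℝ) ^ n := by
  induction n generalizing t with
  | zero => simpa using u.norm_coe_le_norm t
  | succ n ih =>
    rw [pow_succ', mul_apply_eq_comp, ContinuousLinearMap.comp_apply,
      pointwiseApply_apply, volterra_apply]
    have h1 := (A t).le_of_opNorm_le_of_le (A.norm_coe_le_norm t) (norm_primitive_le t.2 ih)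
    refine h1.trans (le_of_eq ?_)
    rw [Nat.factorial_succ]
    push_cast
    field_simp
    ring

/-- The factorial bound makes some power `Tⁿ` have norm less than one, so `1 - Tⁿ` is a unit. It is
the product of `1 - T` and a geometric sum that commutes with it, so `1 - T` is a unit as well,
however large `A` is. -/
theorem isUnit_one_sub_volterra [CompleteSpace X] (A : C(Icc (0 : ℝ) 1, X →L[ℝ] X)) :
    IsUnit (1 - (pointwiseApply A).comp volterra) := by
  set T := (pointwiseApply A).comp (volterra (X := X))
  have hlim := FloorSemiring.tendsto_pow_div_factorial_atTop ‖A‖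
  obtain ⟨n, hn⟩ := (hlim.eventually (gt_mem_nhds zero_lt_one)).exists
  have hT : ‖T ^ n‖ < 1 := by
    refine lt_of_le_of_lt (ContinuousLinearMap.opNorm_le_bound _ (by positivity) fun u => ?_) hn
    rw [ContinuousMap.norm_le _ (by positivity)]
    intro t
    refine (norm_pow_volterra_apply_le A u n t).trans ?_
    exact mul_le_of_le_one_right (by positivity) (pow_le_one₀ t.2.1 t.2.2)
  have h1 : IsUnit (1 - T ^ n) := (Units.oneSub (T ^ n) hT).isUnit
  have hc : Commute (1 - T) (∑ i ∈ Finset.range n, T ^ i) :=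
    Commute.sum_right _ _ _ fun i _ =>
      (Commute.one_left _).sub_left ((Commute.refl T).pow_right i)
  rw [← mul_neg_geom_sum, hc.isUnit_mul_iff] at h1
  exact h1.1

/-- Restriction to `[0,1]` of a function that is continuous there. -/
def restrictUnit {f : ℝ → X} (hf : ContinuousOn f (Icc 0 1)) : C(Icc (0 : ℝ) 1, X) :=
  ⟨fun t => f t, continuousOn_iff_continuous_domRestrict.1 hf⟩

/-- Bootstrapping: if `y` is of class `Cⁿ`, so is the right-hand side of its equation, hence `y` is
of class `Cⁿ⁺¹`. -/
theorem contDiffOn_of_linear_ode [CompleteSpace X] {A : ℝ → X →L[ℝ] X} {g y : ℝ → X}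
    (hA : ContDiffOn ℝ ∞ A (Icc 0 1)) (hg : ContDiffOn ℝ ∞ g (Icc 0 1))
    (hy : ∀ t ∈ Icc (0 : ℝ) 1, HasDerivWithinAt y (A t (y t) + g t) (Icc 0 1) t) :
    ContDiffOn ℝ ∞ y (Icc 0 1) := by
  rw [contDiffOn_infty]
  intro n
  induction n with
  | zero => exact contDiffOn_zero.2 fun t ht => (hy t ht).continuousWithinAt
  | succ n ih =>
    push_cast
    refine (contDiffOn_succ_iff_derivWithin (uniqueDiffOn_Icc zero_lt_one)).2
      ⟨fun t ht => (hy t ht).differentiableWithinAt, by simp, ?_⟩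
    have hle : (n : WithTop ℕ∞) ≤ ∞ := ENat.LEInfty.out
    refine (((hA.of_le hle).clm_apply ih).add (hg.of_le hle)).congr fun t ht => ?_
    exact (hy t ht).derivWithin (uniqueDiffWithinAt_unitInterval ht)

/-- Linear ordinary differential equations with smooth coefficients have smooth solutions. -/
theorem exists_linear_ode [CompleteSpace X] {A : ℝ → X →L[ℝ] X} {g : ℝ → X}
    (hA : ContDiffOn ℝ ∞ A (Icc 0 1)) (hg : ContDiffOn ℝ ∞ g (Icc 0 1)) (y₀ : X) :
    ∃ y : ℝ → X, ContDiffOn ℝ ∞ y (Icc 0 1) ∧ y 0 = y₀ ∧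
      ∀ t ∈ Icc (0 : ℝ) 1, HasDerivWithinAt y (A t (y t) + g t) (Icc 0 1) t := by
  set 𝒜 := restrictUnit hA.continuousOn
  have hb : ContinuousOn (fun t => A t y₀ + g t) (Icc 0 1) :=
    (hA.continuousOn.clm_apply continuousOn_const).add hg.continuousOn
  -- The unknown is the derivative `u = y'`. With `y = y₀ + ∫ u` the equation becomes `u - A ∫ u = A
  -- y₀ + g`.
  obtain ⟨S, hS⟩ := isUnit_one_sub_volterra 𝒜
  set u : C(Icc (0 : ℝ) 1, X) := (↑S⁻¹ : C(Icc (0 : ℝ) 1, X) →L[ℝ] C(Icc (0 : ℝ) 1, X))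
    (restrictUnit hb)
  have hu : u - pointwiseApply 𝒜 (volterra u) = restrictUnit hb := by
    have h1 : (S : C(Icc (0 : ℝ) 1, X) →L[ℝ] C(Icc (0 : ℝ) 1, X)) u = restrictUnit hb := by
      rw [← mul_apply_eq_comp, Units.mul_inv]
      rfl
    rw [hS] at h1
    exact h1
  have hy : ∀ t ∈ Icc (0 : ℝ) 1, HasDerivWithinAt (fun t => y₀ + primitive u t)
      (A t (y₀ + primitive u t) + g t) (Icc 0 1) t := by
    intro t ht
    refine (((hasDerivAt_primitive u t).const_add y₀).hasDerivWithinAt).congr_deriv ?_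
    rw [IccExtend_of_mem _ _ ht]
    have h2 : u ⟨t, ht⟩ - A t (primitive u t) = A t y₀ + g t :=
      DFunLike.congr_fun hu (⟨t, ht⟩ : Icc (0 : ℝ) 1)
    rw [map_add, ← sub_eq_zero]
    rw [← sub_eq_zero] at h2
    rw [← h2]
    abel
  exact ⟨_, contDiffOn_of_linear_ode hA hg hy, by simp [primitive_zero], hy⟩

/-- Linear ordinary differential equations with prescribed value at the right end point. -/
theorem exists_linear_ode_right [CompleteSpace X] {A : ℝ → X →L[ℝ] X}
    (hA : ContDiffOn ℝ ∞ A (Icc 0 1)) (y₁ : X) :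
    ∃ y : ℝ → X, ContDiffOn ℝ ∞ y (Icc 0 1) ∧ y 1 = y₁ ∧
      ∀ t ∈ Icc (0 : ℝ) 1, HasDerivWithinAt y (A t (y t)) (Icc 0 1) t := by
  have hmaps : MapsTo (fun t : ℝ => 1 - t) (Icc 0 1) (Icc 0 1) := fun t ht =>
    ⟨by linarith [ht.2], by linarith [ht.1]⟩
  have hsm : ContDiffOn ℝ ∞ (fun t : ℝ => 1 - t) (Icc 0 1) := by fun_prop
  -- Time reversal `t ↦ 1 - t` turns the terminal condition into an initial one and changes the sign
  -- of the coefficient.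
  obtain ⟨x, hx, hx0, hx'⟩ := exists_linear_ode (hA.comp hsm hmaps).neg
    (contDiffOn_const (c := (0 : X))) y₁
  refine ⟨fun t => x (1 - t), hx.comp hsm hmaps, by simpa using hx0, fun t ht => ?_⟩
  have h1 : HasDerivWithinAt (fun t : ℝ => 1 - t) (-1) (Icc 0 1) t := by
    simpa using (hasDerivWithinAt_id t (Icc 0 1)).const_sub (1 : ℝ)
  refine ((hx' (1 - t) (hmaps ht)).scomp t h1 hmaps).congr_deriv ?_
  simp
end

/-! ### Multipliers for underdetermined linear systems. -/

section

/-- A monotone function with equal end values is constant. In the applications `f` is a momentum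
pairing and `q` a square or a sum of squares. -/
theorem eq_zero_of_hasDerivWithinAt_nonneg {f q : ℝ → ℝ}
    (hf : ∀ t ∈ Icc (0 : ℝ) 1, HasDerivWithinAt f (q t) (Icc 0 1) t)
    (hq : ∀ t ∈ Icc (0 : ℝ) 1, 0 ≤ q t) (h01 : f 0 = f 1) : ∀ t ∈ Icc (0 : ℝ) 1, q t = 0 := by
  have hmono : MonotoneOn f (Icc 0 1) := by
    refine monotoneOn_of_deriv_nonneg (convex_Icc 0 1) (fun t ht => (hf t ht).continuousWithinAt)
      (fun t ht => ?_) (fun t ht => ?_)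
    · exact ((hf t (interior_subset ht)).mono interior_subset).differentiableWithinAt
    · rw [((hf t (interior_subset ht)).hasDerivAt (mem_interior_iff_mem_nhds.1 ht)).deriv]
      exact hq t (interior_subset ht)
  have hconst : ∀ t ∈ Icc (0 : ℝ) 1, f t = f 0 := fun t ht =>
    le_antisymm (h01 ▸ hmono ht (right_mem_Icc.2 zero_le_one) ht.2)
      (hmono (left_mem_Icc.2 zero_le_one) ht ht.1)
  intro t ht
  exact (uniqueDiffWithinAt_unitInterval ht).eq_deriv _ (hf t ht)
    ((hasDerivWithinAt_const t (Icc 0 1) (f 0)).congr hconst (hconst t ht))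

variable {X : Type*} [NormedAddCommGroup X] [NormedSpace ℝ X] [FiniteDimensional ℝ X] {m : ℕ}

/-- A smooth family of surjections onto `ℝᵐ` has a smooth family of right inverses. -/
theorem exists_smooth_rightInverse {A : ℝ → X →L[ℝ] (Fin m → ℝ)} {s : Set ℝ}
    (hA : ContDiffOn ℝ ∞ A s) (hsurj : ∀ t ∈ s, Function.Surjective (A t)) :
    ∃ R : ℝ → (Fin m → ℝ) →L[ℝ] X, ContDiffOn ℝ ∞ R s ∧ ∀ t ∈ s, ∀ y, A t (R t y) = y := by
  set b := Module.finBasis ℝ X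
  -- `T` is the transpose of `A` in a basis of `X`. The Gram operator `A T` is injective because `A`
  -- is onto, and the right inverse is `T (A T)⁻¹`, smooth because inversion is.
  set T : ℝ → (Fin m → ℝ) →L[ℝ] X := fun t =>
    ∑ j, ∑ a, (A t (b j) a) • (ContinuousLinearMap.proj (R := ℝ) (φ := fun _ => ℝ) a).smulRight (b j)
  have hT : ContDiffOn ℝ ∞ T s := by
    refine ContDiffOn.sum fun j _ => ContDiffOn.sum fun a _ => ContDiffOn.fun_smul ?_ contDiffOn_const
    exact contDiffOn_pi.1 (hA.clm_apply contDiffOn_const) a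
  have hTA : ∀ t y, T t y = ∑ j, (∑ a, y a * A t (b j) a) • b j := by
    intro t y
    simp only [T, sum_apply, smul_apply, ContinuousLinearMap.smulRight_apply,
      ContinuousLinearMap.proj_apply, Finset.sum_smul, smul_smul]
    simp only [mul_comm]
  have hinj : ∀ t ∈ s, Function.Injective ((A t).comp (T t)) := by
    intro t ht
    rw [injective_iff_map_eq_zero]
    intro y hy
    have h1 : ∑ j, (∑ a, y a * A t (b j) a) * (∑ a, y a * A t (b j) a) = 0 := by
      have h2 : ∑ a, y a * (A t (T t y)) a = 0 := by
        have : A t (T t y) = 0 := hy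
        simp [this]
      rw [hTA, map_sum] at h2
      simp only [map_smul, Finset.sum_apply, Pi.smul_apply, smul_eq_mul, Finset.mul_sum] at h2
      rw [Finset.sum_comm] at h2
      rw [← h2]
      refine Finset.sum_congr rfl fun j _ => ?_
      rw [Finset.mul_sum]
      refine Finset.sum_congr rfl fun a _ => ?_
      ring
    have h3 : ∀ j, ∑ a, y a * A t (b j) a = 0 := fun j =>
      mul_self_eq_zero.1 ((Finset.sum_eq_zero_iff_of_nonneg fun i _ => mul_self_nonneg _).1 h1 j
        (Finset.mem_univ j))
    -- The vector `y` is orthogonal to the range of `A t`; this range contains `y` itself, so `y =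
    -- 0`.
    have h4 : ∀ x, ∑ a, y a * A t x a = 0 := by
      intro x
      rw [← b.sum_repr x, map_sum]
      simp only [map_smul, Finset.sum_apply, Pi.smul_apply, smul_eq_mul, Finset.mul_sum]
      rw [Finset.sum_comm]
      refine Finset.sum_eq_zero fun j _ => ?_
      have := h3 j
      calc ∑ a, y a * (b.repr x j * A t (b j) a) = b.repr x j * ∑ a, y a * A t (b j) a := by
            rw [Finset.mul_sum]
            exact Finset.sum_congr rfl fun a _ => by ring
        _ = 0 := by rw [this, mul_zero]
    obtain ⟨x, hx⟩ := hsurj t ht y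
    have h5 := h4 x
    rw [hx] at h5
    funext a
    exact mul_self_eq_zero.1 ((Finset.sum_eq_zero_iff_of_nonneg fun i _ => mul_self_nonneg _).1 h5 a
        (Finset.mem_univ a))
  have hinv : ∀ t ∈ s, ∃ e : (Fin m → ℝ) ≃L[ℝ] (Fin m → ℝ),
      (e : (Fin m → ℝ) →L[ℝ] (Fin m → ℝ)) = (A t).comp (T t) := fun t ht =>
    ⟨(LinearEquiv.ofInjectiveEndo ((A t).comp (T t) : (Fin m → ℝ) →ₗ[ℝ] (Fin m → ℝ))
      (hinj t ht)).toContinuousLinearEquiv, by ext; rfl⟩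
  refine ⟨fun t => (T t).comp ((A t).comp (T t)).inverse, ?_, ?_⟩
  · intro t ht
    refine (hT t ht).clm_comp ?_
    obtain ⟨e, he⟩ := hinv t ht
    have h1 : ContDiffAt ℝ ∞ ContinuousLinearMap.inverse ((A t).comp (T t)) :=
      he ▸ contDiffAt_map_inverse e
    exact h1.comp_contDiffWithinAt t ((hA t ht).clm_comp (hT t ht))
  · intro t ht y
    obtain ⟨e, he⟩ := hinv t ht
    have h1 : A t (T t (((A t).comp (T t)).inverse y)) = ((A t).comp (T t))
      (((A t).comp (T t)).inverse y) := rfl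
    rw [ContinuousLinearMap.comp_apply, h1, ← he, ContinuousLinearMap.inverse_equiv]
    exact e.apply_symm_apply y

/-- The solutions of the linear system `A δ' + B δ = 0` with `δ(0) = 0`. -/
structure IsLinearSolution (A B : ℝ → X →L[ℝ] (Fin m → ℝ)) (δ : ℝ → X) : Prop where
  smooth : ContDiffOn ℝ ∞ δ (Icc 0 1)
  zero : δ 0 = 0
  eq : ∀ t ∈ Icc (0 : ℝ) 1, A t (derivWithin δ (Icc 0 1) t) + B t (δ t) = 0

/-- The end points of the solutions of the linear system `A δ' + B δ = 0` with `δ(0) = 0`. -/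
def reachable (A B : ℝ → X →L[ℝ] (Fin m → ℝ)) : Submodule ℝ X where
  carrier := {x | ∃ δ, IsLinearSolution A B δ ∧ δ 1 = x}
  zero_mem' := ⟨fun _ => 0, ⟨contDiffOn_const, rfl, by simp⟩, rfl⟩
  add_mem' := by
    rintro _ _ ⟨δ, hδ, rfl⟩ ⟨η, hη, rfl⟩
    refine ⟨fun t => δ t + η t, ⟨hδ.smooth.add hη.smooth, by simp [hδ.zero, hη.zero],
      fun t ht => ?_⟩, rfl⟩
    rw [derivWithin_fun_add (hδ.smooth.differentiableOn (by simp) t ht)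
      (hη.smooth.differentiableOn (by simp) t ht), map_add, map_add, add_add_add_comm, hδ.eq t ht,
      hη.eq t ht, add_zero]
  smul_mem' := by
    rintro a _ ⟨δ, hδ, rfl⟩
    refine ⟨fun t => a • δ t, ⟨contDiffOn_const.smul hδ.smooth, by simp [hδ.zero],
      fun t ht => ?_⟩, rfl⟩
    rw [derivWithin_fun_const_smul _ (hδ.smooth.differentiableOn (by simp) t ht), map_smul, map_smul,
      ← smul_add, hδ.eq t ht, smul_zero]

/-- A covector that annihilates the reachable subspace comes from a smooth multiplier. -/
theorem exists_multiplier {A B : ℝ → X →L[ℝ] (Fin m → ℝ)} (hA : ContDiffOn ℝ ∞ A (Icc 0 1))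
    (hB : ContDiffOn ℝ ∞ B (Icc 0 1)) (hsurj : ∀ t ∈ Icc (0 : ℝ) 1, Function.Surjective (A t))
    (p₁ : X →L[ℝ] ℝ) (hp₁ : ∀ x ∈ reachable A B, p₁ x = 0) :
    ∃ lam : ℝ → Fin m → ℝ, ContDiffOn ℝ ∞ lam (Icc 0 1) ∧
      (∀ t ∈ Icc (0 : ℝ) 1, ∀ x, HasDerivWithinAt (fun s => ∑ a, lam s a * A s x a)
        (∑ a, lam t a * B t x a) (Icc 0 1) t) ∧
      ∀ x, ∑ a, lam 1 a * A 1 x a = p₁ x := by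
  obtain ⟨R, hR, hAR⟩ := exists_smooth_rightInverse hA hsurj
  have hRB := hR.clm_comp hB
  -- The adjoint equation `p' = p ∘ R ∘ B` with final value `p₁`. It remains to show that `p` has
  -- the form `λ A`, that is, `p = p ∘ R ∘ A`; then `λ = p ∘ R`.
  obtain ⟨p, hp, hp1, hp'⟩ := exists_linear_ode_right (X := X →L[ℝ] ℝ)
    (A := fun t => (ContinuousLinearMap.compL ℝ X X ℝ).flip ((R t).comp (B t)))
    ((ContinuousLinearMap.contDiff _).comp_contDiffOn hRB) p₁
  have hkey : ∀ x, ∀ t ∈ Icc (0 : ℝ) 1, p t (x - R t (A t x)) = 0 := by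
    intro x
    set q : ℝ → ℝ := fun t => p t (x - R t (A t x)) with hqdef
    have hPx : ContDiffOn ℝ ∞ (fun t => x - R t (A t x)) (Icc 0 1) :=
      contDiffOn_const.sub (hR.clm_apply (hA.clm_apply contDiffOn_const))
    have hq : ContDiffOn ℝ ∞ q (Icc 0 1) := hp.clm_apply hPx
    -- The solution of `δ' = -R B δ + q (x - R A x)`. The forcing lies in the kernel of `A`, so `δ`
    -- solves the linear system, and the choice of the weight `q` makes the derivative of `p(δ)`
    -- equal to `q²`. As `p₁` kills the reachable point `δ(1)`, `q` vanishes.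
    obtain ⟨δ, hδ, hδ0, hδ'⟩ := exists_linear_ode hRB.neg (hq.smul hPx) (0 : X)
    have hsol : IsLinearSolution A B δ := by
      refine ⟨hδ, hδ0, fun t ht => ?_⟩
      rw [(hδ' t ht).derivWithin (uniqueDiffWithinAt_unitInterval ht)]
      simp [hAR t ht]
    have hderiv : ∀ t ∈ Icc (0 : ℝ) 1, HasDerivWithinAt (fun s => p s (δ s)) (q t * q t)
        (Icc 0 1) t := by
      intro t ht
      refine ((hp' t ht).clm_apply (hδ' t ht)).congr_deriv ?_
      have : q t = p t x - p t (R t (A t x)) := by rw [hqdef]; simp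
      simp [this]
    have h1 := eq_zero_of_hasDerivWithinAt_nonneg hderiv (fun t _ => mul_self_nonneg _)
      (by rw [hδ0, hp1, hp₁ _ ⟨δ, hsol, rfl⟩, map_zero])
    exact fun t ht => mul_self_eq_zero.1 (h1 t ht)
  have hsum : ∀ t y, ∑ a, p t (R t (Pi.single a 1)) * y a = p t (R t y) := by
    intro t y
    conv_rhs => rw [pi_eq_sum_univ' y]
    simp only [map_sum, map_smul, smul_eq_mul]
    refine Finset.sum_congr rfl fun a _ => ?_
    rw [mul_comm]
  have hpA : ∀ t ∈ Icc (0 : ℝ) 1, ∀ x, p t (R t (A t x)) = p t x := fun t ht x => by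
    have := hkey x t ht
    rw [map_sub, sub_eq_zero] at this
    exact this.symm
  refine ⟨fun t a => p t (R t (Pi.single a 1)), ?_, fun t ht x => ?_, fun x => ?_⟩
  · exact contDiffOn_pi.2 fun a => hp.clm_apply (hR.clm_apply contDiffOn_const)
  · simp only [hsum]
    refine HasDerivWithinAt.congr ?_ (fun s hs => hpA s hs x) (hpA t ht x)
    have h1 := (hp' t ht).clm_apply (hasDerivWithinAt_const t (Icc 0 1) x)
    simpa using h1
  · rw [hsum, hpA 1 (right_mem_Icc.2 zero_le_one), hp1]
end

/-! ### Smoothness of superposition operators on `C([0,1])`. -/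

section
universe u v
variable {W : Type u} {Y : Type v} [NormedAddCommGroup W] [NormedAddCommGroup Y]

/-- The superposition operator `v ↦ f(·, v(·))`. -/
def superposition (f : ℝ × W → Y) (hf : ContinuousOn f (Icc (0 : ℝ) 1 ×ˢ univ))
    (v : C(Icc (0 : ℝ) 1, W)) : C(Icc (0 : ℝ) 1, Y) :=
  ⟨fun t => f (t, v t), hf.comp_continuous (by fun_prop) fun t => ⟨t.2, trivial⟩⟩

/-- On the compact interval the norm topology is the compact-open one, for which postcomposition
with a continuous map is continuous. No uniform continuity of `f` on bounded sets of `W` is needed.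
-/
theorem continuous_superposition (f : ℝ × W → Y)
    (hf : ContinuousOn f (Icc (0 : ℝ) 1 ×ˢ univ)) : Continuous (superposition f hf) := by
  set F : C(Icc (0 : ℝ) 1 × W, Y) := ⟨fun p => f (p.1, p.2),
    hf.comp_continuous (by fun_prop) fun p => ⟨p.1.2, trivial⟩⟩
  have h1 : Continuous fun v : C(Icc (0 : ℝ) 1, W) =>
      F.comp ((ContinuousMap.id (Icc (0 : ℝ) 1)).prodMk v) := by
    refine (ContinuousMap.continuous_postcomp F).comp ?_
    refine ContinuousMap.continuous_of_continuous_uncurry _ ?_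
    change Continuous fun p : C(Icc (0 : ℝ) 1, W) × Icc (0 : ℝ) 1 => (p.2, p.1 p.2)
    fun_prop
  exact h1

variable [NormedSpace ℝ W] [NormedSpace ℝ Y]

theorem uniqueDiffOn_cylinder : UniqueDiffOn ℝ (Icc (0 : ℝ) 1 ×ˢ (univ : Set W)) :=
  (uniqueDiffOn_Icc zero_lt_one).prod uniqueDiffOn_univ

/-- The partial derivative in the second variable. -/
def partialSnd (f : ℝ × W → Y) (p : ℝ × W) : W →L[ℝ] Y :=
  (fderivWithin ℝ f (Icc (0 : ℝ) 1 ×ˢ univ) p).comp (.inr ℝ ℝ W)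

theorem contDiffOn_partialSnd {f : ℝ × W → Y} (hf : ContDiffOn ℝ ∞ f (Icc (0 : ℝ) 1 ×ˢ univ)) :
    ContDiffOn ℝ ∞ (partialSnd f) (Icc (0 : ℝ) 1 ×ˢ univ) :=
  (hf.fderivWithin uniqueDiffOn_cylinder (m := ∞) (by simp)).clm_comp contDiffOn_const

theorem hasFDerivAt_partialSnd {f : ℝ × W → Y}
    (hf : ContDiffOn ℝ ∞ f (Icc (0 : ℝ) 1 ×ˢ univ)) {t : ℝ} (ht : t ∈ Icc (0 : ℝ) 1) (w : W) :
    HasFDerivAt (fun w => f (t, w)) (partialSnd f (t, w)) w := by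
  have h1 := (hf.differentiableOn (by simp) (t, w) ⟨ht, trivial⟩).hasFDerivWithinAt
  rw [← hasFDerivWithinAt_univ]
  exact h1.comp w (hasFDerivAt_prodMk_right (𝕜 := ℝ) t w).hasFDerivWithinAt
    (fun x _ => ⟨ht, trivial⟩)

theorem norm_pointwiseApply_le (A : C(Icc (0 : ℝ) 1, W →L[ℝ] Y)) : ‖pointwiseApply A‖ ≤ ‖A‖ :=
  LinearMap.mkContinuous_norm_le _ (norm_nonneg A) _

theorem isBoundedLinearMap_pointwiseApply : IsBoundedLinearMap ℝ
    (fun A : C(Icc (0 : ℝ) 1, W →L[ℝ] Y) => pointwiseApply A) where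
  map_add _ _ := ContinuousLinearMap.ext fun _ => ContinuousMap.ext fun _ => rfl
  map_smul _ _ := ContinuousLinearMap.ext fun _ => ContinuousMap.ext fun _ => rfl
  bound := ⟨1, one_pos, fun A => by rw [one_mul]; exact norm_pointwiseApply_le A⟩

theorem contDiff_pointwiseApply {n : WithTop ℕ∞} :
    ContDiff ℝ n fun A : C(Icc (0 : ℝ) 1, W →L[ℝ] Y) => pointwiseApply A :=
  isBoundedLinearMap_pointwiseApply.contDiff

/-- The mean value inequality is applied at each time. Its uniformity in `t` is the continuity at
`u` of the superposition operator of the partial derivative. -/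
theorem hasFDerivAt_superposition {f : ℝ × W → Y}
    (hf : ContDiffOn ℝ ∞ f (Icc (0 : ℝ) 1 ×ˢ univ)) (u : C(Icc (0 : ℝ) 1, W)) :
    HasFDerivAt (superposition f hf.continuousOn)
      (pointwiseApply (superposition (partialSnd f) (contDiffOn_partialSnd hf).continuousOn u))
      u := by
  set G := superposition (partialSnd f) (contDiffOn_partialSnd hf).continuousOn with hG
  refine .of_isLittleO (Asymptotics.isLittleO_iff.2 fun ε hε => ?_)
  obtain ⟨δ, hδ, hball⟩ := Metric.continuous_iff.1
    (continuous_superposition (partialSnd f) (contDiffOn_partialSnd hf).continuousOn) u ε hε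
  filter_upwards [Metric.ball_mem_nhds u hδ] with v hv
  rw [ContinuousMap.norm_le _ (by positivity)]
  intro t
  have hvt : v t ∈ Metric.ball (u t) δ :=
    (ContinuousMap.dist_apply_le_dist t).trans_lt hv
  have hbound : ∀ w ∈ Metric.ball (u t) δ, ‖partialSnd f (t, w) - G u t‖ ≤ ε := by
    intro w hw
    -- Shifting `u` by a constant function gives a curve that passes through `w` at time `t` and is
    -- uniformly close to `u`; this turns the estimate in the sup norm into a pointwise one.
    have h1 : dist (u + ContinuousMap.const _ (w - u t)) u < δ := by
      rw [dist_eq_norm, add_sub_cancel_left]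
      refine lt_of_le_of_lt ((ContinuousMap.norm_le _ (norm_nonneg _)).2 fun s => ?_)
        (mem_ball_iff_norm.1 hw)
      rfl
    have h2 := (ContinuousMap.dist_apply_le_dist t).trans (hball _ h1).le
    rw [dist_eq_norm] at h2
    simpa [superposition, hG] using h2
  have h3 := (convex_ball (u t) δ).norm_image_sub_le_of_norm_hasFDerivWithin_le'
    (fun w _ => (hasFDerivAt_partialSnd hf t.2 w).hasFDerivWithinAt) hbound
    (Metric.mem_ball_self hδ) hvt
  exact h3.trans (mul_le_mul_of_nonneg_left ((v - u).norm_coe_le_norm t) hε.le)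

/-- The derivative is again a superposition operator, with values in `W →L[ℝ] Y`, so the induction
has to vary the target. This is why both spaces share a universe. -/
theorem contDiff_superposition {W Y : Type u} [NormedAddCommGroup W] [NormedAddCommGroup Y]
    [NormedSpace ℝ W] [NormedSpace ℝ Y] {f : ℝ × W → Y}
    (hf : ContDiffOn ℝ ∞ f (Icc (0 : ℝ) 1 ×ˢ univ)) :
    ContDiff ℝ ∞ (superposition f hf.continuousOn) := by
  rw [contDiff_infty]
  intro n
  induction n generalizing Y with
  | zero => exact contDiff_zero.2 (continuous_superposition f _)
  | succ n ih =>
    push_cast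
    exact contDiff_succ_iff_hasFDerivAt.2 ⟨fun u => pointwiseApply (superposition (partialSnd f) _ u),
      contDiff_pointwiseApply.comp (ih (contDiffOn_partialSnd hf)),
      fun u => hasFDerivAt_superposition hf u⟩
end

/-! ### The inverse function theorem on a neighbourhood. -/

section
variable {𝔼 𝔽 : Type*} [NormedAddCommGroup 𝔼] [NormedSpace ℝ 𝔼] [CompleteSpace 𝔼]
  [NormedAddCommGroup 𝔽] [NormedSpace ℝ 𝔽]

/-- The inverse function theorem, with a smooth local inverse on a whole neighbourhood. -/
theorem exists_smooth_localInverse {f : 𝔼 → 𝔽} {f' : 𝔼 ≃L[ℝ] 𝔽} {a : 𝔼} {s : Set 𝔼} (hs : s ∈ nhds a)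
    (hf : ContDiffOn ℝ ∞ f s) (hf' : HasFDerivAt f (f' : 𝔼 →L[ℝ] 𝔽) a) :
    ∃ (g : 𝔽 → 𝔼) (U : Set 𝔽), IsOpen U ∧ f a ∈ U ∧ ContDiffOn ℝ ∞ g U ∧ g (f a) = a ∧
      (∀ y ∈ U, f (g y) = y) ∧ HasFDerivAt g (f'.symm : 𝔽 →L[ℝ] 𝔼) (f a) := by
  have hfa : ContDiffAt ℝ ∞ f a := hf.contDiffAt hs
  set φ := hfa.toOpenPartialHomeomorph f hf' (by simp) with hφ
  have hcoe : (φ : 𝔼 → 𝔽) = f := hfa.toOpenPartialHomeomorph_coe hf' (by simp)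
  have ha : a ∈ φ.source := hfa.mem_toOpenPartialHomeomorph_source hf' (by simp)
  have hfaT : f a ∈ φ.target := hfa.image_mem_toOpenPartialHomeomorph_target hf' (by simp)
  have hsymm : φ.symm (f a) = a := by
    have := φ.left_inv ha
    rwa [hcoe] at this
  -- Smoothness of the inverse at one image point is not enough. Invertibility of the derivative is
  -- an open condition, so it holds near `a`, and the inverse is smooth at every nearby image point.
  have hopen : IsOpen (range ((↑) : (𝔼 ≃L[ℝ] 𝔽) → 𝔼 →L[ℝ] 𝔽)) := ContinuousLinearEquiv.isOpen
  have hcont : ContinuousAt (fderiv ℝ f) a :=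
    (hfa.fderiv_right (m := 0) (by simp)).continuousAt
  have hev : ∀ᶠ x in nhds a, ContDiffAt ℝ ∞ f x ∧ fderiv ℝ f x ∈
      range ((↑) : (𝔼 ≃L[ℝ] 𝔽) → 𝔼 →L[ℝ] 𝔽) := by
    refine Filter.Eventually.and ?_ (hcont.eventually (hopen.mem_nhds ?_))
    · filter_upwards [eventually_mem_nhds_iff.2 hs] with x hx using hf.contDiffAt hx
    · rw [hf'.fderiv]; exact ⟨f', rfl⟩
  obtain ⟨V, hV, hVo, haV⟩ := eventually_nhds_iff.1 hev
  refine ⟨φ.symm, φ.target ∩ φ.symm ⁻¹' V, φ.symm.isOpen_inter_preimage hVo, ⟨hfaT, ?_⟩, ?_,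
    hsymm, ?_, ?_⟩
  · change φ.symm (f a) ∈ V
    rwa [hsymm]
  · intro y hy
    obtain ⟨h1, e, he⟩ := hV _ hy.2
    refine (φ.contDiffAt_symm hy.1 (f₀' := e) ?_ ?_).contDiffWithinAt
    · rw [hcoe, he]; exact (h1.differentiableAt (by simp)).hasFDerivAt
    · rwa [hcoe]
  · intro y hy
    have := φ.right_inv hy.1
    rwa [hcoe] at this
  · refine φ.hasFDerivAt_symm hfaT ?_
    rwa [hcoe, hsymm]
end

/-! ### Evaluation of curves in `C([0,1])` and pointwise implicit equations. -/

section
universe u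
variable {X : Type u} [NormedAddCommGroup X] [NormedSpace ℝ X]

/-- The error splits into three parts: the remainder of `V` in the parameter, small uniformly in
time; the oscillation of the continuous function `V'` times the parameter increment; and the
remainder of the single curve `V s` in time. Only differentiability of `V` at one `s` and of `V s`
at one `t` is used. -/
theorem hasFDerivWithinAt_eval {V : ℝ → C(Icc (0 : ℝ) 1, X)} {V' : C(Icc (0 : ℝ) 1, X)} {d : X}
    {s t : ℝ} {S : Set ℝ} (hV : HasDerivAt V V' s)
    (hd : HasDerivWithinAt (IccExtend zero_le_one (V s)) d (Icc 0 1) t) :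
    HasFDerivWithinAt (fun p : ℝ × ℝ => IccExtend zero_le_one (V p.1) p.2)
      ((ContinuousLinearMap.fst ℝ ℝ ℝ).smulRight (IccExtend zero_le_one V' t) +
        (ContinuousLinearMap.snd ℝ ℝ ℝ).smulRight d) (S ×ˢ Icc 0 1) (s, t) := by
  set l := nhdsWithin (s, t) (S ×ˢ Icc (0 : ℝ) 1)
  have hfst : Filter.Tendsto (Prod.fst : ℝ × ℝ → ℝ) l (nhds s) :=
    (continuous_fst.tendsto' (s, t) s rfl).mono_left nhdsWithin_le_nhds
  have hsnd : Filter.Tendsto (Prod.snd : ℝ × ℝ → ℝ) l (nhdsWithin t (Icc 0 1)) :=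
    (continuous_snd.continuousWithinAt (x := (s, t))).tendsto_nhdsWithin fun p hp => hp.2
  have hO1 : (fun p : ℝ × ℝ => p.1 - s) =O[l] fun p => p - (s, t) :=
    Asymptotics.IsBigO.of_bound 1 (Filter.Eventually.of_forall fun p => by
      rw [one_mul]; exact norm_fst_le (p - (s, t)))
  have hO2 : (fun p : ℝ × ℝ => p.2 - t) =O[l] fun p => p - (s, t) :=
    Asymptotics.IsBigO.of_bound 1 (Filter.Eventually.of_forall fun p => by
      rw [one_mul]; exact norm_snd_le (p - (s, t)))
  have h1 : (fun p : ℝ × ℝ => IccExtend zero_le_one (V p.1 - V s - (p.1 - s) • V') p.2)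
      =o[l] fun p => p - (s, t) := by
    have ha := (hV.hasFDerivAt.isLittleO.comp_tendsto hfst).trans_isBigO hO1
    refine (Asymptotics.IsBigO.of_bound 1 (Filter.Eventually.of_forall fun p => ?_)).trans_isLittleO ha
    rw [one_mul]
    simpa using! (V p.1 - V s - (p.1 - s) • V').norm_coe_le_norm (projIcc 0 1 zero_le_one p.2)
  have h2 : (fun p : ℝ × ℝ => (p.1 - s) • (IccExtend zero_le_one V' p.2 -
      IccExtend zero_le_one V' t)) =o[l] fun p => p - (s, t) := by
    have hb : Filter.Tendsto (fun p : ℝ × ℝ => IccExtend zero_le_one V' p.2 -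
        IccExtend zero_le_one V' t) l (nhds 0) := by
      have hc : Continuous fun p : ℝ × ℝ => IccExtend zero_le_one V' p.2 -
        IccExtend zero_le_one V' t :=
        ((V'.continuous.Icc_extend' (h := zero_le_one)).comp continuous_snd).sub continuous_const
      exact (hc.tendsto' (s, t) 0 (by simp)).mono_left nhdsWithin_le_nhds
    have hc := (Asymptotics.isBigO_refl (fun p : ℝ × ℝ => p.1 - s) l).smul_isLittleO
      ((Asymptotics.isLittleO_one_iff ℝ).2 hb)
    simp only [smul_eq_mul, mul_one] at hc
    exact hc.trans_isBigO hO1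
  have h3 : (fun p : ℝ × ℝ => IccExtend zero_le_one (V s) p.2 - IccExtend zero_le_one (V s) t -
      (p.2 - t) • d) =o[l] fun p => p - (s, t) :=
    ((hasDerivWithinAt_iff_isLittleO.1 hd).comp_tendsto hsnd).trans_isBigO hO2
  refine .of_isLittleO (((h1.add h2).add h3).congr_left fun p => ?_)
  simp only [IccExtend, Function.comp_apply, ContinuousMap.sub_apply, ContinuousMap.smul_apply,
    add_apply, ContinuousLinearMap.smulRight_apply, ContinuousLinearMap.coe_fst',
    ContinuousLinearMap.coe_snd', Prod.fst_sub, Prod.snd_sub, smul_sub]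
  abel

variable [FiniteDimensional ℝ X]

/-- A continuous solution of a regular implicit equation is differentiable. -/
theorem differentiableWithinAt_of_implicit {K : ℝ × X → X} {v : ℝ → X} {D : ℝ × X →L[ℝ] X}
    {s : Set ℝ} {t : ℝ} (ht : t ∈ s) (hK : HasFDerivWithinAt K D (s ×ˢ univ) (t, v t))
    (hD : ∀ x, D (0, x) = 0 → x = 0) (hv : ContinuousWithinAt v s t)
    (hzero : ∀ r ∈ s, K (r, v r) = 0) : DifferentiableWithinAt ℝ v s t := by
  set f : ℝ × X → ℝ × X := fun p => (p.1, K p)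
  set f' : ℝ × X →L[ℝ] ℝ × X := (ContinuousLinearMap.fst ℝ ℝ X).prod D
  have hinj : Function.Injective f' := by
    rw [injective_iff_map_eq_zero]
    rintro ⟨τ, x⟩ h
    have h1 : τ = 0 := congrArg Prod.fst h
    have h2 : D (τ, x) = 0 := congrArg Prod.snd h
    subst h1
    rw [hD x h2]
    rfl
  set e : (ℝ × X) ≃L[ℝ] (ℝ × X) :=
    (LinearEquiv.ofInjectiveEndo (f' : ℝ × X →ₗ[ℝ] ℝ × X) hinj).toContinuousLinearEquiv
  have he : (e : ℝ × X →L[ℝ] ℝ × X) = f' := by ext <;> rfl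
  have hf : HasFDerivWithinAt f (e : ℝ × X →L[ℝ] ℝ × X) (s ×ˢ univ) (t, v t) := by
    rw [he]
    exact hasFDerivWithinAt_fst.prodMk hK
  -- On `s ×ˢ {0}` the map `f ∘ g` is the identity. As `f` has an invertible derivative and `g` is
  -- continuous, `g` is differentiable there, and `v` is read off from it.
  set g : ℝ × X → ℝ × X := fun q => (q.1, v q.1)
  have hmaps : MapsTo g (s ×ˢ {0}) (s ×ˢ univ) := fun q hq => ⟨hq.1, trivial⟩
  have hgc : ContinuousWithinAt g (s ×ˢ {0}) (t, 0) :=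
    continuousWithinAt_fst.prodMk
      (ContinuousWithinAt.comp (t := s) hv continuousWithinAt_fst fun q hq => hq.1)
  have hg : HasFDerivWithinAt g (e.symm : ℝ × X →L[ℝ] ℝ × X) (s ×ˢ {0}) (t, 0) := by
    refine HasFDerivWithinAt.of_local_left_inverse (f := f) (t := s ×ˢ univ)
      (hgc.tendsto_nhdsWithin hmaps) hf ⟨ht, rfl⟩ ?_
    filter_upwards [self_mem_nhdsWithin] with q hq
    exact Prod.ext rfl ((hzero _ hq.1).trans hq.2.symm)
  have hι : HasFDerivWithinAt (fun r : ℝ => (r, (0 : X))) (.inl ℝ ℝ X) s t :=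
    (hasFDerivAt_prodMk_left (𝕜 := ℝ) t (0 : X)).hasFDerivWithinAt
  have hm : MapsTo (fun r : ℝ => (r, (0 : X))) s (s ×ˢ {0}) := fun r hr => ⟨hr, rfl⟩
  have h1 := hg.comp t hι hm
  exact (hasFDerivAt_snd.comp_hasFDerivWithinAt t h1).differentiableWithinAt
end

/-! ### Joint smoothness of families of solutions of implicit equations. -/

section
universe u

theorem volterra_compLeft {X Y : Type*} [NormedAddCommGroup X] [NormedSpace ℝ X] [CompleteSpace X]
    [NormedAddCommGroup Y] [NormedSpace ℝ Y] [CompleteSpace Y] (T : X →L[ℝ] Y)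
    (v : C(Icc (0 : ℝ) 1, X)) :
    volterra (T.compLeftContinuous ℝ (Icc (0 : ℝ) 1) v) =
      T.compLeftContinuous ℝ (Icc (0 : ℝ) 1) (volterra v) := by
  ext t
  exact T.intervalIntegral_comp_comm
    ((v.continuous.Icc_extend' (h := zero_le_one)).intervalIntegrable _ _)

theorem hasDerivWithinAt_volterra {X : Type*} [NormedAddCommGroup X] [NormedSpace ℝ X]
    [CompleteSpace X] (v : C(Icc (0 : ℝ) 1, X)) {t : ℝ} (ht : t ∈ Icc (0 : ℝ) 1) :
    HasDerivWithinAt (IccExtend zero_le_one (volterra v)) (IccExtend zero_le_one v t)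
      (Icc 0 1) t := by
  refine (hasDerivAt_primitive v t).hasDerivWithinAt.congr (fun r hr => ?_) ?_
  · rw [IccExtend_of_mem _ _ hr]; rfl
  · rw [IccExtend_of_mem _ _ ht]; rfl

/-- The linearisation in the velocities and positions of `H`, as a system on `X × X`. -/
def prolongation {X : Type u} [NormedAddCommGroup X] [NormedSpace ℝ X] (H : ℝ × (X × X) → X)
    (p : ℝ × ((X × X) × (X × X))) : X × X :=
  (H (p.1, (p.2.1.1, p.2.2.1)), partialSnd H (p.1, (p.2.1.1, p.2.2.1)) (p.2.1.2, p.2.2.2))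

theorem contDiffOn_prolongation {X : Type u} [NormedAddCommGroup X] [NormedSpace ℝ X]
    {H : ℝ × (X × X) → X} (hH : ContDiffOn ℝ ∞ H (Icc (0 : ℝ) 1 ×ˢ univ)) :
    ContDiffOn ℝ ∞ (prolongation H) (Icc (0 : ℝ) 1 ×ˢ univ) := by
  have h1 : ContDiff ℝ ∞ fun p : ℝ × ((X × X) × (X × X)) => (p.1, (p.2.1.1, p.2.2.1)) := by
    fun_prop
  have h2 : ContDiff ℝ ∞ fun p : ℝ × ((X × X) × (X × X)) => (p.2.1.2, p.2.2.2) := by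
    fun_prop
  have hm : MapsTo (fun p : ℝ × ((X × X) × (X × X)) => (p.1, (p.2.1.1, p.2.2.1)))
      (Icc (0 : ℝ) 1 ×ˢ univ) (Icc (0 : ℝ) 1 ×ˢ univ) := fun p hp => ⟨hp.1, trivial⟩
  exact (hH.comp h1.contDiffOn hm).prodMk
    (((contDiffOn_partialSnd hH).comp h1.contDiffOn hm).clm_apply h2.contDiffOn)

/-- The derivative of the prolongation in the velocities is block triangular with `∂H/∂v` in both
diagonal blocks. The first component kills `a`, and then the second kills `b`. -/
theorem partialSnd_prolongation_injective {X : Type u} [NormedAddCommGroup X] [NormedSpace ℝ X]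
    {H : ℝ × (X × X) → X} (hH : ContDiffOn ℝ ∞ H (Icc (0 : ℝ) 1 ×ˢ univ)) {t : ℝ}
    (ht : t ∈ Icc (0 : ℝ) 1) {x x' v v' : X}
    (hinj : ∀ b, partialSnd H (t, (x, v)) (0, b) = 0 → b = 0) (b : X × X)
    (hb : partialSnd (prolongation H) (t, ((x, x'), (v, v'))) (0, b) = 0) : b = 0 := by
  obtain ⟨a, b⟩ := b
  have hD := hasFDerivAt_partialSnd (contDiffOn_prolongation hH) ht ((x, x'), (v, v'))
  have ha : a = 0 := by
    refine hinj a ?_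
    have hc : HasDerivAt (fun r : ℝ => (((x, x'), (v, v')) : (X × X) × (X × X)) + r • (0, (a, b)))
        (0, (a, b)) 0 := by
      simpa using ((hasDerivAt_id (0 : ℝ)).smul_const
        ((0, (a, b)) : (X × X) × (X × X))).const_add ((x, x'), (v, v'))
    have hc2 : HasDerivAt (fun r : ℝ => ((x, v) : X × X) + r • (0, a)) (0, a) 0 := by
      simpa using ((hasDerivAt_id (0 : ℝ)).smul_const ((0, a) : X × X)).const_add (x, v)
    have h1 := HasFDerivAt.comp_hasDerivAt (0 : ℝ) (by simpa using hD) hc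
    have h2 := HasFDerivAt.comp_hasDerivAt (0 : ℝ)
      (by simpa using hasFDerivAt_partialSnd hH ht (x, v)) hc2
    have h3 := (hasFDerivAt_fst (𝕜 := ℝ)).comp_hasDerivAt (0 : ℝ) h1
    rw [hb] at h3
    refine h2.unique (h3.congr_of_eventuallyEq (Filter.Eventually.of_forall fun r => ?_))
    simp [prolongation]
  subst ha
  have hb0 : b = 0 := by
    refine hinj b ?_
    have hc : HasDerivAt (fun r : ℝ => (((x, x'), (v, v')) : (X × X) × (X × X)) + r • (0, (0, b)))
        (0, (0, b)) 0 := by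
      simpa using ((hasDerivAt_id (0 : ℝ)).smul_const
        ((0, (0, b)) : (X × X) × (X × X))).const_add ((x, x'), (v, v'))
    have hc2 : HasDerivAt (fun r : ℝ => ((x', v') : X × X) + r • (0, b)) (0, b) 0 := by
      simpa using ((hasDerivAt_id (0 : ℝ)).smul_const ((0, b) : X × X)).const_add (x', v')
    have h1 := HasFDerivAt.comp_hasDerivAt (0 : ℝ) (by simpa using hD) hc
    have h2 := (partialSnd H (t, (x, v))).hasFDerivAt.comp_hasDerivAt (0 : ℝ) hc2
    have h3 := (hasFDerivAt_snd (𝕜 := ℝ)).comp_hasDerivAt (0 : ℝ) h1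
    rw [hb] at h3
    refine h2.unique (h3.congr_of_eventuallyEq (Filter.Eventually.of_forall fun r => ?_))
    simp [prolongation]
  rw [hb0]
  rfl

theorem continuousOn_eval {X : Type*} [NormedAddCommGroup X] [NormedSpace ℝ X]
    {U : ℝ → C(Icc (0 : ℝ) 1, X)} {S : Set ℝ} (hU : ContinuousOn U S) :
    ContinuousOn (fun p : ℝ × ℝ => IccExtend zero_le_one (U p.1) p.2) (S ×ˢ Icc 0 1) := by
  have h1 : ContinuousOn (fun p : ℝ × ℝ => U p.1) (S ×ˢ Icc (0 : ℝ) 1) :=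
    hU.comp continuousOn_fst fun p hp => hp.1
  have h2 : Continuous fun p : ℝ × ℝ => projIcc (0 : ℝ) 1 zero_le_one p.2 :=
    continuous_projIcc.comp continuous_snd
  have h3 : Continuous fun q : C(Icc (0 : ℝ) 1, X) × Icc (0 : ℝ) 1 => q.1 q.2 := by fun_prop
  exact h3.comp_continuousOn (h1.prodMk h2.continuousOn)

/-- Differentiating `H(t, x, v) = w` and solving for `v'` gives a formula that contains only `x`,
`v` and the derivatives of `H` and `w`. That loss-free formula is what the bootstrapping in time
rests on. -/
theorem exists_derivWithin_of_implicit {X : Type u} [NormedAddCommGroup X] [NormedSpace ℝ X]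
    [FiniteDimensional ℝ X] {H : ℝ × (X × X) → X} (hH : ContDiffOn ℝ ∞ H (Icc (0 : ℝ) 1 ×ˢ univ))
    {x v w : ℝ → X} {t : ℝ} {w' : X} (ht : t ∈ Icc (0 : ℝ) 1)
    (hx : HasDerivWithinAt x (v t) (Icc 0 1) t) (hv : ContinuousWithinAt v (Icc 0 1) t)
    (hw : HasDerivWithinAt w w' (Icc 0 1) t) (heq : ∀ r ∈ Icc (0 : ℝ) 1, H (r, (x r, v r)) = w r)
    (hinj : ∀ b, partialSnd H (t, (x t, v t)) (0, b) = 0 → b = 0) :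
    HasDerivWithinAt v (((partialSnd H (t, (x t, v t))).comp (.inr ℝ X X)).inverse
      (w' - fderivWithin ℝ H (Icc (0 : ℝ) 1 ×ˢ univ) (t, (x t, v t)) (1, (v t, 0)))) (Icc 0 1) t := by
  set DH := fderivWithin ℝ H (Icc (0 : ℝ) 1 ×ˢ univ) (t, (x t, v t)) with hDH
  have hHd : HasFDerivWithinAt H DH (Icc (0 : ℝ) 1 ×ˢ univ) (t, (x t, v t)) :=
    (hH.differentiableOn (by simp) _ ⟨ht, trivial⟩).hasFDerivWithinAt
  have hpart : ∀ b, DH (0, (0, b)) = partialSnd H (t, (x t, v t)) (0, b) := fun b => rfl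
  have hxF := hx.hasFDerivWithinAt
  have hwF := hw.hasFDerivWithinAt
  have hfst : HasFDerivWithinAt (Prod.fst : ℝ × X → ℝ) (.fst ℝ ℝ X) (Icc (0 : ℝ) 1 ×ˢ univ)
      (t, v t) := hasFDerivWithinAt_fst
  have hmf : MapsTo (Prod.fst : ℝ × X → ℝ) (Icc (0 : ℝ) 1 ×ˢ univ) (Icc 0 1) := fun p hp => hp.1
  have hm : MapsTo (fun p : ℝ × X => (p.1, (x p.1, p.2))) (Icc (0 : ℝ) 1 ×ˢ univ)
      (Icc (0 : ℝ) 1 ×ˢ univ) := fun p hp => ⟨hp.1, trivial⟩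
  have hK := (HasFDerivWithinAt.comp (t, v t) hHd
    (hfst.prodMk ((hxF.comp (t, v t) hfst hmf).prodMk hasFDerivWithinAt_snd)) hm).sub
    (hwF.comp (t, v t) hfst hmf)
  have hdiff : DifferentiableWithinAt ℝ v (Icc 0 1) t := by
    refine differentiableWithinAt_of_implicit ht hK (fun b hb => hinj b ?_) hv fun r hr => ?_
    · simpa [← hpart] using hb
    · simpa [sub_eq_zero] using heq r hr
  have hd := hdiff.hasDerivWithinAt
  refine hd.congr_deriv ?_
  set d := derivWithin v (Icc 0 1) t
  have h1 : HasDerivWithinAt (fun r => H (r, (x r, v r))) (DH (1, (v t, d))) (Icc 0 1) t :=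
    hHd.comp_hasDerivWithinAt t ((hasDerivWithinAt_id t _).prodMk (hx.prodMk hd))
      (fun r hr => (⟨hr, trivial⟩ : (r, (x r, v r)) ∈ Icc (0 : ℝ) 1 ×ˢ (univ : Set (X × X))))
  have h2 : DH (1, (v t, d)) = w' := (uniqueDiffWithinAt_unitInterval ht).eq_deriv _ h1
    (hw.congr heq (heq t ht))
  set T := (partialSnd H (t, (x t, v t))).comp (.inr ℝ X X)
  have hTinj : Function.Injective T := (injective_iff_map_eq_zero T).2 fun b hb => hinj b hb
  set e : X ≃L[ℝ] X := (LinearEquiv.ofInjectiveEndo (T : X →ₗ[ℝ] X) hTinj).toContinuousLinearEquiv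
  have he : (e : X →L[ℝ] X) = T := by ext; rfl
  have h3 : T d = w' - DH (1, (v t, 0)) := by
    rw [← h2, ← map_sub]
    simp [T, ← hpart]
  rw [← h3, ← he, ContinuousLinearMap.inverse_equiv]
  exact (e.symm_apply_apply d).symm

/-- Joint smoothness of a smooth family of solutions of a regular implicit differential equation. -/
theorem contDiffOn_of_implicit_family (n : ℕ) : ∀ {X : Type u} [NormedAddCommGroup X]
    [NormedSpace ℝ X] [FiniteDimensional ℝ X] {H : ℝ × (X × X) → X}
    (_ : ContDiffOn ℝ ∞ H (Icc (0 : ℝ) 1 ×ˢ univ)) {U : ℝ → C(Icc (0 : ℝ) 1, X)} {ε : ℝ}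
    (_ : ContDiffOn ℝ ∞ U (Ioo (-ε) ε)) {w : ℝ × ℝ → X}
    (_ : ContDiffOn ℝ ∞ w (Ioo (-ε) ε ×ˢ Icc (0 : ℝ) 1))
    (_ : ∀ s ∈ Ioo (-ε) ε, ∀ t : Icc (0 : ℝ) 1, H (t, (volterra (U s) t, U s t)) = w (s, t))
    (_ : ∀ s ∈ Ioo (-ε) ε, ∀ t : Icc (0 : ℝ) 1, ∀ b,
      partialSnd H (t, (volterra (U s) t, U s t)) (0, b) = 0 → b = 0),
    ContDiffOn ℝ n (fun p : ℝ × ℝ => IccExtend zero_le_one (U p.1) p.2)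
      (Ioo (-ε) ε ×ˢ Icc (0 : ℝ) 1) ∧
    ContDiffOn ℝ n (fun p : ℝ × ℝ => IccExtend zero_le_one (volterra (U p.1)) p.2)
      (Ioo (-ε) ε ×ˢ Icc (0 : ℝ) 1) := by
  induction n with
  | zero =>
    intro X _ _ _ H hH U ε hU w hw heq hinj
    exact ⟨contDiffOn_zero.2 (continuousOn_eval hU.continuousOn),
      contDiffOn_zero.2 (continuousOn_eval (volterra.continuous.comp_continuousOn hU.continuousOn))⟩
  | succ n ih =>
    intro X _ _ _ H hH U ε hU w hw heq hinj
    have hUd : ∀ s ∈ Ioo (-ε) ε, HasDerivAt U (deriv U s) s := fun s hs =>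
      ((hU.differentiableOn (by simp) s hs).differentiableAt (isOpen_Ioo.mem_nhds hs)).hasDerivAt
    have hU' : ContDiffOn ℝ ∞ (deriv U) (Ioo (-ε) ε) :=
      ((contDiffOn_infty_iff_deriv_of_isOpen isOpen_Ioo).1 hU).2
    have hVd : ∀ s ∈ Ioo (-ε) ε, HasDerivAt (fun s => volterra (U s)) (volterra (deriv U s)) s :=
      fun s hs => (volterra (X := X)).hasFDerivAt.comp_hasDerivAt s (hUd s hs)
    set ι₁ := (ContinuousLinearMap.inl ℝ X X).compLeftContinuous ℝ (Icc (0 : ℝ) 1)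
    set ι₂ := (ContinuousLinearMap.inr ℝ X X).compLeftContinuous ℝ (Icc (0 : ℝ) 1)
    -- The pair `(u, ∂u/∂s)` solves the prolonged equation, so the induction hypothesis for `X × X`
    -- controls `∂u/∂s` as well as `u`. The induction therefore quantifies over all spaces.
    set P : ℝ → C(Icc (0 : ℝ) 1, X × X) := fun s => ι₁ (U s) + ι₂ (deriv U s)
    have hP : ContDiffOn ℝ ∞ P (Ioo (-ε) ε) :=
      (ι₁.contDiff.comp_contDiffOn hU).add (ι₂.contDiff.comp_contDiffOn hU')
    have hPt : ∀ s t, P s t = (U s t, deriv U s t) := fun s t => by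
      change (U s t, (0 : X)) + ((0 : X), deriv U s t) = _
      simp
    have hVP : ∀ s t, volterra (P s) t = (volterra (U s) t, volterra (deriv U s) t) := fun s t => by
      have : volterra (P s) = ι₁ (volterra (U s)) + ι₂ (volterra (deriv U s)) := by
        rw [← volterra_compLeft, ← volterra_compLeft, ← map_add]
      rw [this]
      change (volterra (U s) t, (0 : X)) + ((0 : X), volterra (deriv U s) t) = _
      simp
    have hwd : ContDiffOn ℝ ∞ (fun p => fderivWithin ℝ w (Ioo (-ε) ε ×ˢ Icc (0 : ℝ) 1) p)
        (Ioo (-ε) ε ×ˢ Icc (0 : ℝ) 1) :=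
      hw.fderivWithin (uniqueDiffOn_strip ε) (by simp)
    have hwD : ∀ p ∈ Ioo (-ε) ε ×ˢ Icc (0 : ℝ) 1, HasFDerivWithinAt w
        (fderivWithin ℝ w (Ioo (-ε) ε ×ˢ Icc (0 : ℝ) 1) p) (Ioo (-ε) ε ×ˢ Icc (0 : ℝ) 1) p :=
      fun p hp => (hw.differentiableOn (by simp) p hp).hasFDerivWithinAt
    have hev : ∀ (t : Icc (0 : ℝ) 1) {V : ℝ → C(Icc (0 : ℝ) 1, X)} {V' : C(Icc (0 : ℝ) 1, X)} {s : ℝ},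
        HasDerivAt V V' s → HasDerivAt (fun r => V r t) (V' t) s := fun t V V' s h =>
      ((ContinuousMap.evalCLM ℝ t : C(Icc (0 : ℝ) 1, X) →L[ℝ] X).hasFDerivAt
        (x := V s)).comp_hasDerivAt s h
    obtain ⟨h1, h2⟩ := ih (contDiffOn_prolongation hH) hP
      (w := fun p => (w p, fderivWithin ℝ w (Ioo (-ε) ε ×ˢ Icc (0 : ℝ) 1) p (1, 0)))
      (hw.prodMk (hwd.clm_apply contDiffOn_const)) (fun s hs t => by
        rw [hPt, hVP]
        refine Prod.ext (heq s hs t) ?_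
        have ha : HasDerivAt (fun r => H (t, (volterra (U r) t, U r t)))
            (partialSnd H (t, (volterra (U s) t, U s t)) (volterra (deriv U s) t, deriv U s t)) s :=
          HasFDerivAt.comp_hasDerivAt (f := fun r => (volterra (U r) t, U r t)) s
            (hasFDerivAt_partialSnd hH t.2 _)
            ((hev t (hVd s hs)).prodMk (hev t (hUd s hs)))
        refine ha.unique ((hasDerivAt_left_of_hasFDerivWithinAt hs t.2
          (hwD (s, t) ⟨hs, t.2⟩)).congr_of_eventuallyEq ?_)
        filter_upwards [isOpen_Ioo.mem_nhds hs] with r hr using heq r hr t)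
      (fun s hs t b hb => by
        rw [hPt, hVP] at hb
        exact partialSnd_prolongation_injective hH t.2 (hinj s hs t) b hb)
    have hu : ContDiffOn ℝ n (fun p : ℝ × ℝ => IccExtend zero_le_one (U p.1) p.2)
        (Ioo (-ε) ε ×ˢ Icc (0 : ℝ) 1) :=
      (contDiff_fst.comp_contDiffOn h1).congr fun p _ => (congrArg Prod.fst (hPt p.1 (projIcc 0 1 zero_le_one p.2))).symm
    have hu' : ContDiffOn ℝ n (fun p : ℝ × ℝ => IccExtend zero_le_one ⇑(deriv U p.1 : C(Icc (0 : ℝ) 1, X)) p.2)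
        (Ioo (-ε) ε ×ˢ Icc (0 : ℝ) 1) :=
      (contDiff_snd.comp_contDiffOn h1).congr fun p _ => (congrArg Prod.snd (hPt p.1 (projIcc 0 1 zero_le_one p.2))).symm
    have hx : ContDiffOn ℝ n (fun p : ℝ × ℝ => IccExtend zero_le_one (volterra (U p.1)) p.2)
        (Ioo (-ε) ε ×ˢ Icc (0 : ℝ) 1) :=
      (contDiff_fst.comp_contDiffOn h2).congr fun p _ => (congrArg Prod.fst (hVP p.1 (projIcc 0 1 zero_le_one p.2))).symm
    have hx' : ContDiffOn ℝ n (fun p : ℝ × ℝ => IccExtend zero_le_one (volterra (deriv U p.1)) p.2)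
        (Ioo (-ε) ε ×ˢ Icc (0 : ℝ) 1) :=
      (contDiff_snd.comp_contDiffOn h2).congr fun p _ => (congrArg Prod.snd (hVP p.1 (projIcc 0 1 zero_le_one p.2))).symm
    have hle : (n : WithTop ℕ∞) ≤ ∞ := ENat.LEInfty.out
    push_cast
    rw [contDiffOn_succ_iff_hasFDerivWithinAt_of_uniqueDiffOn (uniqueDiffOn_strip ε),
      contDiffOn_succ_iff_hasFDerivWithinAt_of_uniqueDiffOn (uniqueDiffOn_strip ε)]
    set σ : ℝ × ℝ → ℝ × (X × X) := fun p => (p.2, (IccExtend zero_le_one (volterra (U p.1)) p.2,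
      IccExtend zero_le_one (U p.1) p.2))
    have hσ : ContDiffOn ℝ n σ (Ioo (-ε) ε ×ˢ Icc (0 : ℝ) 1) :=
      contDiff_snd.contDiffOn.prodMk (hx.prodMk hu)
    have hσm : MapsTo σ (Ioo (-ε) ε ×ˢ Icc (0 : ℝ) 1) (Icc (0 : ℝ) 1 ×ˢ univ) :=
      fun p hp => ⟨hp.2, trivial⟩
    have hinjσ : ∀ p ∈ Ioo (-ε) ε ×ˢ Icc (0 : ℝ) 1, ∀ b, partialSnd H (σ p) (0, b) = 0 → b = 0 := by
      intro p hp b hb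
      simp only [σ, IccExtend_of_mem _ _ hp.2] at hb
      exact hinj p.1 hp.1 ⟨p.2, hp.2⟩ b hb
    -- The time derivative of `u`, in terms of quantities already known to be of class `Cⁿ`.
    set d : ℝ × ℝ → X := fun p => ((partialSnd H (σ p)).comp (.inr ℝ X X)).inverse
      (fderivWithin ℝ w (Ioo (-ε) ε ×ˢ Icc (0 : ℝ) 1) p (0, 1) -
        fderivWithin ℝ H (Icc (0 : ℝ) 1 ×ˢ univ) (σ p) (1, (IccExtend zero_le_one (U p.1) p.2, 0)))
    have hdsm : ContDiffOn ℝ n d (Ioo (-ε) ε ×ˢ Icc (0 : ℝ) 1) := by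
      have hDH : ContDiffOn ℝ n (fun p => fderivWithin ℝ H (Icc (0 : ℝ) 1 ×ˢ univ) (σ p))
          (Ioo (-ε) ε ×ˢ Icc (0 : ℝ) 1) :=
        ((hH.fderivWithin uniqueDiffOn_cylinder (m := ∞) (by simp)).of_le hle).comp hσ hσm
      refine ContDiffOn.clm_apply ?_ (((hwd.of_le hle).clm_apply contDiffOn_const).sub
        (hDH.clm_apply (contDiffOn_const.prodMk (hu.prodMk contDiffOn_const))))
      intro p hp
      set T := (partialSnd H (σ p)).comp (.inr ℝ X X)
      have hTinj : Function.Injective T := (injective_iff_map_eq_zero T).2 (hinjσ p hp)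
      set e : X ≃L[ℝ] X :=
        (LinearEquiv.ofInjectiveEndo (T : X →ₗ[ℝ] X) hTinj).toContinuousLinearEquiv
      have he : (e : X →L[ℝ] X) = T := by ext; rfl
      have h5 : ContDiffAt ℝ n ContinuousLinearMap.inverse T := he ▸ contDiffAt_map_inverse e
      exact h5.comp_contDiffWithinAt p (((((contDiffOn_partialSnd hH).of_le hle).comp hσ hσm) p
        hp).clm_comp contDiffWithinAt_const)
    refine ⟨⟨by simp, _, (contDiffOn_const (c := ContinuousLinearMap.fst ℝ ℝ ℝ)).smulRight hu' |>.add
      ((contDiffOn_const (c := ContinuousLinearMap.snd ℝ ℝ ℝ)).smulRight hdsm), ?_⟩,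
      ⟨by simp, _, (contDiffOn_const (c := ContinuousLinearMap.fst ℝ ℝ ℝ)).smulRight hx' |>.add
      ((contDiffOn_const (c := ContinuousLinearMap.snd ℝ ℝ ℝ)).smulRight hu), ?_⟩⟩
    · rintro ⟨s, t⟩ ⟨hs, ht⟩
      refine hasFDerivWithinAt_eval (hUd s hs) ?_
      exact exists_derivWithin_of_implicit hH (x := IccExtend zero_le_one (volterra (U s)))
        (v := IccExtend zero_le_one (U s)) (w := fun r => w (s, r)) ht
        (hasDerivWithinAt_volterra (U s) ht)
        ((U s).continuous.Icc_extend' (h := zero_le_one)).continuousWithinAt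
        (hasDerivWithinAt_right_of_hasFDerivWithinAt hs (hwD (s, t) ⟨hs, ht⟩))
        (fun r hr => by
          rw [IccExtend_of_mem _ _ hr, IccExtend_of_mem _ _ hr]
          exact heq s hs ⟨r, hr⟩)
        (hinjσ (s, t) ⟨hs, ht⟩)
    · rintro ⟨s, t⟩ ⟨hs, ht⟩
      exact hasFDerivWithinAt_eval (hVd s hs) (hasDerivWithinAt_volterra (U s) ht)
end

/-! ### From solutions of the linearised system to families of true solutions. -/

section
universe u
variable {X : Type u} [NormedAddCommGroup X] [NormedSpace ℝ X]

theorem volterra_derivWithin [CompleteSpace X] {δ : ℝ → X} (hδ : ContDiffOn ℝ ∞ δ (Icc 0 1)) (h0 : δ 0 = 0)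
    (hc : ContinuousOn (derivWithin δ (Icc 0 1)) (Icc 0 1)) (t : Icc (0 : ℝ) 1) :
    volterra (restrictUnit hc) t = δ t := by
  have hp : ∀ r ∈ Icc (0 : ℝ) 1, HasDerivWithinAt (primitive (restrictUnit hc))
      (derivWithin δ (Icc 0 1) r) (Icc 0 1) r := fun r hr => by
    have h1 := (hasDerivAt_primitive (restrictUnit hc) r).hasDerivWithinAt (s := Icc 0 1)
    rwa [IccExtend_of_mem _ _ hr] at h1
  refine eq_of_derivWithin_eq (fun r hr => (hp r hr).differentiableWithinAt)
    (hδ.differentiableOn (by simp)) (fun r hr => ?_) (by rw [primitive_zero, h0]) t t.2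
  have hr' := Ico_subset_Icc_self hr
  exact (hp r hr').derivWithin (uniqueDiffWithinAt_unitInterval hr')

theorem contDiffOn_derivWithin_unitInterval {F : Type*} [NormedAddCommGroup F] [NormedSpace ℝ F]
    {δ : ℝ → F} (hδ : ContDiffOn ℝ ∞ δ (Icc 0 1)) :
    ContDiffOn ℝ ∞ (derivWithin δ (Icc 0 1)) (Icc 0 1) :=
  hδ.derivWithin (uniqueDiffOn_Icc zero_lt_one) (by simp)

/-- The pair formed by the primitive of a curve and the curve. -/
def withPrimitive : C(Icc (0 : ℝ) 1, X) →L[ℝ] C(Icc (0 : ℝ) 1, X × X) :=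
  (ContinuousLinearMap.inl ℝ X X).compLeftContinuous ℝ (Icc (0 : ℝ) 1) ∘L volterra +
    (ContinuousLinearMap.inr ℝ X X).compLeftContinuous ℝ (Icc (0 : ℝ) 1)

theorem withPrimitive_apply (u : C(Icc (0 : ℝ) 1, X)) (t : Icc (0 : ℝ) 1) :
    withPrimitive u t = (volterra u t, u t) := by
  change (volterra u t, (0 : X)) + ((0 : X), u t) = _
  simp

/-- A block operator built from a bijection `S` and a section `V` of `K`. -/
def blockEquiv {U F : Type*} [NormedAddCommGroup U] [NormedSpace ℝ U] [NormedAddCommGroup F]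
    [NormedSpace ℝ F] (S : U ≃L[ℝ] U) (V : F →L[ℝ] U) (K : U →L[ℝ] F) (hKV : ∀ y, K (V y) = y) :
    (U × F) ≃L[ℝ] (U × F) :=
  ContinuousLinearEquiv.equivOfInverse
    (((S : U →L[ℝ] U).comp (.fst ℝ U F) - ((S : U →L[ℝ] U).comp V).comp (.snd ℝ U F)).prod
      (K.comp (.fst ℝ U F)))
    (((S.symm : U →L[ℝ] U).comp (.fst ℝ U F) +
        V.comp (ContinuousLinearMap.snd ℝ U F - (K.comp (S.symm : U →L[ℝ] U)).comp (.fst ℝ U F))).prod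
      (ContinuousLinearMap.snd ℝ U F - (K.comp (S.symm : U →L[ℝ] U)).comp (.fst ℝ U F)))
    (fun p => by ext <;> simp [hKV]) (fun p => by ext <;> simp [hKV])

end

section
universe u
variable {X : Type u} [NormedAddCommGroup X] [NormedSpace ℝ X] [FiniteDimensional ℝ X]
  {F : Type*} [NormedAddCommGroup F] [NormedSpace ℝ F] [FiniteDimensional ℝ F]

set_option maxHeartbeats 1000000 in
/-- Solutions of a regular implicit equation with a prescribed function of the right end point. -/
theorem exists_family_of_implicit {H : ℝ × (X × X) → X}
    (hH : ContDiffOn ℝ ∞ H (Icc (0 : ℝ) 1 ×ˢ univ)) (hH0 : ∀ t ∈ Icc (0 : ℝ) 1, H (t, 0) = 0)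
    {C : ℝ → X →L[ℝ] X} (hC : ContDiffOn ℝ ∞ C (Icc 0 1))
    (hHC : ∀ t ∈ Icc (0 : ℝ) 1, HasFDerivAt (fun y => H (t, y)) ((C t).coprod (.id ℝ X)) 0)
    {e : X → F} {O : Set X} (hO : O ∈ nhds 0) (he : ContDiffOn ℝ ∞ e O)
    {Δ : ℝ → F →L[ℝ] X} (hΔ : ContDiffOn ℝ ∞ Δ (Icc 0 1)) (hΔ0 : Δ 0 = 0)
    (hΔ1 : ∀ y, fderiv ℝ e 0 (Δ 1 y) = y)
    {δ : ℝ → X} (hδ : ContDiffOn ℝ ∞ δ (Icc 0 1)) (hδ0 : δ 0 = 0)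
    (hδ1 : fderiv ℝ e 0 (δ 1) = 0) :
    ∃ ε > 0, ∃ (x : ℝ → ℝ → X) (τ : ℝ → F),
      ContDiffOn ℝ ∞ (fun p : ℝ × ℝ => x p.1 p.2) (Ioo (-ε) ε ×ˢ Icc (0 : ℝ) 1) ∧
      (∀ s, x s 0 = 0) ∧ (∀ t, x 0 t = 0) ∧
      (∀ s ∈ Ioo (-ε) ε, ∀ t ∈ Icc (0 : ℝ) 1, H (t, (x s t, derivWithin (x s) (Icc 0 1) t)) =
        s • (C t (δ t) + derivWithin δ (Icc 0 1) t) +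
          (C t (Δ t (τ s)) + derivWithin Δ (Icc 0 1) t (τ s))) ∧
      (∀ s ∈ Ioo (-ε) ε, e (x s 1) = e 0) ∧ HasDerivAt (fun s => x s 1) (δ 1) 0 := by
  have := FiniteDimensional.complete ℝ X
  have := FiniteDimensional.complete ℝ F
  have one_mem : (1 : ℝ) ∈ Icc (0 : ℝ) 1 := right_mem_Icc.2 zero_le_one
  set κ := fderiv ℝ e 0 with hκ
  set ev : C(Icc (0 : ℝ) 1, X) →L[ℝ] X :=
    (ContinuousMap.evalCLM ℝ (⟨1, one_mem⟩ : Icc (0 : ℝ) 1)).comp volterra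
  have hδ' := contDiffOn_derivWithin_unitInterval hδ
  have hΔ' := contDiffOn_derivWithin_unitInterval hΔ
  -- `S` is the linearisation at `0` of `u ↦ H(t, ∫ u, u)`, namely `u ↦ C ∫ u + u`.
  have hS := isUnit_one_sub_volterra (-(restrictUnit hC.continuousOn))
  set S := ContinuousLinearEquiv.ofUnit hS.unit with hSdef
  have hSa : ∀ u t, S u t = C t (volterra u t) + u t := fun u t => by
    change u t - (-(C t)) (volterra u t) = _
    simp [add_comm]
  set V : F →L[ℝ] C(Icc (0 : ℝ) 1, X) := LinearMap.toContinuousLinearMap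
    { toFun := fun y => restrictUnit (hΔ'.continuousOn.clm_apply (continuousOn_const (c := y)))
      map_add' := fun y y' => by ext t; exact map_add (derivWithin Δ (Icc 0 1) t) y y'
      map_smul' := fun a y => by ext t; exact map_smul (derivWithin Δ (Icc 0 1) t) a y } with hV
  have hVa : ∀ y t, V y t = derivWithin Δ (Icc 0 1) t y := fun y t => rfl
  have hVv : ∀ y t, volterra (V y) t = Δ t y := fun y t => by
    have hd : ∀ r ∈ Icc (0 : ℝ) 1, derivWithin (fun r => Δ r y) (Icc 0 1) r =
        derivWithin Δ (Icc 0 1) r y := fun r hr => by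
      have h1 := ((hΔ.differentiableOn (by simp) r hr).hasDerivWithinAt).clm_apply
        (hasDerivWithinAt_const r (Icc 0 1) y)
      simpa using h1.derivWithin (uniqueDiffWithinAt_unitInterval hr)
    have hs := hΔ.clm_apply (contDiffOn_const (c := y))
    have h2 := volterra_derivWithin hs (by simp [hΔ0])
      (contDiffOn_derivWithin_unitInterval hs).continuousOn t
    rw [← h2]
    congr 2
    ext r
    exact (hd r r.2).symm
  set K : C(Icc (0 : ℝ) 1, X) →L[ℝ] F :=
    κ.comp ev with hK
  have hKa : ∀ u, K u = κ (volterra u ⟨1, one_mem⟩) := fun u => rfl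
  have hKV : ∀ y, K (V y) = y := fun y => by rw [hKa, hVv]; exact hΔ1 y
  -- The unknowns are the velocity `u` and a finite-dimensional correction `τ` along the directions
  -- of `Δ`; the second equation uses `τ` to hold the end point fixed. The derivative of `T` at `0`
  -- is `blockEquiv`.
  set T : C(Icc (0 : ℝ) 1, X) × F → C(Icc (0 : ℝ) 1, X) × F := fun p =>
    (superposition H hH.continuousOn (withPrimitive p.1) - S (V p.2),
      e (volterra p.1 ⟨1, one_mem⟩) - e 0) with hT
  have hev : Continuous fun p : C(Icc (0 : ℝ) 1, X) × F =>
      volterra p.1 (⟨1, one_mem⟩ : Icc (0 : ℝ) 1) :=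
    ev.continuous.comp
      continuous_fst
  have hevs : ContDiff ℝ ∞ fun p : C(Icc (0 : ℝ) 1, X) × F =>
      volterra p.1 (⟨1, one_mem⟩ : Icc (0 : ℝ) 1) :=
    ContDiff.comp (g := fun u : C(Icc (0 : ℝ) 1, X) => volterra u (⟨1, one_mem⟩ : Icc (0 : ℝ) 1))
      ev.contDiff
      contDiff_fst
  have hs : (fun p : C(Icc (0 : ℝ) 1, X) × F =>
      volterra p.1 (⟨1, one_mem⟩ : Icc (0 : ℝ) 1)) ⁻¹' O ∈ nhds 0 :=
    hev.continuousAt.preimage_mem_nhds (by simpa using hO)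
  have hTs : ContDiffOn ℝ ∞ T ((fun p : C(Icc (0 : ℝ) 1, X) × F =>
      volterra p.1 (⟨1, one_mem⟩ : Icc (0 : ℝ) 1)) ⁻¹' O) := by
    refine ContDiffOn.prodMk (ContDiff.contDiffOn ?_)
      ((he.comp hevs.contDiffOn fun p hp => hp).sub contDiffOn_const)
    exact (((contDiff_superposition hH).comp withPrimitive.contDiff).comp contDiff_fst).sub
      ((S.contDiff.comp V.contDiff).comp contDiff_snd)
  have hH00 : ∀ t ∈ Icc (0 : ℝ) 1, partialSnd H (t, 0) = (C t).coprod (.id ℝ X) := fun t ht =>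
    (hasFDerivAt_partialSnd hH ht 0).unique (hHC t ht)
  have hT0 : T 0 = 0 := by
    refine Prod.ext (ContinuousMap.ext fun t => ?_) (by simp [hT])
    simp only [hT, Prod.fst_zero, Prod.snd_zero, map_zero, sub_zero]
    exact hH0 t t.2
  have hTd : HasFDerivAt T (blockEquiv S V K hKV : _ →L[ℝ] _) 0 := by
    have h1 := HasFDerivAt.comp (f := fun p : C(Icc (0 : ℝ) 1, X) × F => withPrimitive p.1)
      (0 : C(Icc (0 : ℝ) 1, X) × F) (hasFDerivAt_superposition hH _)
      ((withPrimitive (X := X)).hasFDerivAt.comp (0 : C(Icc (0 : ℝ) 1, X) × F) hasFDerivAt_fst)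
    have h2 := ((S : C(Icc (0 : ℝ) 1, X) →L[ℝ] C(Icc (0 : ℝ) 1, X)).comp V).hasFDerivAt.comp (0 : C(Icc (0 : ℝ) 1, X) × F)
      hasFDerivAt_snd
    have h3 : HasFDerivAt e κ (volterra (0 : C(Icc (0 : ℝ) 1, X) × F).1 ⟨1, one_mem⟩) := by
      have := ((he.contDiffAt hO).differentiableAt (by simp)).hasFDerivAt
      simpa using this
    have h4 := (HasFDerivAt.comp (f := fun p : C(Icc (0 : ℝ) 1, X) × F =>
      volterra p.1 (⟨1, one_mem⟩ : Icc (0 : ℝ) 1)) (0 : C(Icc (0 : ℝ) 1, X) × F) h3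
      (ev.hasFDerivAt.comp
        (0 : C(Icc (0 : ℝ) 1, X) × F) hasFDerivAt_fst)).sub_const (e 0)
    refine ((h1.sub h2).prodMk h4).congr_fderiv (ContinuousLinearMap.ext fun p => ?_)
    refine Prod.ext (ContinuousMap.ext fun t => ?_) rfl
    change partialSnd H (t, withPrimitive (0 : C(Icc (0 : ℝ) 1, X)) t) (withPrimitive p.1 t) -
      S (V p.2) t = S p.1 t - S (V p.2) t
    rw [withPrimitive_apply, map_zero, hSa p.1, withPrimitive_apply]
    change partialSnd H (t, 0) _ - _ = _
    rw [hH00 t t.2]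
    simp
  obtain ⟨g, U, hU, h0U, hg, hg0, hfg, hgd⟩ := exists_smooth_localInverse hs hTs hTd
  rw [hT0] at h0U hg0 hgd
  set d := restrictUnit hδ'.continuousOn with hd
  have hdv : ∀ t, volterra d t = δ t := volterra_derivWithin hδ hδ0 hδ'.continuousOn
  set ι : ℝ → C(Icc (0 : ℝ) 1, X) × F := fun s => s • (S d, 0) with hι
  have hιc : ContDiff ℝ ∞ ι := contDiff_id.smul contDiff_const
  have hι0 : ι 0 = 0 := zero_smul _ _
  have hιU : ι ⁻¹' U ∈ nhds 0 :=
    hιc.continuous.continuousAt.preimage_mem_nhds (by rw [hι0]; exact hU.mem_nhds h0U)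
  set Ψ := fun u => superposition (partialSnd H) (contDiffOn_partialSnd hH).continuousOn
    (withPrimitive u) with hΨ
  have hΨc : Continuous Ψ := (continuous_superposition _ _).comp withPrimitive.continuous
  have hgι : ContinuousAt (fun s => g (ι s)) 0 := by
    refine ContinuousAt.comp (g := g) ?_ hιc.continuous.continuousAt
    rw [hι0]
    exact hg.continuousOn.continuousAt (hU.mem_nhds h0U)
  -- At `0` the derivative of `H` in the velocity is the identity; a perturbation of norm less than
  -- one keeps it injective, as the joint smoothness result requires.
  have hnear : ∀ᶠ s in nhds (0 : ℝ), ι s ∈ U ∧ ‖Ψ (g (ι s)).1 - Ψ 0‖ < 1 := by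
    refine Filter.Eventually.and hιU ?_
    have hc : ContinuousAt (fun s => ‖Ψ (g (ι s)).1 - Ψ 0‖) 0 :=
      ((hΨc.continuousAt.comp (continuousAt_fst.comp hgι)).sub continuousAt_const).norm
    refine hc.eventually (gt_mem_nhds ?_)
    simp [hι0, hg0]
  obtain ⟨ε, hε, hball⟩ := Metric.eventually_nhds_iff_ball.1 hnear
  rw [Real.ball_eq_Ioo, zero_sub, zero_add] at hball
  have hgs : ContDiffOn ℝ ∞ (fun s => g (ι s)) (Ioo (-ε) ε) :=
    hg.comp hιc.contDiffOn fun s hs => (hball s hs).1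
  have hfst : ContDiffOn ℝ ∞ (fun s => (g (ι s)).1) (Ioo (-ε) ε) :=
    contDiff_fst.comp_contDiffOn hgs
  have hτ : ContDiffOn ℝ ∞ (fun s => (g (ι s)).2) (Ioo (-ε) ε) :=
    contDiff_snd.comp_contDiffOn hgs
  set w : ℝ × ℝ → X := fun p => p.1 • (C p.2 (δ p.2) + derivWithin δ (Icc 0 1) p.2) +
    (C p.2 (Δ p.2 (g (ι p.1)).2) + derivWithin Δ (Icc 0 1) p.2 (g (ι p.1)).2) with hw
  have hm2 : MapsTo (Prod.snd : ℝ × ℝ → ℝ) (Ioo (-ε) ε ×ˢ Icc (0 : ℝ) 1) (Icc 0 1) :=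
    fun p hp => hp.2
  have hm1 : MapsTo (Prod.fst : ℝ × ℝ → ℝ) (Ioo (-ε) ε ×ˢ Icc (0 : ℝ) 1) (Ioo (-ε) ε) :=
    fun p hp => hp.1
  have hws : ContDiffOn ℝ ∞ w (Ioo (-ε) ε ×ˢ Icc (0 : ℝ) 1) := by
    have hC2 := hC.comp contDiffOn_snd hm2
    have hτ1 := hτ.comp contDiffOn_fst hm1
    exact (contDiffOn_fst.smul ((hC2.clm_apply (hδ.comp contDiffOn_snd hm2)).add
      (hδ'.comp contDiffOn_snd hm2))).add
      ((hC2.clm_apply ((hΔ.comp contDiffOn_snd hm2).clm_apply hτ1)).add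
        ((hΔ'.comp contDiffOn_snd hm2).clm_apply hτ1))
  have heq : ∀ s ∈ Ioo (-ε) ε, ∀ t : Icc (0 : ℝ) 1,
      H (t, (volterra (g (ι s)).1 t, (g (ι s)).1 t)) = w (s, t) := by
    intro s hs t
    have h1 := congrArg (fun p => p.1 t) (hfg _ (hball s hs).1)
    change H (t, withPrimitive (g (ι s)).1 t) - S (V (g (ι s)).2) t = s • S d t at h1
    rw [sub_eq_iff_eq_add, withPrimitive_apply, hSa, hSa, hdv, hVv, hVa] at h1
    exact h1
  have hinj : ∀ s ∈ Ioo (-ε) ε, ∀ t : Icc (0 : ℝ) 1, ∀ b,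
      partialSnd H (t, (volterra (g (ι s)).1 t, (g (ι s)).1 t)) (0, b) = 0 → b = 0 := by
    intro s hs t b hb
    by_contra hb0
    have h1 := (Ψ (g (ι s)).1 - Ψ 0).norm_coe_le_norm t
    have h2 : (Ψ (g (ι s)).1 - Ψ 0) t (0, b) = -b := by
      change partialSnd H (t, withPrimitive (g (ι s)).1 t) (0, b) -
        partialSnd H (t, withPrimitive 0 t) (0, b) = -b
      rw [withPrimitive_apply, hb, map_zero]
      change _ - partialSnd H (t, 0) (0, b) = _
      rw [hH00 t t.2]
      simp
    have h3 := ((Ψ (g (ι s)).1 - Ψ 0) t).le_opNorm (0, b)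
    have h4 : ‖((0 : X), b)‖ = ‖b‖ := by simp [Prod.norm_def]
    rw [h2, norm_neg, h4] at h3
    have h5 : 0 < ‖b‖ := norm_pos_iff.2 hb0
    nlinarith [(hball s hs).2]
  have hjoint : ContDiffOn ℝ ∞
      (fun p : ℝ × ℝ => IccExtend zero_le_one (volterra (g (ι p.1)).1) p.2)
      (Ioo (-ε) ε ×ˢ Icc (0 : ℝ) 1) :=
    contDiffOn_infty.2 fun n => (contDiffOn_of_implicit_family n hH hfst hws heq hinj).2
  refine ⟨ε, hε, fun s t => IccExtend zero_le_one (volterra (g (ι s)).1) t,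
    fun s => (g (ι s)).2, hjoint, fun s => ?_, fun t => ?_, fun s hs t ht => ?_, fun s hs => ?_, ?_⟩
  · beta_reduce
    rw [IccExtend_of_mem _ _ (left_mem_Icc.2 zero_le_one)]
    exact primitive_zero _
  · simp [hι0, hg0, IccExtend]
  · have h1 := (hasDerivWithinAt_volterra (g (ι s)).1 ht).derivWithin
      (uniqueDiffWithinAt_unitInterval ht)
    change H (t, (_, derivWithin (IccExtend zero_le_one (volterra (g (ι s)).1)) (Icc 0 1) t)) = _
    beta_reduce
    rw [h1, IccExtend_of_mem _ _ ht, IccExtend_of_mem _ _ ht]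
    exact heq s hs ⟨t, ht⟩
  · have h1 := congrArg Prod.snd (hfg _ (hball s hs).1)
    change e (volterra (g (ι s)).1 ⟨1, one_mem⟩) - e 0 = s • (0 : F) at h1
    rw [smul_zero, sub_eq_zero] at h1
    beta_reduce
    rw [IccExtend_of_mem _ _ one_mem]
    exact h1
  · have hιd : HasDerivAt ι (S d, 0) 0 := by
      have := (hasDerivAt_id (0 : ℝ)).smul_const (S d, (0 : F))
      rwa [one_smul] at this
    have h1 := HasFDerivAt.comp_hasDerivAt (0 : ℝ) (hι0 ▸ hgd) hιd
    -- To first order no correction `τ` is needed, because `δ` already satisfies the linearised end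
    -- condition.
    have h2 : (blockEquiv S V K hKV).symm (S d, 0) = (d, 0) := by
      rw [ContinuousLinearEquiv.symm_apply_eq]
      change (S d, (0 : F)) = (S d - S (V 0), K d)
      rw [hKa, hdv, hδ1]
      simp
    have h3 := (ev.comp (.fst ℝ C(Icc (0 : ℝ) 1, X) F)).hasFDerivAt.comp_hasDerivAt
      (0 : ℝ) h1
    have h4 : (fun s => IccExtend zero_le_one (volterra (g (ι s)).1) 1) = fun s => ev (g (ι s)).1 :=
      funext fun s => IccExtend_of_mem zero_le_one (volterra (g (ι s)).1) one_mem
    rw [h4]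
    refine h3.congr_deriv ?_
    change volterra ((blockEquiv S V K hKV).symm (S d, 0)).1 _ = _
    rw [h2, hdv]

/-- Smooth families of solutions of an underdetermined system whose linearisation is controllable
at the right end point. -/
theorem exists_family_of_linearSolution {m : ℕ} {G : ℝ × (X × X) → (Fin m → ℝ)}
    (hG : ContDiffOn ℝ ∞ G (Icc (0 : ℝ) 1 ×ˢ univ)) (hG0 : ∀ t ∈ Icc (0 : ℝ) 1, G (t, 0) = 0)
    {A B : ℝ → X →L[ℝ] (Fin m → ℝ)} (hA : ContDiffOn ℝ ∞ A (Icc 0 1))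
    (hB : ContDiffOn ℝ ∞ B (Icc 0 1)) (hsurj : ∀ t ∈ Icc (0 : ℝ) 1, Function.Surjective (A t))
    (hGd : ∀ t ∈ Icc (0 : ℝ) 1, HasFDerivAt (fun y => G (t, y)) ((B t).coprod (A t)) 0)
    {e : X → F} {O : Set X} (hO : O ∈ nhds 0) (he : ContDiffOn ℝ ∞ e O)
    (hreach : ∀ y, ∃ x ∈ reachable A B, fderiv ℝ e 0 x = y)
    {δ : ℝ → X} (hδ : IsLinearSolution A B δ) (hδ1 : fderiv ℝ e 0 (δ 1) = 0) :
    ∃ ε > 0, ∃ x : ℝ → ℝ → X,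
      ContDiffOn ℝ ∞ (fun p : ℝ × ℝ => x p.1 p.2) (Ioo (-ε) ε ×ˢ Icc (0 : ℝ) 1) ∧
      (∀ s, x s 0 = 0) ∧ (∀ t, x 0 t = 0) ∧
      (∀ s ∈ Ioo (-ε) ε, ∀ t ∈ Icc (0 : ℝ) 1,
        G (t, (x s t, derivWithin (x s) (Icc 0 1) t)) = 0) ∧
      (∀ s ∈ Ioo (-ε) ε, e (x s 1) = e 0) ∧ HasDerivAt (fun s => x s 1) (δ 1) 0 := by
  obtain ⟨R, hR, hAR⟩ := exists_smooth_rightInverse hA hsurj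
  set b := Module.finBasis ℝ F
  choose x₁ hx₁ hx₁e using fun i => hreach (b i)
  choose η hη hη1 using hx₁
  -- Linear combinations of solutions whose end points map to a basis of `F`, so that the
  -- differential of `e` at `0` inverts `Δ 1`.
  set Δ : ℝ → F →L[ℝ] X := fun t =>
    ∑ i, (LinearMap.toContinuousLinearMap (b.coord i)).smulRight (η i t) with hΔdef
  have hΔa : ∀ t y, Δ t y = ∑ i, b.coord i y • η i t := fun t y => by
    simp [hΔdef]
  have hΔ : ContDiffOn ℝ ∞ Δ (Icc 0 1) := ContDiffOn.sum fun i _ =>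
    (ContinuousLinearMap.smulRightL ℝ F X
      (LinearMap.toContinuousLinearMap (b.coord i))).contDiff.comp_contDiffOn (hη i).smooth
  have hΔ' : ∀ t ∈ Icc (0 : ℝ) 1, ∀ y, derivWithin Δ (Icc 0 1) t y =
      ∑ i, b.coord i y • derivWithin (η i) (Icc 0 1) t := fun t ht y => by
    have h1 := ((hΔ.differentiableOn (by simp) t ht).hasDerivWithinAt).clm_apply
      (hasDerivWithinAt_const t (Icc 0 1) y)
    have h2 : HasDerivWithinAt (fun r => Δ r y)
        (∑ i, b.coord i y • derivWithin (η i) (Icc 0 1) t) (Icc 0 1) t := by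
      simp only [hΔa]
      exact HasDerivWithinAt.fun_sum fun i _ =>
        (((hη i).smooth.differentiableOn (by simp) t ht).hasDerivWithinAt).const_smul _
    simpa using (uniqueDiffWithinAt_unitInterval ht).eq_deriv _ h1 h2
  -- The square completion of `G`: applying `A` gives back `G`, and the complementary part fixes the
  -- velocity along the kernel of `A`. The linearisation at `0` is `(x, v) ↦ R B x + v`.
  set H : ℝ × (X × X) → X := fun p => R p.1 (G p) + (p.2.2 - R p.1 (A p.1 p.2.2)) with hHdef
  have hm : MapsTo (Prod.fst : ℝ × (X × X) → ℝ) (Icc (0 : ℝ) 1 ×ˢ univ) (Icc 0 1) :=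
    fun p hp => hp.1
  have hH : ContDiffOn ℝ ∞ H (Icc (0 : ℝ) 1 ×ˢ univ) := by
    have hR1 := hR.comp contDiffOn_fst hm
    have hv : ContDiffOn ℝ ∞ (fun p : ℝ × (X × X) => p.2.2) (Icc (0 : ℝ) 1 ×ˢ univ) := by fun_prop
    exact (hR1.clm_apply hG).add
      (hv.sub (hR1.clm_apply ((hA.comp contDiffOn_fst hm).clm_apply hv)))
  have hAH : ∀ t ∈ Icc (0 : ℝ) 1, ∀ y, A t (H (t, y)) = G (t, y) := fun t ht y => by
    simp only [hHdef, map_add, map_sub, hAR t ht]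
    abel
  obtain ⟨ε, hε, x, τ, hx, hx0, h0x, hHx, hex, hxd⟩ := exists_family_of_implicit hH
    (fun t ht => by simp [hHdef, hG0 t ht]) (hR.clm_comp hB) (fun t ht => by
      have h1 := (R t).hasFDerivAt.comp (0 : X × X) (hGd t ht)
      have h2 := (ContinuousLinearMap.snd ℝ X X - ((R t).comp (A t)).comp
        (ContinuousLinearMap.snd ℝ X X)).hasFDerivAt (x := (0 : X × X))
      refine (h1.add h2).congr_fderiv (ContinuousLinearMap.ext fun y => ?_)
      simp) hO he hΔ (by
      ext y
      simp [hΔa, (hη _).zero]) (fun y => by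
      rw [hΔa, map_sum]
      simp only [map_smul, hη1, hx₁e]
      exact b.sum_repr y) hδ.smooth hδ.zero hδ1
  refine ⟨ε, hε, x, hx, hx0, h0x, fun s hs t ht => ?_, hex, hxd⟩
  rw [← hAH t ht, hHx s hs t ht]
  -- The right-hand side of the equation for `H` is built from linear solutions, so `A` annihilates
  -- it and `G` vanishes along the family.
  have h1 : ∀ {η : ℝ → X}, IsLinearSolution A B η →
      A t (((R t).comp (B t)) (η t) + derivWithin η (Icc 0 1) t) = 0 := fun {η} h => by
    rw [map_add, ContinuousLinearMap.comp_apply, hAR t ht, add_comm]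
    exact h.eq t ht
  rw [map_add, map_smul, h1 hδ, smul_zero, zero_add, hΔa, hΔ' t ht, map_sum,
    ← Finset.sum_add_distrib, map_sum]
  refine Finset.sum_eq_zero fun i _ => ?_
  rw [map_smul, ← smul_add, map_smul, h1 (hη i), smul_zero]
end

/-! ### Deformations of the identity and tubes around a curve. -/

section
universe u v
variable {E : Type u} [NormedAddCommGroup E] [NormedSpace ℝ E]
  {M : Type v} [TopologicalSpace M] [ChartedSpace E M]

/-- There are a finite-dimensional parameter space and a smooth family `P(·, y)` of deformations of
the identity of `M` whose derivative in the parameter at `0` is onto at each point of `K`. -/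
def HasDeformation (K : Set M) : Prop :=
  ∃ (Y : Type u) (_ : NormedAddCommGroup Y) (_ : NormedSpace ℝ Y) (_ : FiniteDimensional ℝ Y)
    (P : M × Y → M), ContMDiff (𝓘(ℝ, E).prod 𝓘(ℝ, Y)) 𝓘(ℝ, E) ∞ P ∧ (∀ q, P (q, 0) = q) ∧
      ∀ q ∈ K, Function.Surjective (mfderiv 𝓘(ℝ, Y) 𝓘(ℝ, E) (fun y => P (q, y)) 0)

theorem contMDiff_partial_snd {Y : Type*} [NormedAddCommGroup Y] [NormedSpace ℝ Y] {P : M × Y → M}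
    (hP : ContMDiff (𝓘(ℝ, E).prod 𝓘(ℝ, Y)) 𝓘(ℝ, E) ∞ P) (q : M) :
    ContMDiff 𝓘(ℝ, Y) 𝓘(ℝ, E) ∞ fun y => P (q, y) :=
  hP.comp (contMDiff_const.prodMk contMDiff_id)

/-- Compose the two deformations. Restricting the composite to either parameter space recovers that
deformation, so its derivative is onto wherever one of the two is. -/
theorem HasDeformation.union {K K' : Set M} (h : HasDeformation (E := E) K)
    (h' : HasDeformation (E := E) K') : HasDeformation (E := E) (K ∪ K') := by
  obtain ⟨Y, _, _, _, P, hP, hP0, hPs⟩ := h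
  obtain ⟨Y', _, _, _, P', hP', hP0', hPs'⟩ := h'
  have hsm : ContMDiff (𝓘(ℝ, E).prod 𝓘(ℝ, Y × Y')) 𝓘(ℝ, E) ∞
      fun p : M × (Y × Y') => P' (P (p.1, p.2.1), p.2.2) := by
    have h1 : ContMDiff (𝓘(ℝ, E).prod 𝓘(ℝ, Y × Y')) 𝓘(ℝ, Y) ∞ fun p : M × (Y × Y') => p.2.1 :=
      contDiff_fst.contMDiff.comp contMDiff_snd
    have h2 : ContMDiff (𝓘(ℝ, E).prod 𝓘(ℝ, Y × Y')) 𝓘(ℝ, Y') ∞ fun p : M × (Y × Y') => p.2.2 :=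
      contDiff_snd.contMDiff.comp contMDiff_snd
    exact hP'.comp ((hP.comp (contMDiff_fst.prodMk h1)).prodMk h2)
  refine ⟨Y × Y', inferInstance, inferInstance, inferInstance, _, hsm,
    fun q => by simp [hP0, hP0'], fun q hq => ?_⟩
  have hd := (contMDiff_partial_snd hsm q).mdifferentiable (by simp) (0 : Y × Y')
  rcases hq with hq | hq
  · have h1 := mfderiv_comp (I := 𝓘(ℝ, Y)) (I' := 𝓘(ℝ, Y × Y')) (0 : Y)
      (f := ContinuousLinearMap.inl ℝ Y Y') hd
      ((ContinuousLinearMap.inl ℝ Y Y').contDiff.contMDiff.mdifferentiableAt (n := ∞) (by simp))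
    have h2 : ((fun y : Y × Y' => P' (P (q, y.1), y.2)) ∘
      ContinuousLinearMap.inl ℝ Y Y') =
      fun y => P (q, y) := funext fun y => hP0' _
    rw [h2] at h1
    have h3 := hPs q hq
    rw [h1] at h3
    exact Function.Surjective.of_comp h3
  · have h1 := mfderiv_comp (I := 𝓘(ℝ, Y')) (I' := 𝓘(ℝ, Y × Y')) (0 : Y')
      (f := ContinuousLinearMap.inr ℝ Y Y') hd
      ((ContinuousLinearMap.inr ℝ Y Y').contDiff.contMDiff.mdifferentiableAt (n := ∞) (by simp))
    have h2 : ((fun y : Y × Y' => P' (P (q, y.1), y.2)) ∘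
      ContinuousLinearMap.inr ℝ Y Y') =
      fun y => P' (q, y) := funext fun y => by simp [hP0]
    rw [h2] at h1
    have h3 := hPs' q hq
    rw [h1] at h3
    exact Function.Surjective.of_comp h3

variable [FiniteDimensional ℝ E]

theorem hasDeformation_empty : HasDeformation (E := E) (∅ : Set M) :=
  ⟨E, inferInstance, inferInstance, inferInstance, Prod.fst, contMDiff_fst, fun _ => rfl,
    fun _ hq => hq.elim⟩

variable [T2Space M] [IsManifold 𝓘(ℝ, E) ∞ M]

/-- In a chart, translate by `χ(q) g(v) v` with two bump functions: `χ` localises near `q₀`, and `g`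
bounds the displacement, so the deformation is defined for every parameter `v`. -/
theorem hasDeformation_nhds (q₀ : M) : ∃ K ∈ nhds q₀, HasDeformation (E := E) K := by
  set e := chartAt E q₀ with he
  have hea : e ∈ atlas E M := chart_mem_atlas E q₀
  obtain ⟨r, hr, hball⟩ := Metric.isOpen_iff.1 e.open_target (e q₀) (mem_chart_target E q₀)
  have hext : ∀ q, extChartAt 𝓘(ℝ, E) q₀ q = e q := fun q => rfl
  let χ : SmoothBumpFunction 𝓘(ℝ, E) q₀ :=
    { rIn := r / 4
      rOut := r / 2
      rIn_pos := by positivity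
      rIn_lt_rOut := by linarith
      closedBall_subset := by
        refine inter_subset_left.trans ?_
        rw [extChartAt_target]
        intro x hx
        refine ⟨hball (Metric.closedBall_subset_ball (by linarith) hx), by simp⟩ }
  -- Both outer radii are `r / 2`: the support of `χ` and the displacement together stay in the ball
  -- of radius `r` inside the chart.
  let g : ContDiffBump (0 : E) := ⟨r / 4, r / 2, by positivity, by linarith⟩
  have hσ : ContDiff ℝ ∞ fun v => g v • v := g.contDiff.smul contDiff_id
  have hσr : ∀ v, ‖g v • v‖ < r / 2 := by
    intro v
    by_cases hv : ‖v‖ < r / 2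
    · rw [norm_smul, Real.norm_of_nonneg g.nonneg]
      exact (mul_le_of_le_one_left (norm_nonneg v) g.le_one).trans_lt hv
    · rw [g.zero_of_le_dist (by simpa using hv), zero_smul, norm_zero]
      positivity
  have hmem : ∀ q ∈ e.source, ∀ v, e q + χ q • (g v • v) ∈ e.target := by
    intro q hq v
    by_cases h0 : χ q = 0
    · rw [h0, zero_smul, add_zero]; exact e.map_source hq
    · have h1 : q ∈ Function.support χ := h0
      rw [χ.support_eq_inter_preimage] at h1
      refine hball ?_
      have h2 : ‖e q - e q₀‖ < r / 2 := mem_ball_iff_norm.1 h1.2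
      rw [mem_ball_iff_norm]
      have h3 : ‖χ q • (g v • v)‖ < r / 2 := by
        rw [norm_smul, Real.norm_of_nonneg χ.nonneg]
        exact (mul_le_of_le_one_left (norm_nonneg _) χ.le_one).trans_lt (hσr v)
      have h4 := norm_add_le (e q - e q₀) (χ q • (g v • v))
      rw [sub_add_eq_add_sub] at h4
      linarith
  classical
  set P : M × E → M := fun p =>
    if p.1 ∈ e.source then e.symm (e p.1 + χ p.1 • (g p.2 • p.2)) else p.1 with hP
  have hPin : ∀ q ∈ e.source, ∀ v, P (q, v) = e.symm (e q + χ q • (g v • v)) := fun q hq v =>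
    if_pos hq
  have hPχ : ∀ q, χ q = 0 → ∀ v, P (q, v) = q := by
    intro q hq v
    by_cases h : q ∈ e.source
    · rw [hPin q h, hq, zero_smul, add_zero, e.left_inv h]
    · exact if_neg h
  have hsm : ContMDiff (𝓘(ℝ, E).prod 𝓘(ℝ, E)) 𝓘(ℝ, E) ∞ P := by
    rintro ⟨q, v⟩
    by_cases hq : q ∈ e.source
    · have h1 : ContMDiffAt (𝓘(ℝ, E).prod 𝓘(ℝ, E)) 𝓘(ℝ, E) ∞
          (fun p : M × E => e p.1 + χ p.1 • (g p.2 • p.2)) (q, v) :=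
        ((contMDiffAt_chart hea hq).comp (q, v) contMDiffAt_fst).add
          (ContMDiffAt.smul (χ.contMDiffAt.comp (q, v) contMDiffAt_fst)
            (hσ.contMDiff.contMDiffAt.comp (q, v) contMDiffAt_snd))
      refine ((contMDiffAt_chart_symm hea (hmem q hq v)).comp (q, v) h1).congr_of_eventuallyEq ?_
      filter_upwards [continuous_fst.continuousAt.preimage_mem_nhds
        (e.open_source.mem_nhds hq)] with p hp using hPin p.1 hp p.2
    -- Outside the chart domain one is off the closed support of `χ`, near which the deformation is
    -- the identity.
    · have hq' : q ∉ tsupport χ := fun h => hq (χ.tsupport_subset_chartAt_source h)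
      refine (contMDiffAt_fst).congr_of_eventuallyEq ?_
      filter_upwards [continuous_fst.continuousAt.preimage_mem_nhds
        ((isClosed_tsupport χ).isOpen_compl.mem_nhds hq')] with p hp
      exact hPχ p.1 (image_eq_zero_of_notMem_tsupport hp) p.2
  have hP0 : ∀ q, P (q, 0) = q := by
    intro q
    by_cases h : q ∈ e.source
    · rw [hPin q h, smul_zero, smul_zero, add_zero, e.left_inv h]
    · exact if_neg h
  refine ⟨Function.support χ, χ.support_mem_nhds, E, inferInstance, inferInstance, inferInstance,
    P, hsm, hP0, fun q hq => ?_⟩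
  have hqs : q ∈ e.source := χ.support_subset_source hq
  -- Near `v = 0` the cutoff `g` is one, so in coordinates the map is a translation by `χ(q) v`, and
  -- `χ(q) ≠ 0` on the support.
  have h1 : HasFDerivAt (fun v : E => e (P (q, v))) (χ q • ContinuousLinearMap.id ℝ E) 0 := by
    have h2 : HasFDerivAt (fun v : E => e q + χ q • v) (χ q • ContinuousLinearMap.id ℝ E) 0 :=
      ((hasFDerivAt_id (0 : E)).const_smul (χ q)).const_add (e q)
    refine h2.congr_of_eventuallyEq ?_
    filter_upwards [g.eventuallyEq_one] with v hv
    rw [hPin q hqs, e.right_inv (hmem q hqs v), hv]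
    simp
  intro w
  obtain ⟨v, hv⟩ := (bijective_chartFrame hea hqs).2 w
  have hc := contMDiff_partial_snd hsm q
  have hframe := chartFrame_mfderivWithin hea (s := univ) ((hc 0).contMDiffWithinAt)
    uniqueDiffWithinAt_univ (by rwa [hP0]) ((χ q)⁻¹ • v)
  rw [fderivWithin_univ, mfderivWithin_univ, h1.fderiv] at hframe
  refine ⟨(χ q)⁻¹ • v, hframe.symm.trans ?_⟩
  rw [hP0]
  have h0 : χ q ≠ 0 := hq
  simpa [smul_smul, h0] using hv

theorem hasDeformation_of_isCompact {K : Set M} (hK : IsCompact K) :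
    HasDeformation (E := E) K := by
  refine hK.induction_on hasDeformation_empty ?_ (fun _ _ h h' => h.union h') fun q _ => ?_
  · rintro s t hst ⟨Y, h1, h2, h3, P, hP, hP0, hPs⟩
    exact ⟨Y, h1, h2, h3, P, hP, hP0, fun q hq => hPs q (hst hq)⟩
  · obtain ⟨K, hK, h⟩ := hasDeformation_nhds (E := E) q
    exact ⟨K, mem_nhdsWithin_of_mem_nhds hK, h⟩

/-- A curve extends to a smooth family of curves with enough parameters to move each of its points
in all directions. -/
theorem exists_tube {c : ℝ → M} (hc : ContMDiffOn 𝓘(ℝ, ℝ) 𝓘(ℝ, E) ∞ c (Icc 0 1)) :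
    ∃ (Y : Type u) (_ : NormedAddCommGroup Y) (_ : NormedSpace ℝ Y) (_ : FiniteDimensional ℝ Y)
      (F : ℝ × Y → M), ContMDiffOn 𝓘(ℝ, ℝ × Y) 𝓘(ℝ, E) ∞ F (Icc (0 : ℝ) 1 ×ˢ univ) ∧
      (∀ t, F (t, 0) = c t) ∧
      ∀ t ∈ Icc (0 : ℝ) 1, Function.Surjective
        (mfderiv 𝓘(ℝ, Y) 𝓘(ℝ, E) (fun y => F (t, y)) 0) := by
  obtain ⟨Y, _, _, _, P, hP, hP0, hPs⟩ :=
    hasDeformation_of_isCompact (E := E) (isCompact_Icc.image_of_continuousOn hc.continuousOn)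
  refine ⟨Y, inferInstance, inferInstance, inferInstance, fun p => P (c p.1, p.2), ?_,
    fun t => hP0 _, fun t ht => hPs _ (mem_image_of_mem c ht)⟩
  have h1 : ContMDiff 𝓘(ℝ, ℝ × Y) 𝓘(ℝ, ℝ) ∞ (Prod.fst : ℝ × Y → ℝ) := contDiff_fst.contMDiff
  have h2 : ContMDiff 𝓘(ℝ, ℝ × Y) 𝓘(ℝ, Y) ∞ (Prod.snd : ℝ × Y → Y) := contDiff_snd.contMDiff
  exact hP.comp_contMDiffOn ((hc.comp h1.contMDiffOn fun p hp => hp.1).prodMk h2.contMDiffOn)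
end

/-! ### The constraints in tube coordinates. -/

section
universe u v
variable {E : Type u} [NormedAddCommGroup E] [NormedSpace ℝ E]
  {M : Type v} [TopologicalSpace M] [ChartedSpace E M]
  {Y : Type u} [NormedAddCommGroup Y] [NormedSpace ℝ Y] {k : ℕ}

/-- The velocity at `t` of the curves `r ↦ F (r, y(r))` with `y(t) = y` and `ẏ(t) = v`. -/
def tubeVelocity (F : ℝ × Y → M) (p : ℝ × Y × Y) : TangentBundle 𝓘(ℝ, E) M :=
  ⟨F (p.1, p.2.1), mfderivWithin 𝓘(ℝ, ℝ × Y) 𝓘(ℝ, E) F (Icc (0 : ℝ) 1 ×ˢ univ) (p.1, p.2.1)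
    ((1, p.2.2) : ℝ × Y)⟩

/-- The constraints, as functions of the parameters `(y, ζ)` of the curves `(F (t, y), z + ζ)` and
of their derivatives. -/
def tubeConstraint (φ : Fin (k + 1) → TangentBundle 𝓘(ℝ, E) M × (ℝ × ℝ) → ℝ) (F : ℝ × Y → M)
    (z : ℝ → ℝ) (p : ℝ × ((Y × ℝ) × (Y × ℝ))) (a : Fin (k + 1)) : ℝ :=
  φ a (tubeVelocity F (p.1, p.2.1.1, p.2.2.1), (z p.1 + p.2.1.2, zdot z p.1 + p.2.2.2))

/-- The derivative of a tube in its parameters at `0`. -/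
def tubeFrame (F : ℝ × Y → M) (t : ℝ) : Y →L[ℝ] E :=
  mfderiv 𝓘(ℝ, Y) 𝓘(ℝ, E) (fun y => F (t, y)) 0

/-- The velocity of a curve as an element of the model space. -/
def fibreVelocity (c : ℝ → M) (t : ℝ) : E := (velocity 𝓘(ℝ, E) c t).2

variable {F : ℝ × Y → M} {c : ℝ → M} {z : ℝ → ℝ} {t : ℝ}
  {φ : Fin (k + 1) → TangentBundle 𝓘(ℝ, E) M × (ℝ × ℝ) → ℝ}

theorem mdifferentiableWithinAt_tube
    (hF : ContMDiffOn 𝓘(ℝ, ℝ × Y) 𝓘(ℝ, E) ∞ F (Icc (0 : ℝ) 1 ×ˢ univ)) (ht : t ∈ Icc (0 : ℝ) 1)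
    (y : Y) : MDifferentiableWithinAt 𝓘(ℝ, ℝ × Y) 𝓘(ℝ, E) F (Icc (0 : ℝ) 1 ×ˢ univ) (t, y) :=
  (hF (t, y) ⟨ht, trivial⟩).mdifferentiableWithinAt (by simp)

theorem velocity_tube (hF : ContMDiffOn 𝓘(ℝ, ℝ × Y) 𝓘(ℝ, E) ∞ F (Icc (0 : ℝ) 1 ×ˢ univ))
    (ht : t ∈ Icc (0 : ℝ) 1) {y : ℝ → Y} (hy : DifferentiableWithinAt ℝ y (Icc 0 1) t) :
    velocity 𝓘(ℝ, E) (fun r => F (r, y r)) t =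
      tubeVelocity F (t, y t, derivWithin y (Icc 0 1) t) := by
  have h1 : HasFDerivWithinAt (fun r => (r, y r)) ((ContinuousLinearMap.id ℝ ℝ).prod
      (ContinuousLinearMap.toSpanSingleton ℝ (derivWithin y (Icc 0 1) t))) (Icc 0 1) t :=
    (hasFDerivWithinAt_id t _).prodMk hy.hasDerivWithinAt.hasFDerivWithinAt
  have h2 := mfderivWithin_comp t (mdifferentiableWithinAt_tube hF ht (y t))
    (f := fun r => (r, y r)) h1.differentiableWithinAt.mdifferentiableWithinAt
    (s := Icc 0 1) (fun r hr => ⟨hr, trivial⟩) (uniqueDiffWithinAt_unitInterval ht).uniqueMDiffWithinAt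
  have h3 := congrArg (fun D => D (1 : ℝ)) h2
  rw [velocity, tubeVelocity]
  refine congrArg (Bundle.TotalSpace.mk _) (h3.trans ?_)
  rw [mfderivWithin_eq_fderivWithin, h1.fderivWithin (uniqueDiffWithinAt_unitInterval ht)]
  change mfderivWithin 𝓘(ℝ, ℝ × Y) 𝓘(ℝ, E) F (Icc (0 : ℝ) 1 ×ˢ univ) (t, y t)
    ((1, (1 : ℝ) • derivWithin y (Icc 0 1) t) : ℝ × Y) = _
  rw [one_smul]

/-- This is the passage to a first-order system in the vector space `Y × ℝ`, to which the flat
theory above applies. -/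
theorem tubeConstraint_path (hF : ContMDiffOn 𝓘(ℝ, ℝ × Y) 𝓘(ℝ, E) ∞ F (Icc (0 : ℝ) 1 ×ˢ univ))
    (hz : ContDiffOn ℝ ∞ z (Icc 0 1)) (ht : t ∈ Icc (0 : ℝ) 1) {x : ℝ → Y × ℝ}
    (hx : DifferentiableWithinAt ℝ x (Icc 0 1) t) (a : Fin (k + 1)) :
    φ a (velocity 𝓘(ℝ, E) (fun r => F (r, (x r).1)) t,
        (z t + (x t).2, zdot (fun r => z r + (x r).2) t)) =
      tubeConstraint φ F z (t, (x t, derivWithin x (Icc 0 1) t)) a := by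
  have hx' := hx.hasDerivWithinAt
  have h1 : HasDerivWithinAt (fun r => (x r).1) (derivWithin x (Icc 0 1) t).1 (Icc 0 1) t :=
    (ContinuousLinearMap.fst ℝ Y ℝ).hasFDerivAt.comp_hasDerivWithinAt t hx'
  have h2 : HasDerivWithinAt (fun r => (x r).2) (derivWithin x (Icc 0 1) t).2 (Icc 0 1) t :=
    (ContinuousLinearMap.snd ℝ Y ℝ).hasFDerivAt.comp_hasDerivWithinAt t hx'
  have hu := uniqueDiffWithinAt_unitInterval ht
  have h3 : zdot (fun r => z r + (x r).2) t = zdot z t + (derivWithin x (Icc 0 1) t).2 :=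
    ((hz.differentiableOn (by simp) t ht).hasDerivWithinAt.add h2).derivWithin hu
  rw [velocity_tube hF ht h1.differentiableWithinAt, h1.derivWithin hu, h3]
  rfl

/-- Split the direction `(1, v)` into `(1, 0)`, which gives the velocity of `c`, and `(0, v)`, which
gives the frame. Over the base curve the tube velocity is thus affine in `v`, so velocity
derivatives of `φ` pull back linearly. -/
theorem tubeVelocity_zero (hF : ContMDiffOn 𝓘(ℝ, ℝ × Y) 𝓘(ℝ, E) ∞ F (Icc (0 : ℝ) 1 ×ˢ univ))
    (hF0 : ∀ t, F (t, 0) = c t) (ht : t ∈ Icc (0 : ℝ) 1) (v : Y) :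
    tubeVelocity F (t, 0, v) = ⟨c t, (fibreVelocity c t + tubeFrame F t v : E)⟩ := by
  have h1 := velocity_tube hF ht (y := fun _ => 0) (differentiableWithinAt_const _)
  have hc : (fun r => F (r, (0 : Y))) = c := funext hF0
  rw [hc] at h1
  set D : ℝ × Y →L[ℝ] E := mfderivWithin 𝓘(ℝ, ℝ × Y) 𝓘(ℝ, E) F (Icc (0 : ℝ) 1 ×ˢ univ) (t, (0 : Y))
  have hcv : fibreVelocity (E := E) c t = D (1, 0) := by
    rw [velocity, tubeVelocity, derivWithin_fun_const] at h1
    exact eq_of_heq (Bundle.TotalSpace.ext_iff.1 h1).2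
  have h2 := mfderivWithin_comp (0 : Y) (mdifferentiableWithinAt_tube hF ht (0 : Y))
    (f := fun y => (t, y)) (I := 𝓘(ℝ, Y)) (s := univ)
    (hasFDerivAt_prodMk_right (𝕜 := ℝ) t (0 : Y)).differentiableAt.differentiableWithinAt.mdifferentiableWithinAt
    (fun r _ => ⟨ht, trivial⟩) (uniqueMDiffWithinAt_univ _)
  rw [mfderivWithin_univ, mfderivWithin_univ, mfderiv_eq_fderiv,
    (hasFDerivAt_prodMk_right (𝕜 := ℝ) t (0 : Y)).fderiv] at h2
  have h3 : tubeFrame (E := E) F t v = D (0, v) := congrArg (fun D => D v) h2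
  have h4 : D (1, v) = fibreVelocity (E := E) c t + tubeFrame (E := E) F t v := by
    rw [hcv, h3, ← map_add]
    simp
  exact Bundle.TotalSpace.ext (hF0 t) (heq_of_eq h4)

variable [IsManifold 𝓘(ℝ, E) ∞ M]

theorem contMDiffOn_tubeVelocity
    (hF : ContMDiffOn 𝓘(ℝ, ℝ × Y) 𝓘(ℝ, E) ∞ F (Icc (0 : ℝ) 1 ×ˢ univ)) :
    ContMDiffOn 𝓘(ℝ, ℝ × Y × Y) 𝓘(ℝ, E).tangent ∞ (tubeVelocity (E := E) F)
      (Icc (0 : ℝ) 1 ×ˢ univ) := by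
  have h2 := hF.contMDiffOn_tangentMapWithin (m := ∞) (by simp) uniqueDiffOn_cylinder.uniqueMDiffOn
  have h3 := contMDiff_tangentBundle_mk (E := ℝ × Y)
  have h4 : ContMDiff 𝓘(ℝ, ℝ × Y × Y) 𝓘(ℝ, (ℝ × Y) × (ℝ × Y)) ∞
      fun p : ℝ × Y × Y => ((p.1, p.2.1), ((1 : ℝ), p.2.2)) := ContDiff.contMDiff (by fun_prop)
  exact h2.comp (h3.comp h4).contMDiffOn fun p hp => ⟨hp.1, trivial⟩

theorem contDiffOn_tubeConstraint
    (hφ : ∀ a, ContMDiff (𝓘(ℝ, E).tangent.prod 𝓘(ℝ, ℝ × ℝ)) 𝓘(ℝ, ℝ) ∞ (φ a))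
    (hF : ContMDiffOn 𝓘(ℝ, ℝ × Y) 𝓘(ℝ, E) ∞ F (Icc (0 : ℝ) 1 ×ˢ univ))
    (hz : ContDiffOn ℝ ∞ z (Icc 0 1)) :
    ContDiffOn ℝ ∞ (tubeConstraint φ F z) (Icc (0 : ℝ) 1 ×ˢ univ) := by
  refine contDiffOn_pi.2 fun a => ?_
  rw [← contMDiffOn_iff_contDiffOn]
  have hm : MapsTo (Prod.fst : ℝ × ((Y × ℝ) × (Y × ℝ)) → ℝ) (Icc (0 : ℝ) 1 ×ˢ univ) (Icc 0 1) :=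
    fun p hp => hp.1
  have h1 : ContMDiff 𝓘(ℝ, ℝ × ((Y × ℝ) × (Y × ℝ))) 𝓘(ℝ, ℝ × Y × Y) ∞
      fun p : ℝ × ((Y × ℝ) × (Y × ℝ)) => (p.1, p.2.1.1, p.2.2.1) := ContDiff.contMDiff (by fun_prop)
  have h2 : ContDiffOn ℝ ∞ (fun p : ℝ × ((Y × ℝ) × (Y × ℝ)) =>
      (z p.1 + p.2.1.2, zdot z p.1 + p.2.2.2)) (Icc (0 : ℝ) 1 ×ˢ univ) :=
    ((hz.comp contDiffOn_fst hm).add (by fun_prop)).prodMk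
      (((contDiffOn_zdot hz).comp contDiffOn_fst hm).add (by fun_prop))
  exact (hφ a).comp_contMDiffOn (((contMDiffOn_tubeVelocity hF).comp h1.contMDiffOn
    fun p hp => ⟨hp.1, trivial⟩).prodMk h2.contMDiffOn)

/-- The derivative of the constraints along a tube in the velocities of the parameters. -/
def tubeVelocityDeriv (φ : Fin (k + 1) → TangentBundle 𝓘(ℝ, E) M × (ℝ × ℝ) → ℝ) (F : ℝ × Y → M)
    (z : ℝ → ℝ) (t : ℝ) : Y × ℝ →L[ℝ] (Fin (k + 1) → ℝ) :=
  (partialSnd (tubeConstraint φ F z) (t, 0)).comp (.inr ℝ (Y × ℝ) (Y × ℝ))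

/-- The derivative of the constraints along a tube in the parameters. -/
def tubeParameterDeriv (φ : Fin (k + 1) → TangentBundle 𝓘(ℝ, E) M × (ℝ × ℝ) → ℝ) (F : ℝ × Y → M)
    (z : ℝ → ℝ) (t : ℝ) : Y × ℝ →L[ℝ] (Fin (k + 1) → ℝ) :=
  (partialSnd (tubeConstraint φ F z) (t, 0)).comp (.inl ℝ (Y × ℝ) (Y × ℝ))

theorem contDiffOn_partialSnd_tubeConstraint
    (hφ : ∀ a, ContMDiff (𝓘(ℝ, E).tangent.prod 𝓘(ℝ, ℝ × ℝ)) 𝓘(ℝ, ℝ) ∞ (φ a))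
    (hF : ContMDiffOn 𝓘(ℝ, ℝ × Y) 𝓘(ℝ, E) ∞ F (Icc (0 : ℝ) 1 ×ˢ univ))
    (hz : ContDiffOn ℝ ∞ z (Icc 0 1)) :
    ContDiffOn ℝ ∞ (fun t : ℝ => partialSnd (tubeConstraint φ F z) (t, 0)) (Icc 0 1) := by
  have hm : MapsTo (fun t : ℝ => (t, (0 : (Y × ℝ) × (Y × ℝ)))) (Icc 0 1) (Icc (0 : ℝ) 1 ×ˢ univ) :=
    fun t ht => ⟨ht, trivial⟩
  exact (contDiffOn_partialSnd (contDiffOn_tubeConstraint hφ hF hz)).comp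
    (contDiffOn_id.prodMk contDiffOn_const) hm

theorem contDiffOn_tubeVelocityDeriv
    (hφ : ∀ a, ContMDiff (𝓘(ℝ, E).tangent.prod 𝓘(ℝ, ℝ × ℝ)) 𝓘(ℝ, ℝ) ∞ (φ a))
    (hF : ContMDiffOn 𝓘(ℝ, ℝ × Y) 𝓘(ℝ, E) ∞ F (Icc (0 : ℝ) 1 ×ˢ univ))
    (hz : ContDiffOn ℝ ∞ z (Icc 0 1)) :
    ContDiffOn ℝ ∞ (tubeVelocityDeriv φ F z) (Icc 0 1) :=
  (contDiffOn_partialSnd_tubeConstraint hφ hF hz).clm_comp contDiffOn_const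

theorem contDiffOn_tubeParameterDeriv
    (hφ : ∀ a, ContMDiff (𝓘(ℝ, E).tangent.prod 𝓘(ℝ, ℝ × ℝ)) 𝓘(ℝ, ℝ) ∞ (φ a))
    (hF : ContMDiffOn 𝓘(ℝ, ℝ × Y) 𝓘(ℝ, E) ∞ F (Icc (0 : ℝ) 1 ×ˢ univ))
    (hz : ContDiffOn ℝ ∞ z (Icc 0 1)) :
    ContDiffOn ℝ ∞ (tubeParameterDeriv φ F z) (Icc 0 1) :=
  (contDiffOn_partialSnd_tubeConstraint hφ hF hz).clm_comp contDiffOn_const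

theorem hasFDerivAt_tubeConstraint
    (hφ : ∀ a, ContMDiff (𝓘(ℝ, E).tangent.prod 𝓘(ℝ, ℝ × ℝ)) 𝓘(ℝ, ℝ) ∞ (φ a))
    (hF : ContMDiffOn 𝓘(ℝ, ℝ × Y) 𝓘(ℝ, E) ∞ F (Icc (0 : ℝ) 1 ×ˢ univ))
    (hz : ContDiffOn ℝ ∞ z (Icc 0 1)) (ht : t ∈ Icc (0 : ℝ) 1) :
    HasFDerivAt (fun y => tubeConstraint φ F z (t, y))
      ((tubeParameterDeriv φ F z t).coprod (tubeVelocityDeriv φ F z t)) 0 := by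
  refine (hasFDerivAt_partialSnd (contDiffOn_tubeConstraint hφ hF hz) ht 0).congr_fderiv ?_
  ext y <;> simp [tubeParameterDeriv, tubeVelocityDeriv]

/-- The derivative of the constraints in the velocities `(q̇, ż)`. -/
def velocityDeriv (φ : Fin (k + 1) → TangentBundle 𝓘(ℝ, E) M × (ℝ × ℝ) → ℝ) (c : ℝ → M)
    (z : ℝ → ℝ) (t : ℝ) (a : Fin (k + 1)) : E × ℝ →L[ℝ] ℝ :=
  fderiv ℝ (fun y : E × ℝ => φ a ((⟨c t, y.1⟩ : TangentBundle 𝓘(ℝ, E) M), (z t, y.2)))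
    (fibreVelocity c t, zdot z t)

theorem hasFDerivAt_velocityDeriv
    (hφ : ∀ a, ContMDiff (𝓘(ℝ, E).tangent.prod 𝓘(ℝ, ℝ × ℝ)) 𝓘(ℝ, ℝ) ∞ (φ a))
    (hc : ContMDiffOn 𝓘(ℝ, ℝ) 𝓘(ℝ, E) ∞ c (Icc 0 1)) (ht : t ∈ Icc (0 : ℝ) 1)
    (a : Fin (k + 1)) : HasFDerivAt
      (fun y : E × ℝ => φ a ((⟨c t, y.1⟩ : TangentBundle 𝓘(ℝ, E) M), (z t, y.2)))
      (velocityDeriv φ c z t a) (fibreVelocity c t, zdot z t) := by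
  obtain ⟨D, hD, -⟩ := exists_hasFDerivAt_fibre (chart_mem_atlas E (c t)) (hφ a) hc ht
    (mem_chart_source E (c t)) (z t, zdot z t)
  have h1 : HasFDerivAt (fun y : E × ℝ => (y.1, (z t, y.2)))
      ((ContinuousLinearMap.fst ℝ E ℝ).prod
        ((ContinuousLinearMap.inr ℝ ℝ ℝ).comp (.snd ℝ E ℝ)))
      (fibreVelocity c t, zdot z t) := by
    refine hasFDerivAt_fst.prodMk ?_
    exact HasFDerivAt.comp (f := fun y : E × ℝ => y.2) (fibreVelocity c t, zdot z t)
      (hasFDerivAt_prodMk_right (𝕜 := ℝ) (z t) (zdot z t)) hasFDerivAt_snd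
  exact (HasFDerivAt.comp (E := E × ℝ) (f := fun y : E × ℝ => (y.1, (z t, y.2)))
    (fibreVelocity c t, zdot z t) hD h1).differentiableAt.hasFDerivAt

theorem velocityDeriv_apply
    (hφ : ∀ a, ContMDiff (𝓘(ℝ, E).tangent.prod 𝓘(ℝ, ℝ × ℝ)) 𝓘(ℝ, ℝ) ∞ (φ a))
    (hc : ContMDiffOn 𝓘(ℝ, ℝ) 𝓘(ℝ, E) ∞ c (Icc 0 1)) (ht : t ∈ Icc (0 : ℝ) 1)
    (a : Fin (k + 1)) (v : E) (w : ℝ) : velocityDeriv φ c z t a (v, w) =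
      fibreDeriv (φ a) c (z t, zdot z t) t v + partialZdot 𝓘(ℝ, E) (φ a) c z t * w := by
  have hD := hasFDerivAt_velocityDeriv (z := z) hφ hc ht a
  have h1 : fibreDeriv (φ a) c (z t, zdot z t) t = (velocityDeriv φ c z t a).comp (.inl ℝ E ℝ) :=
    HasFDerivAt.fderiv (HasFDerivAt.comp (f := fun v : E => (v, zdot z t)) (fibreVelocity c t) hD
      (hasFDerivAt_prodMk_left (𝕜 := ℝ) (fibreVelocity c t) (zdot z t)))
  have h2 : partialZdot 𝓘(ℝ, E) (φ a) c z t = velocityDeriv φ c z t a (0, 1) :=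
    HasDerivAt.deriv (HasFDerivAt.comp_hasDerivAt (f := fun w : ℝ => (fibreVelocity (E := E) c t, w))
      (zdot z t) hD ((hasDerivAt_const (zdot z t) (fibreVelocity (E := E) c t)).prodMk
        (hasDerivAt_id (zdot z t))))
  have h3 : ((v, w) : E × ℝ) = (v, 0) + w • (0, 1) := by simp
  rw [h1, h2, h3, map_add, map_smul, smul_eq_mul, mul_comm]
  rfl

theorem tubeVelocityDeriv_apply
    (hφ : ∀ a, ContMDiff (𝓘(ℝ, E).tangent.prod 𝓘(ℝ, ℝ × ℝ)) 𝓘(ℝ, ℝ) ∞ (φ a))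
    (hc : ContMDiffOn 𝓘(ℝ, ℝ) 𝓘(ℝ, E) ∞ c (Icc 0 1))
    (hF : ContMDiffOn 𝓘(ℝ, ℝ × Y) 𝓘(ℝ, E) ∞ F (Icc (0 : ℝ) 1 ×ˢ univ))
    (hF0 : ∀ t, F (t, 0) = c t) (hz : ContDiffOn ℝ ∞ z (Icc 0 1)) (ht : t ∈ Icc (0 : ℝ) 1)
    (x : Y × ℝ) (a : Fin (k + 1)) :
    tubeVelocityDeriv φ F z t x a = velocityDeriv φ c z t a (tubeFrame F t x.1, x.2) := by
  have h1 := (hasFDerivAt_tubeConstraint hφ hF hz ht).comp (0 : Y × ℝ)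
    (hasFDerivAt_prodMk_right (𝕜 := ℝ) (0 : Y × ℝ) (0 : Y × ℝ))
  have h2 := (ContinuousLinearMap.proj (R := ℝ) (φ := fun _ : Fin (k + 1) => ℝ) a).hasFDerivAt.comp
    (0 : Y × ℝ) h1
  set D : Y × ℝ →L[ℝ] E × ℝ := (tubeFrame F t).prodMap (.id ℝ ℝ)
  have h3 : HasFDerivAt (fun x : Y × ℝ => (fibreVelocity c t, zdot z t) + D x) D 0 :=
    D.hasFDerivAt.const_add _
  have h4 := HasFDerivAt.comp (f := fun x : Y × ℝ => (fibreVelocity c t, zdot z t) + D x)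
    (0 : Y × ℝ) (by simpa using hasFDerivAt_velocityDeriv (z := z) hφ hc ht a) h3
  have h5 := h2.unique (h4.congr_of_eventuallyEq (Filter.Eventually.of_forall fun x => by
    change φ a (tubeVelocity F (t, 0, x.1), (z t + 0, zdot z t + x.2)) = _
    rw [add_zero, tubeVelocity_zero hF hF0 ht]
    rfl))
  have h6 := congrArg (fun D => D x) h5
  have h7 : D x = (tubeFrame F t x.1, x.2) := rfl
  simpa [h7] using h6
end

/-! ### Duality, and multipliers obtained from a tube. -/

section

/-- A proper range would lie in the kernel of a nonzero functional on `ℝᵐ`, whose coefficients form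
a linear relation between the `f a`. -/
theorem surjective_pi_of_linearIndependent {X : Type*} [NormedAddCommGroup X] [NormedSpace ℝ X]
    {m : ℕ} {f : Fin m → X →L[ℝ] ℝ} (hf : LinearIndependent ℝ f) :
    Function.Surjective fun x a => f a x := by
  set T : X →ₗ[ℝ] (Fin m → ℝ) := LinearMap.pi fun a => (f a : X →ₗ[ℝ] ℝ) with hT
  suffices h : T.range = ⊤ by
    intro y
    obtain ⟨x, hx⟩ := LinearMap.range_eq_top.1 h y
    exact ⟨x, hx⟩
  by_contra hne
  obtain ⟨g, hg, hgT⟩ := Submodule.exists_le_ker_of_lt_top _ (lt_top_iff_ne_top.2 hne)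
  have hgs : ∀ y, g y = ∑ a, y a * g (Pi.single a 1) := fun y => by
    conv_lhs => rw [pi_eq_sum_univ' y]
    simp
  have h1 := Fintype.linearIndependent_iff.1 hf (fun a => g (Pi.single a 1)) (by
    ext x
    have h2 : g (T x) = 0 := hgT ⟨x, rfl⟩
    rw [hgs] at h2
    simpa [hT, mul_comm] using h2)
  exact hg (LinearMap.ext fun y => by rw [hgs]; simp [h1])

/-- A functional on a subspace `R` that vanishes on the kernel of a map `κ` which is onto on `R`
factors through `κ`. -/
theorem exists_factor_of_surjOn {X E : Type*} [NormedAddCommGroup X] [NormedSpace ℝ X]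
    [NormedAddCommGroup E] [NormedSpace ℝ E] [FiniteDimensional ℝ E] {R : Submodule ℝ X}
    {κ : X →L[ℝ] E} (hκ : ∀ y, ∃ x ∈ R, κ x = y) (f : X →L[ℝ] ℝ)
    (hf : ∀ x ∈ R, κ x = 0 → f x = 0) : ∃ η : E →L[ℝ] ℝ, ∀ x ∈ R, f x = η (κ x) := by
  set κR : R →ₗ[ℝ] E := (κ : X →ₗ[ℝ] E).comp R.subtype
  obtain ⟨σ, hσ⟩ := κR.exists_rightInverse_of_surjective (LinearMap.range_eq_top.2 fun y => by
    obtain ⟨x, hx, h⟩ := hκ y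
    exact ⟨⟨x, hx⟩, h⟩)
  refine ⟨LinearMap.toContinuousLinearMap ((f : X →ₗ[ℝ] ℝ).comp (R.subtype.comp σ)), fun x hx => ?_⟩
  have h1 : κ (σ (κ x)) = κ x := DFunLike.congr_fun hσ (κ x)
  have h2 := hf (x - σ (κ x)) (R.sub_mem hx (σ (κ x)).2) (by rw [map_sub, h1, sub_self])
  rw [map_sub, sub_eq_zero] at h2
  exact h2

universe u v
variable {E : Type u} [NormedAddCommGroup E] [NormedSpace ℝ E]
  {M : Type v} [TopologicalSpace M] [ChartedSpace E M]
  {Y : Type u} [NormedAddCommGroup Y] [NormedSpace ℝ Y] {k : ℕ}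
  {F : ℝ × Y → M} {c : ℝ → M} {z : ℝ → ℝ} {t : ℝ}
  {φ : Fin (k + 1) → TangentBundle 𝓘(ℝ, E) M × (ℝ × ℝ) → ℝ}

/-- The curves of a tube with given parameters. -/
def tubeFamily (F : ℝ × Y → M) (z : ℝ → ℝ) (x : ℝ → ℝ → Y × ℝ) (s : ℝ) : (ℝ → M) × (ℝ → ℝ) :=
  (fun r => F (r, (x s r).1), fun r => z r + (x s r).2)

theorem isFamily_tubeFamily (hF : ContMDiffOn 𝓘(ℝ, ℝ × Y) 𝓘(ℝ, E) ∞ F (Icc (0 : ℝ) 1 ×ˢ univ))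
    (hF0 : ∀ t, F (t, 0) = c t) (hz : ContDiffOn ℝ ∞ z (Icc 0 1)) {ε : ℝ} (hε : 0 < ε)
    {x : ℝ → ℝ → Y × ℝ}
    (hx : ContDiffOn ℝ ∞ (fun p : ℝ × ℝ => x p.1 p.2) (Ioo (-ε) ε ×ˢ Icc (0 : ℝ) 1))
    (h0x : ∀ t, x 0 t = 0) : IsFamily E c z ε (tubeFamily F z x) where
  pos := hε
  smooth_fst := by
    have h1 : ContDiffOn ℝ ∞ (fun p : ℝ × ℝ => (p.2, (x p.1 p.2).1))
        (Ioo (-ε) ε ×ˢ Icc (0 : ℝ) 1) := contDiffOn_snd.prodMk (contDiff_fst.comp_contDiffOn hx)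
    exact hF.comp h1.contMDiffOn fun p hp => ⟨hp.2, trivial⟩
  smooth_snd := (hz.comp contDiffOn_snd fun p hp => hp.2).add (contDiff_snd.comp_contDiffOn hx)
  eq_fst := fun r _ => by simp [tubeFamily, h0x, hF0]
  eq_snd := fun r _ => by simp [tubeFamily, h0x]

theorem variationField_tubeFamily
    (hF : ContMDiffOn 𝓘(ℝ, ℝ × Y) 𝓘(ℝ, E) ∞ F (Icc (0 : ℝ) 1 ×ˢ univ))
    (ht : t ∈ Icc (0 : ℝ) 1) (x : Y × ℝ) :
    variationField E (tubeFamily F z fun s _ => s • x) t = tubeFrame F t x.1 := by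
  have h1 : ContMDiff 𝓘(ℝ, Y) 𝓘(ℝ, ℝ × Y) ∞ (fun y : Y => (t, y)) :=
    ContDiff.contMDiff (by fun_prop)
  have h2 : ContMDiffOn 𝓘(ℝ, Y) 𝓘(ℝ, E) ∞ (fun y => F (t, y)) univ :=
    hF.comp h1.contMDiffOn fun y _ => ⟨ht, trivial⟩
  have h3 : HasDerivAt (fun s : ℝ => s • x.1) x.1 0 := by
    simpa using (hasDerivAt_id (0 : ℝ)).smul_const x.1
  have h4 := mfderiv_comp (I := 𝓘(ℝ, ℝ)) (I' := 𝓘(ℝ, Y)) (I'' := 𝓘(ℝ, E)) (0 : ℝ)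
    (f := fun s : ℝ => s • x.1) (g := fun y => F (t, y))
    ((contMDiffOn_univ.1 h2).mdifferentiable (by simp) _)
    h3.differentiableAt.mdifferentiableAt
  have h5 := congrArg (fun D => D (1 : ℝ)) h4
  refine h5.trans ?_
  rw [mfderiv_eq_fderiv, h3.hasFDerivAt.fderiv, zero_smul]
  change mfderiv 𝓘(ℝ, Y) 𝓘(ℝ, E) (fun y => F (t, y)) 0 ((1 : ℝ) • x.1) = _
  rw [one_smul]
  rfl

theorem variationZ_tubeFamily {M : Type v} {F : ℝ × Y → M} (x : Y × ℝ) (t : ℝ) :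
    variationZ (tubeFamily F z fun s _ => s • x) t = x.2 := by
  have h1 : HasDerivAt (fun s : ℝ => z t + s * x.2) x.2 0 := by
    simpa using ((hasDerivAt_id (0 : ℝ)).mul_const x.2).const_add (z t)
  exact h1.deriv

variable [IsManifold 𝓘(ℝ, E) ∞ M]

theorem surjective_tubeVelocityDeriv
    (hφ : ∀ a, ContMDiff (𝓘(ℝ, E).tangent.prod 𝓘(ℝ, ℝ × ℝ)) 𝓘(ℝ, ℝ) ∞ (φ a))
    (hc : ContMDiffOn 𝓘(ℝ, ℝ) 𝓘(ℝ, E) ∞ c (Icc 0 1))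
    (hF : ContMDiffOn 𝓘(ℝ, ℝ × Y) 𝓘(ℝ, E) ∞ F (Icc (0 : ℝ) 1 ×ˢ univ))
    (hF0 : ∀ t, F (t, 0) = c t) (hz : ContDiffOn ℝ ∞ z (Icc 0 1)) (ht : t ∈ Icc (0 : ℝ) 1)
    (hind : LinearIndependent ℝ (velocityDeriv φ c z t))
    (hsurj : Function.Surjective (tubeFrame (E := E) F t)) :
    Function.Surjective (tubeVelocityDeriv φ F z t) := by
  intro y
  obtain ⟨⟨v, w⟩, hvw⟩ := surjective_pi_of_linearIndependent hind y
  obtain ⟨y₀, rfl⟩ := hsurj v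
  refine ⟨(y₀, w), ?_⟩
  rw [← hvw]
  ext a
  exact tubeVelocityDeriv_apply hφ hc hF hF0 hz ht _ a

theorem momentum_tubeFamily {lam : ℝ → Fin (k + 1) → ℝ}
    (hφ : ∀ a, ContMDiff (𝓘(ℝ, E).tangent.prod 𝓘(ℝ, ℝ × ℝ)) 𝓘(ℝ, ℝ) ∞ (φ a))
    (hc : ContMDiffOn 𝓘(ℝ, ℝ) 𝓘(ℝ, E) ∞ c (Icc 0 1))
    (hF : ContMDiffOn 𝓘(ℝ, ℝ × Y) 𝓘(ℝ, E) ∞ F (Icc (0 : ℝ) 1 ×ˢ univ))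
    (hF0 : ∀ t, F (t, 0) = c t) (hz : ContDiffOn ℝ ∞ z (Icc 0 1)) (ht : t ∈ Icc (0 : ℝ) 1)
    (x : Y × ℝ) : momentum φ lam c z (tubeFamily F z fun s _ => s • x) t =
      ∑ a, lam t a * tubeVelocityDeriv φ F z t x a := by
  refine Finset.sum_congr rfl fun a _ => ?_
  rw [tubeVelocityDeriv_apply hφ hc hF hF0 hz ht, velocityDeriv_apply hφ hc ht,
    variationField_tubeFamily hF ht, variationZ_tubeFamily]

/-- The parameters `s • x` do not depend on time, so their velocity is zero and only the derivative
`B` in the parameters enters. -/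
theorem hasDerivAt_constraint_tubeFamily
    (hφ : ∀ a, ContMDiff (𝓘(ℝ, E).tangent.prod 𝓘(ℝ, ℝ × ℝ)) 𝓘(ℝ, ℝ) ∞ (φ a))
    (hF : ContMDiffOn 𝓘(ℝ, ℝ × Y) 𝓘(ℝ, E) ∞ F (Icc (0 : ℝ) 1 ×ˢ univ))
    (hz : ContDiffOn ℝ ∞ z (Icc 0 1)) (ht : t ∈ Icc (0 : ℝ) 1) (x : Y × ℝ) (a : Fin (k + 1)) :
    HasDerivAt (fun s => φ a (velocity 𝓘(ℝ, E) (tubeFamily F z (fun s _ => s • x) s).1 t,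
        ((tubeFamily F z (fun s _ => s • x) s).2 t, zdot (tubeFamily F z (fun s _ => s • x) s).2 t)))
      (tubeParameterDeriv φ F z t x a) 0 := by
  have h1 : ∀ s : ℝ, φ a (velocity 𝓘(ℝ, E) (tubeFamily F z (fun s _ => s • x) s).1 t,
        ((tubeFamily F z (fun s _ => s • x) s).2 t, zdot (tubeFamily F z (fun s _ => s • x) s).2 t)) =
      tubeConstraint φ F z (t, (s • x, 0)) a := fun s => by
    have h2 := tubeConstraint_path (φ := φ) hF hz ht (x := fun _ => s • x)
      (differentiableWithinAt_const _) a
    rw [derivWithin_fun_const] at h2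
    exact h2
  simp only [h1]
  have h3 : HasDerivAt (fun s : ℝ => ((s • x, 0) : (Y × ℝ) × (Y × ℝ))) (x, 0) 0 := by
    have := (hasDerivAt_id (0 : ℝ)).smul_const x
    rw [one_smul] at this
    exact this.prodMk (hasDerivAt_const _ _)
  have h4 := HasFDerivAt.comp_hasDerivAt (0 : ℝ)
    (by rw [zero_smul]; exact hasFDerivAt_tubeConstraint hφ hF hz ht) h3
  have h5 := hasDerivAt_pi.1 h4 a
  simpa using h5

/-- Multipliers with prescribed momentum at the right end point. -/
theorem exists_vakonomic_multiplier [FiniteDimensional ℝ Y]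
    (hφ : ∀ a, ContMDiff (𝓘(ℝ, E).tangent.prod 𝓘(ℝ, ℝ × ℝ)) 𝓘(ℝ, ℝ) ∞ (φ a))
    (hc : ContMDiffOn 𝓘(ℝ, ℝ) 𝓘(ℝ, E) ∞ c (Icc 0 1))
    (hF : ContMDiffOn 𝓘(ℝ, ℝ × Y) 𝓘(ℝ, E) ∞ F (Icc (0 : ℝ) 1 ×ˢ univ))
    (hF0 : ∀ t, F (t, 0) = c t) (hz : ContDiffOn ℝ ∞ z (Icc 0 1))
    (hsurj : ∀ t ∈ Icc (0 : ℝ) 1, Function.Surjective (tubeFrame (E := E) F t))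
    (hA : ∀ t ∈ Icc (0 : ℝ) 1, Function.Surjective (tubeVelocityDeriv φ F z t))
    (p₁ : Y × ℝ →L[ℝ] ℝ)
    (hp₁ : ∀ x ∈ reachable (tubeVelocityDeriv φ F z) (tubeParameterDeriv φ F z), p₁ x = 0) :
    ∃ lam : ℝ → Fin (k + 1) → ℝ, ContDiffOn ℝ ∞ lam (Icc 0 1) ∧
      (∀ e ∈ atlas E M, ∀ t ∈ Icc (0 : ℝ) 1, c t ∈ e.source → HasDerivWithinAt
        (fun s => ∑ a, lam s a • partialV 𝓘(ℝ, E) e (fun p => φ a (p, (z s, zdot z s))) c s)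
        (∑ a, lam t a • partialQ 𝓘(ℝ, E) e (fun p => φ a (p, (z t, zdot z t))) c t) (Icc 0 1) t) ∧
      (∀ t ∈ Icc (0 : ℝ) 1, HasDerivWithinAt (fun s => ∑ a, lam s a * partialZdot 𝓘(ℝ, E) (φ a) c z s)
        (∑ a, lam t a * partialZ 𝓘(ℝ, E) (φ a) c z t) (Icc 0 1) t) ∧
      ∀ x, ∑ a, lam 1 a * tubeVelocityDeriv φ F z 1 x a = p₁ x := by
  obtain ⟨lam, hlam, hmom, h1⟩ := exists_multiplier (contDiffOn_tubeVelocityDeriv hφ hF hz)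
    (contDiffOn_tubeParameterDeriv hφ hF hz) hA p₁ hp₁
  have hfam : ∀ x : Y × ℝ, IsFamily E c z 1 (tubeFamily F z fun s _ => s • x) := fun x =>
    isFamily_tubeFamily hF hF0 hz one_pos (contDiffOn_fst.smul contDiffOn_const) fun t => zero_smul _ _
  -- For these families the pairing is `λ A x` and `δφ` is `B x`, so `(λA)' = λB` is the momentum
  -- identity. The frame is onto, hence they test (EL) in all directions and in every chart.
  have hmom' : ∀ x : Y × ℝ, ∀ t ∈ Icc (0 : ℝ) 1,
      HasDerivWithinAt (momentum φ lam c z (tubeFamily F z fun s _ => s • x))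
        (∑ a, lam t a * tubeParameterDeriv φ F z t x a) (Icc 0 1) t := fun x t ht =>
    (hmom t ht x).congr (fun r hr => momentum_tubeFamily hφ hc hF hF0 hz hr x)
      (momentum_tubeFamily hφ hc hF hF0 hz ht x)
  refine ⟨lam, hlam, fun e he t ht hs => ?_, fun t ht => ?_, h1⟩
  · refine hasDerivWithinAt_of_momentum hφ hc hz hlam ht he hs fun v => ?_
    obtain ⟨y, rfl⟩ := hsurj t ht v
    exact ⟨1, _, hfam (y, 0), variationField_tubeFamily hF ht _,
      fun r _ => variationZ_tubeFamily _ r, _,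
      hasDerivAt_constraint_tubeFamily hφ hF hz ht (y, 0), hmom' _ t ht⟩
  · exact hasDerivWithinAt_z_of_momentum hφ ht (hfam (0, 1))
      (fun r hr => by rw [variationField_tubeFamily hF hr]; exact map_zero _)
      (fun r _ => variationZ_tubeFamily _ r)
      (hasDerivAt_constraint_tubeFamily hφ hF hz ht (0, 1)) (hmom' _ t ht)
end

/-! ### Necessity of the multiplier equations for regular critical curves. -/

section
universe u v
variable {E : Type u} [NormedAddCommGroup E] [NormedSpace ℝ E]
  {M : Type v} [TopologicalSpace M] [ChartedSpace E M]
  {Y : Type u} [NormedAddCommGroup Y] [NormedSpace ℝ Y] {k : ℕ}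
  {F : ℝ × Y → M} {c : ℝ → M} {z : ℝ → ℝ} {t : ℝ}
  {φ : Fin (k + 1) → TangentBundle 𝓘(ℝ, E) M × (ℝ × ℝ) → ℝ}

/-- The right end points of the curves of a tube, in the chart `e`. -/
def tubeEndpoint (e : OpenPartialHomeomorph M E) (F : ℝ × Y → M) (x : Y × ℝ) : E :=
  e (F (1, x.1))

theorem contMDiff_tubeEndpoint
    (hF : ContMDiffOn 𝓘(ℝ, ℝ × Y) 𝓘(ℝ, E) ∞ F (Icc (0 : ℝ) 1 ×ˢ univ)) :
    ContMDiff 𝓘(ℝ, Y × ℝ) 𝓘(ℝ, E) ∞ fun x : Y × ℝ => F (1, x.1) := by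
  have h1 : ContMDiff 𝓘(ℝ, Y × ℝ) 𝓘(ℝ, ℝ × Y) ∞ (fun x : Y × ℝ => ((1 : ℝ), x.1)) :=
    ContDiff.contMDiff (by fun_prop)
  exact contMDiffOn_univ.1 (hF.comp h1.contMDiffOn
    fun y _ => ⟨right_mem_Icc.2 zero_le_one, trivial⟩)

variable [IsManifold 𝓘(ℝ, E) ∞ M]

theorem contDiffOn_tubeEndpoint {e : OpenPartialHomeomorph M E} (he : e ∈ atlas E M)
    (hF : ContMDiffOn 𝓘(ℝ, ℝ × Y) 𝓘(ℝ, E) ∞ F (Icc (0 : ℝ) 1 ×ˢ univ)) :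
    ContDiffOn ℝ ∞ (tubeEndpoint e F) ((fun x : Y × ℝ => F (1, x.1)) ⁻¹' e.source) := by
  rw [← contMDiffOn_iff_contDiffOn]
  intro x hx
  exact ((contMDiffAt_chart he hx).comp x (contMDiff_tubeEndpoint hF x)).contMDiffWithinAt

theorem chartFrame_fderiv_tubeEndpoint {e : OpenPartialHomeomorph M E} (he : e ∈ atlas E M)
    (hF : ContMDiffOn 𝓘(ℝ, ℝ × Y) 𝓘(ℝ, E) ∞ F (Icc (0 : ℝ) 1 ×ˢ univ))
    (hF0 : ∀ t, F (t, 0) = c t) (hs : c 1 ∈ e.source) (x : Y × ℝ) :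
    chartFrame e (c 1) (fderiv ℝ (tubeEndpoint e F) 0 x) = tubeFrame F 1 x.1 := by
  have hsm := contMDiff_tubeEndpoint hF
  have h1 := chartFrame_mfderivWithin he (s := univ) (hsm (0 : Y × ℝ)).contMDiffWithinAt
    uniqueDiffWithinAt_univ (by rw [Prod.fst_zero, hF0]; exact hs) x
  rw [fderivWithin_univ, mfderivWithin_univ, Prod.fst_zero, hF0] at h1
  refine h1.trans ?_
  have h2 : ContMDiff 𝓘(ℝ, Y) 𝓘(ℝ, E) ∞ fun y : Y => F (1, y) := by
    have h3 : ContMDiff 𝓘(ℝ, Y) 𝓘(ℝ, Y × ℝ) ∞ (fun y : Y => (y, (0 : ℝ))) :=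
      ContDiff.contMDiff (by fun_prop)
    exact hsm.comp h3
  have h4 := mfderiv_comp (I := 𝓘(ℝ, Y × ℝ)) (I' := 𝓘(ℝ, Y)) (I'' := 𝓘(ℝ, E)) (0 : Y × ℝ)
    (f := Prod.fst) (g := fun y => F (1, y)) (h2.mdifferentiable (by simp) _)
    hasFDerivAt_fst.differentiableAt.mdifferentiableAt
  have h5 := congrArg (fun D => D x) h4
  refine h5.trans ?_
  rw [mfderiv_eq_fderiv, hasFDerivAt_fst.fderiv]
  rfl

variable [FiniteDimensional ℝ E] [FiniteDimensional ℝ Y]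

/-- The end points of the linearised constrained curves through a regular curve fill the tangent
space at the right end point. -/
theorem exists_reachable_of_isRegularCurve {q₀ q₁ : M} {z₀ : ℝ}
    (hφ : ∀ a, ContMDiff (𝓘(ℝ, E).tangent.prod 𝓘(ℝ, ℝ × ℝ)) 𝓘(ℝ, ℝ) ∞ (φ a))
    (hreg : IsRegularCurve 𝓘(ℝ, E) φ q₀ q₁ z₀ (c, z))
    (hc : ContMDiffOn 𝓘(ℝ, ℝ) 𝓘(ℝ, E) ∞ c (Icc 0 1))
    (hF : ContMDiffOn 𝓘(ℝ, ℝ × Y) 𝓘(ℝ, E) ∞ F (Icc (0 : ℝ) 1 ×ˢ univ))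
    (hF0 : ∀ t, F (t, 0) = c t) (hz : ContDiffOn ℝ ∞ z (Icc 0 1))
    (hsurj : ∀ t ∈ Icc (0 : ℝ) 1, Function.Surjective (tubeFrame (E := E) F t))
    {e : OpenPartialHomeomorph M E} (he : e ∈ atlas E M) (hs : c 1 ∈ e.source) (y : E) :
    ∃ x ∈ reachable (tubeVelocityDeriv φ F z) (tubeParameterDeriv φ F z),
      fderiv ℝ (tubeEndpoint e F) 0 x = y := by
  have one_mem : (1 : ℝ) ∈ Icc (0 : ℝ) 1 := right_mem_Icc.2 zero_le_one
  set κ := fderiv ℝ (tubeEndpoint e F) 0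
  set R := reachable (tubeVelocityDeriv φ F z) (tubeParameterDeriv φ F z)
  suffices h : R.map (κ : Y × ℝ →ₗ[ℝ] E) = ⊤ by
    obtain ⟨x, hx, hxy⟩ := h.ge (Submodule.mem_top (x := y))
    exact ⟨x, hx, hxy⟩
  by_contra hne
  obtain ⟨η, hη, hηR⟩ := Submodule.exists_le_ker_of_lt_top _ (lt_top_iff_ne_top.2 hne)
  set p₁ : Y × ℝ →L[ℝ] ℝ := (LinearMap.toContinuousLinearMap η).comp κ
  have hp₁ : ∀ x, p₁ x = η (κ x) := fun x => rfl
  obtain ⟨lam, hlam, hq, hlz, h1⟩ := exists_vakonomic_multiplier hφ hc hF hF0 hz hsurj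
    (fun t ht => surjective_tubeVelocityDeriv hφ hc hF hF0 hz ht (hreg.independent t ht)
      (hsurj t ht)) p₁ (fun x hx => hηR (Submodule.mem_map_of_mem hx))
  -- Regularity is applied to `h = λ` itself, which makes the derivative of the pairing a sum of
  -- squares.
  obtain ⟨Γ, hΓ, hΓd⟩ := hreg.surjective lam hlam
  obtain ⟨ε, hfam, -, hv0, hv1, hz0, -⟩ := hΓ.isFamily
  have hmom : ∀ t ∈ Icc (0 : ℝ) 1, HasDerivWithinAt (momentum φ lam c z Γ)
      (∑ a, lam t a * lam t a) (Icc 0 1) t := fun t ht =>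
    hasDerivWithinAt_momentum hφ hfam ht (fun e he hs => hq e he t ht hs) (hlz t ht) (hΓd t ht)
  -- The end point in `M` does not see the `z`-direction. So the momentum at `t = 1` has no
  -- `z`-component, and the pairing vanishes there although `z(1)` is free.
  have hκ0 : κ (0, 1) = 0 := (bijective_chartFrame he hs).1 <| by
    rw [chartFrame_fderiv_tubeEndpoint he hF hF0 hs, map_zero, map_zero]
  have hm0 : momentum φ lam c z Γ 0 = 0 := by simp [momentum, hv0, hz0]
  have hm1 : momentum φ lam c z Γ 1 = 0 := by
    have h2 := h1 (0, 1)
    rw [hp₁, hκ0, map_zero] at h2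
    have h3 : ∀ a, tubeVelocityDeriv φ F z 1 (0, 1) a = partialZdot 𝓘(ℝ, E) (φ a) c z 1 :=
      fun a => by
        rw [tubeVelocityDeriv_apply hφ hc hF hF0 hz one_mem, velocityDeriv_apply hφ hc one_mem,
          map_zero, map_zero, zero_add, mul_one]
    simp only [h3] at h2
    simp only [momentum, hv1, map_zero, zero_add, ← mul_assoc, ← Finset.sum_mul, h2, zero_mul]
  have hlam0 : ∀ a, lam 1 a = 0 := fun a => by
    have h2 := eq_zero_of_hasDerivWithinAt_nonneg hmom
      (fun t _ => Finset.sum_nonneg fun a _ => mul_self_nonneg _) (hm0.trans hm1.symm) 1 one_mem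
    exact mul_self_eq_zero.1 ((Finset.sum_eq_zero_iff_of_nonneg
      fun a _ => mul_self_nonneg _).1 h2 a (Finset.mem_univ a))
  refine hη (LinearMap.ext fun w => ?_)
  obtain ⟨y₀, hy₀⟩ := hsurj 1 one_mem (chartFrame e (c 1) w)
  have hw : κ (y₀, 0) = w := (bijective_chartFrame he hs).1 <| by
    rw [chartFrame_fderiv_tubeEndpoint he hF hF0 hs]
    exact hy₀
  rw [← hw, ← hp₁, ← h1]
  simp [hlam0]

/-- Regular critical curves satisfy the Euler–Lagrange equations with smooth multipliers. -/
theorem exists_isVakonomicSolution_of_isCritical [T2Space M] {q₀ q₁ : M} {z₀ : ℝ}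
    (hφ : ∀ a, ContMDiff (𝓘(ℝ, E).tangent.prod 𝓘(ℝ, ℝ × ℝ)) 𝓘(ℝ, ℝ) ∞ (φ a))
    (hreg : IsRegularCurve 𝓘(ℝ, E) φ q₀ q₁ z₀ (c, z))
    (hcrit : IsCritical 𝓘(ℝ, E) q₀ q₁ z₀ (zeroSet 𝓘(ℝ, E) φ) (c, z)) :
    ∃ lam : ℝ → Fin (k + 1) → ℝ, ContDiffOn ℝ ∞ lam (Icc 0 1) ∧
      IsVakonomicSolution 𝓘(ℝ, E) φ lam c z ∧ NaturalBoundary 𝓘(ℝ, E) φ lam c z := by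
  have one_mem : (1 : ℝ) ∈ Icc (0 : ℝ) 1 := right_mem_Icc.2 zero_le_one
  obtain ⟨⟨hc, hz, hc0, hc1, hz0, hN⟩, hcrit⟩ := hcrit
  simp only at hc hz hc0 hc1 hz0 hN
  obtain ⟨Y, _, _, _, F, hF, hF0, hsurj⟩ := exists_tube hc
  have he := chart_mem_atlas E (c 1)
  have hs := mem_chart_source E (c 1)
  set e := chartAt E (c 1)
  have hA : ∀ t ∈ Icc (0 : ℝ) 1, Function.Surjective (tubeVelocityDeriv φ F z t) := fun t ht =>
    surjective_tubeVelocityDeriv hφ hc hF hF0 hz ht (hreg.independent t ht) (hsurj t ht)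
  have hreach := exists_reachable_of_isRegularCurve hφ hreg hc hF hF0 hz hsurj he hs
  set κ := fderiv ℝ (tubeEndpoint e F) 0 with hκ
  have hO : (fun x : Y × ℝ => F (1, x.1)) ⁻¹' e.source ∈ nhds 0 :=
    (contMDiff_tubeEndpoint hF).continuous.continuousAt.preimage_mem_nhds
      (e.open_source.mem_nhds (by rw [Prod.fst_zero, hF0]; exact hs))
  have hG0 : ∀ t ∈ Icc (0 : ℝ) 1, tubeConstraint φ F z (t, 0) = 0 := fun t ht => by
    ext a
    have h1 := tubeConstraint_path (φ := φ) hF hz ht (x := fun _ => 0)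
      (differentiableWithinAt_const _) a
    rw [derivWithin_fun_const] at h1
    refine h1.symm.trans ?_
    simp only [Prod.fst_zero, Prod.snd_zero, add_zero, hF0]
    exact hN t ht a
  -- Criticality is used here only: a linear solution that fixes the end point in `M` is realised by
  -- an admissible variation, along which the derivative of the action is the `z`-component of
  -- `δ(1)`.
  have hsnd : ∀ x ∈ reachable (tubeVelocityDeriv φ F z) (tubeParameterDeriv φ F z),
      κ x = 0 → x.2 = 0 := by
    rintro _ ⟨δ, hδ, rfl⟩ hδ1
    obtain ⟨ε, hε, x, hx, hx0, h0x, hGx, hex, hxd⟩ := exists_family_of_linearSolution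
      (contDiffOn_tubeConstraint hφ hF hz) hG0 (contDiffOn_tubeVelocityDeriv hφ hF hz)
      (contDiffOn_tubeParameterDeriv hφ hF hz) hA
      (fun t ht => hasFDerivAt_tubeConstraint hφ hF hz ht) hO (contDiffOn_tubeEndpoint he hF)
      hreach hδ hδ1
    -- The family fixes only the coordinates of the right end point. These determine the point while
    -- it stays in the chart domain, so the parameter interval is shrunk.
    have hO' : ∀ᶠ s in nhds (0 : ℝ), x s 1 ∈ (fun x : Y × ℝ => F (1, x.1)) ⁻¹' e.source :=
      hxd.continuousAt.eventually (by beta_reduce; rw [h0x]; exact hO)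
    obtain ⟨ε₁, hε₁, hball⟩ := Metric.eventually_nhds_iff_ball.1 hO'
    rw [Real.ball_eq_Ioo, zero_sub, zero_add] at hball
    have hsub : Ioo (-(min ε ε₁)) (min ε ε₁) ⊆ Ioo (-ε) ε := fun s hs =>
      ⟨by linarith [hs.1, min_le_left ε ε₁], hs.2.trans_le (min_le_left _ _)⟩
    have hsub₁ : Ioo (-(min ε ε₁)) (min ε ε₁) ⊆ Ioo (-ε₁) ε₁ := fun s hs =>
      ⟨by linarith [hs.1, min_le_right ε ε₁], hs.2.trans_le (min_le_right _ _)⟩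
    have hfam := isFamily_tubeFamily hF hF0 hz (lt_min hε hε₁)
      (hx.mono (prod_mono hsub subset_rfl)) h0x
    have hvar : IsVariation 𝓘(ℝ, E) q₀ q₁ z₀ (zeroSet 𝓘(ℝ, E) φ) (c, z) (tubeFamily F z x) := by
      refine ⟨_, hfam.pos, hfam.smooth_fst, hfam.smooth_snd, fun s hs => ?_, hfam.eq_fst,
        hfam.eq_snd⟩
      have hxs : ContDiffOn ℝ ∞ (x s) (Icc 0 1) :=
        hx.comp (contDiffOn_const.prodMk contDiffOn_id) fun r hr => ⟨hsub hs, hr⟩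
      have h2 : ContDiffOn ℝ ∞ (tubeFamily F z x s).2 (Icc 0 1) :=
        hfam.smooth_snd.comp (contDiffOn_const.prodMk contDiffOn_id) fun r hr => ⟨hs, hr⟩
      refine ⟨hfam.contMDiffOn_fst hs, h2, ?_, ?_, ?_, fun t ht a => ?_⟩
      · simp [tubeFamily, hx0, hF0, hc0]
      · have h3 := hex s (hsub hs)
        have h4 : F (1, (x s 1).1) = F (1, (0 : Y × ℝ).1) := e.injOn (hball s (hsub₁ hs))
          (by rw [Prod.fst_zero, hF0]; exact ‹c 1 ∈ e.source›) h3
        rw [Prod.fst_zero, hF0, hc1] at h4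
        exact h4
      · simp [tubeFamily, hx0, hz0]
      · exact (tubeConstraint_path hF hz ht (hxs.differentiableOn (by simp) t ht) a).trans
          (congrFun (hGx s (hsub hs) t ht) a)
    have h1 := hcrit _ hvar
    obtain ⟨-, -, -, -, -, -, hact⟩ := hvar.isFamily
    have h2 : HasDerivAt (fun s => z 1 + (x s 1).2) (δ 1).2 0 :=
      ((ContinuousLinearMap.snd ℝ Y ℝ).hasFDerivAt.comp_hasDerivAt (0 : ℝ) hxd).const_add (z 1)
    exact h2.deriv.symm.trans (hact.unique h1)
  -- `η` is the multiplier of the condition `c(1) = q₁`; subtracting `η ∘ κ` gives a covector that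
  -- annihilates the reachable space.
  obtain ⟨η, hη⟩ := exists_factor_of_surjOn hreach (.snd ℝ Y ℝ) hsnd
  obtain ⟨lam, hlam, hq, hlz, h1⟩ := exists_vakonomic_multiplier hφ hc hF hF0 hz hsurj hA
    (.snd ℝ Y ℝ - η.comp κ) (fun x hx => sub_eq_zero.2 (hη x hx))
  refine ⟨lam, hlam, ⟨hq, hlz, fun t ht a => hN t ht a⟩, ?_⟩
  have hκ0 : κ (0, 1) = 0 := (bijective_chartFrame he hs).1 <| by
    rw [chartFrame_fderiv_tubeEndpoint he hF hF0 hs, map_zero, map_zero]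
  have h2 := h1 (0, 1)
  have h3 : ∀ a, tubeVelocityDeriv φ F z 1 (0, 1) a = partialZdot 𝓘(ℝ, E) (φ a) c z 1 :=
    fun a => by
      rw [tubeVelocityDeriv_apply hφ hc hF hF0 hz one_mem, velocityDeriv_apply hφ hc one_mem,
        map_zero, map_zero, zero_add, mul_one]
  simp only [h3, sub_apply, ContinuousLinearMap.comp_apply, hκ0, map_zero, sub_zero] at h2
  rw [NaturalBoundary, h2]
  exact sub_self 1
end

/-! ### Eliminating `ż` from the constraints. -/

section
variable {E : Type*} [NormedAddCommGroup E] [NormedSpace ℝ E]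
  {M : Type*} [TopologicalSpace M] [ChartedSpace E M]
  {W : Type*} [NormedAddCommGroup W] [NormedSpace ℝ W] {k : ℕ}
  {e : OpenPartialHomeomorph M E} {c : ℝ → M} {z : ℝ → ℝ} {t : ℝ}
  {L : TangentBundle 𝓘(ℝ, E) M × ℝ → ℝ} {Φ : Fin k → TangentBundle 𝓘(ℝ, E) M × (ℝ × ℝ) → ℝ}

theorem zeroSet_psiConstraint : zeroSet 𝓘(ℝ, E) (constraints 𝓘(ℝ, E) L Φ) =
    zeroSet 𝓘(ℝ, E) (constraints 𝓘(ℝ, E) L (psiConstraint 𝓘(ℝ, E) L Φ)) := by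
  ext ⟨p, y, w⟩
  simp only [zeroSet, mem_ofPred_eq, Fin.forall_fin_succ, constraints, Fin.cons_zero, Fin.cons_succ,
    psiConstraint, psi, sub_eq_zero]
  refine and_congr_right fun h => ?_
  rw [h]

theorem partialZdot_constraints_zero :
    partialZdot 𝓘(ℝ, E) (constraints 𝓘(ℝ, E) L Φ 0) c z t = 1 :=
  ((hasDerivAt_id (zdot z t)).sub_const (L (velocity 𝓘(ℝ, E) c t, z t))).deriv

theorem partialZdot_psiConstraint (α : Fin k) :
    partialZdot 𝓘(ℝ, E) (psiConstraint 𝓘(ℝ, E) L Φ α) c z t = 0 :=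
  (hasDerivAt_const (zdot z t) (psi 𝓘(ℝ, E) L Φ α (velocity 𝓘(ℝ, E) c t, z t))).deriv

theorem partialZ_constraints_zero :
    partialZ 𝓘(ℝ, E) (constraints 𝓘(ℝ, E) L Φ 0) c z t =
      -deriv (fun y => L (velocity 𝓘(ℝ, E) c t, y)) (z t) :=
  deriv_const_sub (zdot z t)

theorem partialV_constraints_zero (u : ℝ × ℝ) :
    partialV 𝓘(ℝ, E) e (fun p => constraints 𝓘(ℝ, E) L Φ 0 (p, u)) c t =
      -partialV 𝓘(ℝ, E) e (fun p => L (p, u.1)) c t :=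
  fderiv_const_sub u.2

theorem partialQ_constraints_zero (u : ℝ × ℝ) :
    partialQ 𝓘(ℝ, E) e (fun p => constraints 𝓘(ℝ, E) L Φ 0 (p, u)) c t =
      -partialQ 𝓘(ℝ, E) e (fun p => L (p, u.1)) c t :=
  fderiv_const_sub u.2

theorem sum_partialZdot_psiConstraint {w w' : Fin (k + 1) → ℝ}
    (h0 : w' 0 = ∑ a, w a * partialZdot 𝓘(ℝ, E) (constraints 𝓘(ℝ, E) L Φ a) c z t) :
    ∑ a, w' a * partialZdot 𝓘(ℝ, E)
        (constraints 𝓘(ℝ, E) L (psiConstraint 𝓘(ℝ, E) L Φ) a) c z t =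
      ∑ a, w a * partialZdot 𝓘(ℝ, E) (constraints 𝓘(ℝ, E) L Φ a) c z t := by
  rw [← h0, Fin.sum_univ_succ, partialZdot_constraints_zero]
  simp only [constraints, Fin.cons_succ, partialZdot_psiConstraint]
  simp

variable [IsManifold 𝓘(ℝ, E) ∞ M]

theorem contMDiff_constraints
    (hL : ContMDiff (𝓘(ℝ, E).tangent.prod 𝓘(ℝ, ℝ)) 𝓘(ℝ, ℝ) ∞ L)
    (hΦ : ∀ α, ContMDiff (𝓘(ℝ, E).tangent.prod 𝓘(ℝ, ℝ × ℝ)) 𝓘(ℝ, ℝ) ∞ (Φ α)) (a : Fin (k + 1)) :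
    ContMDiff (𝓘(ℝ, E).tangent.prod 𝓘(ℝ, ℝ × ℝ)) 𝓘(ℝ, ℝ) ∞ (constraints 𝓘(ℝ, E) L Φ a) := by
  refine Fin.cases ?_ (fun α => hΦ α) a
  exact (contDiff_snd.contMDiff.comp contMDiff_snd).sub
    (hL.comp (contMDiff_fst.prodMk (contDiff_fst.contMDiff.comp contMDiff_snd)))

theorem contMDiff_psiConstraint
    (hL : ContMDiff (𝓘(ℝ, E).tangent.prod 𝓘(ℝ, ℝ)) 𝓘(ℝ, ℝ) ∞ L)
    (hΦ : ∀ α, ContMDiff (𝓘(ℝ, E).tangent.prod 𝓘(ℝ, ℝ × ℝ)) 𝓘(ℝ, ℝ) ∞ (Φ α)) (α : Fin k) :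
    ContMDiff (𝓘(ℝ, E).tangent.prod 𝓘(ℝ, ℝ × ℝ)) 𝓘(ℝ, ℝ) ∞ (psiConstraint 𝓘(ℝ, E) L Φ α) := by
  have h1 : ContMDiff (𝓘(ℝ, E).tangent.prod 𝓘(ℝ, ℝ × ℝ)) 𝓘(ℝ, ℝ) ∞
      fun x : TangentBundle 𝓘(ℝ, E) M × (ℝ × ℝ) => x.2.1 :=
    contDiff_fst.contMDiff.comp contMDiff_snd
  exact (hΦ α).comp (contMDiff_fst.prodMk (h1.prodMk_space (hL.comp (contMDiff_fst.prodMk h1))))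

theorem hasFDerivAt_partialV {φ : TangentBundle 𝓘(ℝ, E) M × W → ℝ} (he : e ∈ atlas E M)
    (hφ : ContMDiff (𝓘(ℝ, E).tangent.prod 𝓘(ℝ, W)) 𝓘(ℝ, ℝ) ∞ φ) (hs : c t ∈ e.source) (u : W) :
    HasFDerivAt (fun v => φ (chartPoint 𝓘(ℝ, E) e (e (c t)) v, u))
      (partialV 𝓘(ℝ, E) e (fun p => φ (p, u)) c t) (chartVelocity 𝓘(ℝ, E) e c t) :=
  (DifferentiableAt.comp (f := fun v => (e (c t), v, u)) (chartVelocity 𝓘(ℝ, E) e c t)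
    (differentiableAt_chartRep he hφ hs (chartVelocity 𝓘(ℝ, E) e c t) u)
    (by fun_prop)).hasFDerivAt

theorem hasFDerivAt_partialQ {φ : TangentBundle 𝓘(ℝ, E) M × W → ℝ} (he : e ∈ atlas E M)
    (hφ : ContMDiff (𝓘(ℝ, E).tangent.prod 𝓘(ℝ, W)) 𝓘(ℝ, ℝ) ∞ φ) (hs : c t ∈ e.source) (u : W) :
    HasFDerivAt (fun x => φ (chartPoint 𝓘(ℝ, E) e x (chartVelocity 𝓘(ℝ, E) e c t), u))
      (partialQ 𝓘(ℝ, E) e (fun p => φ (p, u)) c t) (e (c t)) :=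
  (DifferentiableAt.comp (f := fun x => (x, chartVelocity 𝓘(ℝ, E) e c t, u)) (e (c t))
    (differentiableAt_chartRep he hφ hs (chartVelocity 𝓘(ℝ, E) e c t) u)
    (by fun_prop)).hasFDerivAt

/-- Chain rule through `ż = L`. The hypothesis `hz` is essential: it makes the point at which the
derivatives of `Φ α` are taken the actual velocity of the curve. The analogues for `q` and `z`
follow the same pattern. -/
theorem partialV_psiConstraint (he : e ∈ atlas E M)
    (hL : ContMDiff (𝓘(ℝ, E).tangent.prod 𝓘(ℝ, ℝ)) 𝓘(ℝ, ℝ) ∞ L)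
    (hΦ : ∀ α, ContMDiff (𝓘(ℝ, E).tangent.prod 𝓘(ℝ, ℝ × ℝ)) 𝓘(ℝ, ℝ) ∞ (Φ α))
    (hc : ContMDiffOn 𝓘(ℝ, ℝ) 𝓘(ℝ, E) ∞ c (Icc 0 1)) (ht : t ∈ Icc (0 : ℝ) 1)
    (hs : c t ∈ e.source) (hz : zdot z t = L (velocity 𝓘(ℝ, E) c t, z t)) (α : Fin k) :
    partialV 𝓘(ℝ, E) e (fun p => psiConstraint 𝓘(ℝ, E) L Φ α (p, (z t, zdot z t))) c t =
      partialV 𝓘(ℝ, E) e (fun p => Φ α (p, (z t, zdot z t))) c t +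
        partialZdot 𝓘(ℝ, E) (Φ α) c z t • partialV 𝓘(ℝ, E) e (fun p => L (p, z t)) c t := by
  have hD := (differentiableAt_chartRep he (hΦ α) hs (chartVelocity 𝓘(ℝ, E) e c t)
    (z t, zdot z t)).hasFDerivAt
  rw [partialV_eq he (hΦ α) hs, partialZdot_eq he (hΦ α) hc ht hs]
  set D := fderiv ℝ (chartRep e (Φ α)) (e (c t), chartVelocity 𝓘(ℝ, E) e c t, z t, zdot z t)
  have hLv := hasFDerivAt_partialV he hL hs (z t)
  have h1 := HasFDerivAt.comp (f := fun v : E => ((e (c t), v, z t,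
      L (chartPoint 𝓘(ℝ, E) e (e (c t)) v, z t)) : E × E × ℝ × ℝ)) (chartVelocity 𝓘(ℝ, E) e c t)
    (by rw [chartPoint_velocity he hc ht hs, ← hz]; exact hD)
    ((hasFDerivAt_const (e (c t)) _).prodMk ((hasFDerivAt_id _).prodMk
      ((hasFDerivAt_const (z t) _).prodMk hLv)))
  refine HasFDerivAt.fderiv (h1.congr_fderiv (ContinuousLinearMap.ext fun v => ?_))
  have h2 : ∀ r : ℝ, ((0, v, 0, r) : E × E × ℝ × ℝ) = (0, v, 0, 0) + r • (0, 0, 0, 1) := by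
    simp
  refine (congrArg D (h2 _)).trans ?_
  rw [map_add, map_smul, smul_eq_mul, mul_comm]
  rfl

theorem partialQ_psiConstraint (he : e ∈ atlas E M)
    (hL : ContMDiff (𝓘(ℝ, E).tangent.prod 𝓘(ℝ, ℝ)) 𝓘(ℝ, ℝ) ∞ L)
    (hΦ : ∀ α, ContMDiff (𝓘(ℝ, E).tangent.prod 𝓘(ℝ, ℝ × ℝ)) 𝓘(ℝ, ℝ) ∞ (Φ α))
    (hc : ContMDiffOn 𝓘(ℝ, ℝ) 𝓘(ℝ, E) ∞ c (Icc 0 1)) (ht : t ∈ Icc (0 : ℝ) 1)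
    (hs : c t ∈ e.source) (hz : zdot z t = L (velocity 𝓘(ℝ, E) c t, z t)) (α : Fin k) :
    partialQ 𝓘(ℝ, E) e (fun p => psiConstraint 𝓘(ℝ, E) L Φ α (p, (z t, zdot z t))) c t =
      partialQ 𝓘(ℝ, E) e (fun p => Φ α (p, (z t, zdot z t))) c t +
        partialZdot 𝓘(ℝ, E) (Φ α) c z t • partialQ 𝓘(ℝ, E) e (fun p => L (p, z t)) c t := by
  have hD := (differentiableAt_chartRep he (hΦ α) hs (chartVelocity 𝓘(ℝ, E) e c t)
    (z t, zdot z t)).hasFDerivAt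
  rw [partialQ_eq he (hΦ α) hs, partialZdot_eq he (hΦ α) hc ht hs]
  set D := fderiv ℝ (chartRep e (Φ α)) (e (c t), chartVelocity 𝓘(ℝ, E) e c t, z t, zdot z t)
  have hLv := hasFDerivAt_partialQ he hL hs (z t)
  have h1 := HasFDerivAt.comp (f := fun x : E => ((x, chartVelocity 𝓘(ℝ, E) e c t, z t,
      L (chartPoint 𝓘(ℝ, E) e x (chartVelocity 𝓘(ℝ, E) e c t), z t)) : E × E × ℝ × ℝ)) (e (c t))
    (by rw [chartPoint_velocity he hc ht hs, ← hz]; exact hD)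
    ((hasFDerivAt_id _).prodMk ((hasFDerivAt_const (chartVelocity 𝓘(ℝ, E) e c t) _).prodMk
      ((hasFDerivAt_const (z t) _).prodMk hLv)))
  refine HasFDerivAt.fderiv (h1.congr_fderiv (ContinuousLinearMap.ext fun v => ?_))
  have h2 : ∀ r : ℝ, ((v, 0, 0, r) : E × E × ℝ × ℝ) = (v, 0, 0, 0) + r • (0, 0, 0, 1) := by
    simp
  refine (congrArg D (h2 _)).trans ?_
  rw [map_add, map_smul, smul_eq_mul, mul_comm]
  rfl

theorem partialZ_psiConstraint
    (hL : ContMDiff (𝓘(ℝ, E).tangent.prod 𝓘(ℝ, ℝ)) 𝓘(ℝ, ℝ) ∞ L)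
    (hΦ : ∀ α, ContMDiff (𝓘(ℝ, E).tangent.prod 𝓘(ℝ, ℝ × ℝ)) 𝓘(ℝ, ℝ) ∞ (Φ α))
    (hc : ContMDiffOn 𝓘(ℝ, ℝ) 𝓘(ℝ, E) ∞ c (Icc 0 1)) (ht : t ∈ Icc (0 : ℝ) 1)
    (hz : zdot z t = L (velocity 𝓘(ℝ, E) c t, z t)) (α : Fin k) :
    partialZ 𝓘(ℝ, E) (psiConstraint 𝓘(ℝ, E) L Φ α) c z t =
      partialZ 𝓘(ℝ, E) (Φ α) c z t + partialZdot 𝓘(ℝ, E) (Φ α) c z t *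
        deriv (fun y => L (velocity 𝓘(ℝ, E) c t, y)) (z t) := by
  have he := chart_mem_atlas E (c t)
  have hs := mem_chart_source E (c t)
  have hD := hasFDerivAt_parameter he (hΦ α) hc ht hs (z t, zdot z t)
  have hLz := (hasFDerivAt_parameter he hL hc ht hs (z t)).differentiableAt.hasDerivAt
  rw [partialZ_eq he (hΦ α) hc ht hs, partialZdot_eq he (hΦ α) hc ht hs]
  set D := fderiv ℝ (chartRep (chartAt E (c t)) (Φ α))
    ((chartAt E (c t)) (c t), chartVelocity 𝓘(ℝ, E) (chartAt E (c t)) c t, z t, zdot z t)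
  have h1 := HasFDerivAt.comp_hasDerivAt (f := fun y : ℝ => (y, L (velocity 𝓘(ℝ, E) c t, y))) (z t)
    (by rw [← hz]; exact hD) ((hasDerivAt_id (z t)).prodMk hLz)
  refine h1.deriv.trans ?_
  have h2 : ∀ r : ℝ, ((0, 0, 1, r) : E × E × ℝ × ℝ) = (0, 0, 1, 0) + r • (0, 0, 0, 1) := by
    simp
  refine (congrArg D (h2 _)).trans ?_
  rw [map_add, map_smul, smul_eq_mul, mul_comm]

section
variable {w w' : Fin (k + 1) → ℝ}

/-- Since `∂φ⁰/∂ż = 1`, the new `λ'_0` exceeds `λ_0` by `λ_α ∂φ^α/∂ż`. Its extra contribution, a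
multiple of `-∂L`, cancels the terms that the chain rule adds to the `ψ^α`. -/
theorem sum_partialV_psiConstraint (he : e ∈ atlas E M)
    (hL : ContMDiff (𝓘(ℝ, E).tangent.prod 𝓘(ℝ, ℝ)) 𝓘(ℝ, ℝ) ∞ L)
    (hΦ : ∀ α, ContMDiff (𝓘(ℝ, E).tangent.prod 𝓘(ℝ, ℝ × ℝ)) 𝓘(ℝ, ℝ) ∞ (Φ α))
    (hc : ContMDiffOn 𝓘(ℝ, ℝ) 𝓘(ℝ, E) ∞ c (Icc 0 1)) (ht : t ∈ Icc (0 : ℝ) 1)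
    (hs : c t ∈ e.source) (hz : zdot z t = L (velocity 𝓘(ℝ, E) c t, z t))
    (h0 : w' 0 = ∑ a, w a * partialZdot 𝓘(ℝ, E) (constraints 𝓘(ℝ, E) L Φ a) c z t)
    (h1 : ∀ α : Fin k, w' α.succ = w α.succ) :
    ∑ a, w' a • partialV 𝓘(ℝ, E) e (fun p =>
        constraints 𝓘(ℝ, E) L (psiConstraint 𝓘(ℝ, E) L Φ) a (p, (z t, zdot z t))) c t =
      ∑ a, w a • partialV 𝓘(ℝ, E) e (fun p =>
        constraints 𝓘(ℝ, E) L Φ a (p, (z t, zdot z t))) c t := by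
  rw [Fin.sum_univ_succ, Fin.sum_univ_succ, h0, Fin.sum_univ_succ, partialV_constraints_zero,
    partialV_constraints_zero, partialZdot_constraints_zero]
  simp only [constraints, Fin.cons_succ, partialV_psiConstraint he hL hΦ hc ht hs hz, h1, smul_add,
    Finset.sum_add_distrib, smul_smul, ← Finset.sum_smul]
  module

theorem sum_partialQ_psiConstraint (he : e ∈ atlas E M)
    (hL : ContMDiff (𝓘(ℝ, E).tangent.prod 𝓘(ℝ, ℝ)) 𝓘(ℝ, ℝ) ∞ L)
    (hΦ : ∀ α, ContMDiff (𝓘(ℝ, E).tangent.prod 𝓘(ℝ, ℝ × ℝ)) 𝓘(ℝ, ℝ) ∞ (Φ α))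
    (hc : ContMDiffOn 𝓘(ℝ, ℝ) 𝓘(ℝ, E) ∞ c (Icc 0 1)) (ht : t ∈ Icc (0 : ℝ) 1)
    (hs : c t ∈ e.source) (hz : zdot z t = L (velocity 𝓘(ℝ, E) c t, z t))
    (h0 : w' 0 = ∑ a, w a * partialZdot 𝓘(ℝ, E) (constraints 𝓘(ℝ, E) L Φ a) c z t)
    (h1 : ∀ α : Fin k, w' α.succ = w α.succ) :
    ∑ a, w' a • partialQ 𝓘(ℝ, E) e (fun p =>
        constraints 𝓘(ℝ, E) L (psiConstraint 𝓘(ℝ, E) L Φ) a (p, (z t, zdot z t))) c t =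
      ∑ a, w a • partialQ 𝓘(ℝ, E) e (fun p =>
        constraints 𝓘(ℝ, E) L Φ a (p, (z t, zdot z t))) c t := by
  rw [Fin.sum_univ_succ, Fin.sum_univ_succ, h0, Fin.sum_univ_succ, partialQ_constraints_zero,
    partialQ_constraints_zero, partialZdot_constraints_zero]
  simp only [constraints, Fin.cons_succ, partialQ_psiConstraint he hL hΦ hc ht hs hz, h1, smul_add,
    Finset.sum_add_distrib, smul_smul, ← Finset.sum_smul]
  module

theorem sum_partialZ_psiConstraint
    (hL : ContMDiff (𝓘(ℝ, E).tangent.prod 𝓘(ℝ, ℝ)) 𝓘(ℝ, ℝ) ∞ L)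
    (hΦ : ∀ α, ContMDiff (𝓘(ℝ, E).tangent.prod 𝓘(ℝ, ℝ × ℝ)) 𝓘(ℝ, ℝ) ∞ (Φ α))
    (hc : ContMDiffOn 𝓘(ℝ, ℝ) 𝓘(ℝ, E) ∞ c (Icc 0 1)) (ht : t ∈ Icc (0 : ℝ) 1)
    (hz : zdot z t = L (velocity 𝓘(ℝ, E) c t, z t))
    (h0 : w' 0 = ∑ a, w a * partialZdot 𝓘(ℝ, E) (constraints 𝓘(ℝ, E) L Φ a) c z t)
    (h1 : ∀ α : Fin k, w' α.succ = w α.succ) :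
    ∑ a, w' a * partialZ 𝓘(ℝ, E)
        (constraints 𝓘(ℝ, E) L (psiConstraint 𝓘(ℝ, E) L Φ) a) c z t =
      ∑ a, w a * partialZ 𝓘(ℝ, E) (constraints 𝓘(ℝ, E) L Φ a) c z t := by
  rw [Fin.sum_univ_succ, Fin.sum_univ_succ, h0, Fin.sum_univ_succ, partialZ_constraints_zero,
    partialZ_constraints_zero, partialZdot_constraints_zero]
  simp only [constraints, Fin.cons_succ, partialZ_psiConstraint hL hΦ hc ht hz, h1, mul_add,
    Finset.sum_add_distrib, ← mul_assoc, ← Finset.sum_mul]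
  ring
end

/-- The constraints `φ^α` can be replaced by the constraints `ψ^α`, which do not involve `ż`. -/
theorem isVakonomicSolution_psiConstraint_iff
    (hL : ContMDiff (𝓘(ℝ, E).tangent.prod 𝓘(ℝ, ℝ)) 𝓘(ℝ, ℝ) ∞ L)
    (hΦ : ∀ α, ContMDiff (𝓘(ℝ, E).tangent.prod 𝓘(ℝ, ℝ × ℝ)) 𝓘(ℝ, ℝ) ∞ (Φ α))
    (hc : ContMDiffOn 𝓘(ℝ, ℝ) 𝓘(ℝ, E) ∞ c (Icc 0 1)) {lam lam' : ℝ → Fin (k + 1) → ℝ}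
    (h : ∀ t ∈ Icc (0 : ℝ) 1,
      lam' t 0 = ∑ a, lam t a * partialZdot 𝓘(ℝ, E) (constraints 𝓘(ℝ, E) L Φ a) c z t ∧
      ∀ α : Fin k, lam' t α.succ = lam t α.succ) :
    IsVakonomicSolution 𝓘(ℝ, E) (constraints 𝓘(ℝ, E) L Φ) lam c z ↔
      IsVakonomicSolution 𝓘(ℝ, E) (constraints 𝓘(ℝ, E) L (psiConstraint 𝓘(ℝ, E) L Φ)) lam' c z := by
  have hcon : (∀ t ∈ Icc (0 : ℝ) 1, ∀ a,
      constraints 𝓘(ℝ, E) L Φ a (velocity 𝓘(ℝ, E) c t, (z t, zdot z t)) = 0) ↔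
      ∀ t ∈ Icc (0 : ℝ) 1, ∀ a, constraints 𝓘(ℝ, E) L (psiConstraint 𝓘(ℝ, E) L Φ) a
        (velocity 𝓘(ℝ, E) c t, (z t, zdot z t)) = 0 :=
    forall₂_congr fun t _ => Set.ext_iff.1 zeroSet_psiConstraint _
  -- The derivative identities need `ż = L` along the curve. If the constraints fail, neither system
  -- holds, because each contains them.
  by_cases hzero : ∀ t ∈ Icc (0 : ℝ) 1, ∀ a,
      constraints 𝓘(ℝ, E) L Φ a (velocity 𝓘(ℝ, E) c t, (z t, zdot z t)) = 0
  swap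
  · exact ⟨fun hsol => (hzero hsol.eq_constraint).elim,
      fun hsol => (hzero (hcon.2 hsol.eq_constraint)).elim⟩
  have hz : ∀ t ∈ Icc (0 : ℝ) 1, zdot z t = L (velocity 𝓘(ℝ, E) c t, z t) := fun t ht =>
    sub_eq_zero.1 (hzero t ht 0)
  have hq : ∀ e ∈ atlas E M, ∀ t ∈ Icc (0 : ℝ) 1, c t ∈ e.source →
      (fun s => ∑ a, lam' s a • partialV 𝓘(ℝ, E) e (fun p =>
        constraints 𝓘(ℝ, E) L (psiConstraint 𝓘(ℝ, E) L Φ) a (p, (z s, zdot z s))) c s)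
        =ᶠ[nhdsWithin t (Icc 0 1)] fun s => ∑ a, lam s a • partialV 𝓘(ℝ, E) e (fun p =>
          constraints 𝓘(ℝ, E) L Φ a (p, (z s, zdot z s))) c s := fun e he t ht hs => by
    filter_upwards [eventually_mem_source hc ht hs] with r hr
    exact sum_partialV_psiConstraint he hL hΦ hc hr.1 hr.2 (hz r hr.1) (h r hr.1).1 (h r hr.1).2
  have hzd : ∀ t ∈ Icc (0 : ℝ) 1, _ := fun t ht =>
    sum_partialZdot_psiConstraint (L := L) (Φ := Φ) (c := c) (z := z) (h t ht).1
  refine ⟨fun hsol => ⟨fun e he t ht hs => ?_, fun t ht => ?_, hcon.1 hzero⟩,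
    fun hsol => ⟨fun e he t ht hs => ?_, fun t ht => ?_, hzero⟩⟩
  · rw [sum_partialQ_psiConstraint he hL hΦ hc ht hs (hz t ht) (h t ht).1 (h t ht).2]
    exact (hsol.eq_q e he t ht hs).congr_of_eventuallyEq (hq e he t ht hs)
      ((hq e he t ht hs).self_of_nhdsWithin ht)
  · rw [sum_partialZ_psiConstraint hL hΦ hc ht (hz t ht) (h t ht).1 (h t ht).2]
    exact (hsol.eq_z t ht).congr hzd (hzd t ht)
  · rw [← sum_partialQ_psiConstraint he hL hΦ hc ht hs (hz t ht) (h t ht).1 (h t ht).2]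
    exact (hsol.eq_q e he t ht hs).congr_of_eventuallyEq (hq e he t ht hs).symm
      ((hq e he t ht hs).symm.self_of_nhdsWithin ht)
  · rw [← sum_partialZ_psiConstraint hL hΦ hc ht (hz t ht) (h t ht).1 (h t ht).2]
    exact (hsol.eq_z t ht).congr (fun r hr => (hzd r hr).symm) (hzd t ht).symm

end

/-! ### The Herglotz form of the equations. -/

/-- Integrating factor: `(f P)' = f (P' - l P)` when `f' = -f l`. With `l = ∂𝓛_μ/∂z` the right-hand
term becomes the dissipative term of the Herglotz equation. -/
theorem hasDerivWithinAt_smul_iff {F : Type*} [NormedAddCommGroup F] [NormedSpace ℝ F]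
    {f : ℝ → ℝ} {P : ℝ → F} {Q : F} {s : Set ℝ} {t l : ℝ} (hf : ∀ r ∈ s, f r ≠ 0) (ht : t ∈ s)
    (h : HasDerivWithinAt f (-(f t * l)) s t) :
    HasDerivWithinAt (fun r => f r • P r) (f t • Q) s t ↔
      HasDerivWithinAt P (Q + l • P t) s t := by
  constructor
  · intro h1
    refine (((h.fun_inv (hf t ht)).fun_smul h1).congr
      (fun r hr => (inv_smul_smul₀ (hf r hr) _).symm)
      (inv_smul_smul₀ (hf t ht) _).symm).congr_deriv ?_
    have h2 : -(-(f t * l)) / f t ^ 2 * f t = l := by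
      field_simp [hf t ht]
    rw [inv_smul_smul₀ (hf t ht), smul_smul, h2]
  · intro h1
    refine (h.fun_smul h1).congr_deriv ?_
    module

section
variable {E : Type*} [NormedAddCommGroup E] [NormedSpace ℝ E]
  {M : Type*} [TopologicalSpace M] [ChartedSpace E M] {k : ℕ}
  {e : OpenPartialHomeomorph M E} {c : ℝ → M} {z : ℝ → ℝ} {t : ℝ}
  {L : TangentBundle 𝓘(ℝ, E) M × ℝ → ℝ} {Φ : Fin k → TangentBundle 𝓘(ℝ, E) M × (ℝ × ℝ) → ℝ}
  {mu : ℝ → Fin k → ℝ} {lam : ℝ → Fin (k + 1) → ℝ} {lam₀ : ℝ → ℝ}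

theorem psiConstraint_eq_self (h : ∀ α x y w w', Φ α (x, (y, w)) = Φ α (x, (y, w'))) :
    psiConstraint 𝓘(ℝ, E) L Φ = Φ := by
  ext α ⟨x, y, w⟩
  exact h _ _ _ _ _

theorem naturalBoundary_psiConstraint_iff :
    NaturalBoundary 𝓘(ℝ, E) (constraints 𝓘(ℝ, E) L (psiConstraint 𝓘(ℝ, E) L Φ)) lam c z ↔
      lam 1 0 = 1 := by
  rw [NaturalBoundary, Fin.sum_univ_succ, partialZdot_constraints_zero]
  simp only [constraints, Fin.cons_succ, partialZdot_psiConstraint]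
  simp only [mul_one, mul_zero, Finset.sum_const_zero, add_zero, sub_eq_zero]
  exact eq_comm

/-- The variable `w` stands for `ż` and cancels against `φ⁰`. Setting it to `zdot z t` expresses the
derivatives of `𝓛_μ` through those of the constraints, with weights `(1, μ)`. -/
theorem lagrangianMu_eq_sub (p : TangentBundle 𝓘(ℝ, E) M) (y w : ℝ) :
    lagrangianMu 𝓘(ℝ, E) L Φ mu t (p, y) = w - ∑ a, (Fin.cons 1 (mu t) : Fin (k + 1) → ℝ) a *
      constraints 𝓘(ℝ, E) L (psiConstraint 𝓘(ℝ, E) L Φ) a (p, (y, w)) := by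
  simp [Fin.sum_univ_succ, constraints, lagrangianMu, psiConstraint]
  ring

theorem lagrangianMu_eq_of_psi_eq_zero {x : TangentBundle 𝓘(ℝ, E) M × ℝ}
    (h : ∀ α, psi 𝓘(ℝ, E) L Φ α x = 0) : lagrangianMu 𝓘(ℝ, E) L Φ mu t x = L x := by
  simp [lagrangianMu, h]

theorem constraints_psiConstraint_eq_zero_iff :
    (∀ a, constraints 𝓘(ℝ, E) L (psiConstraint 𝓘(ℝ, E) L Φ) a
      (velocity 𝓘(ℝ, E) c t, (z t, zdot z t)) = 0) ↔
    (∀ α, psi 𝓘(ℝ, E) L Φ α (velocity 𝓘(ℝ, E) c t, z t) = 0) ∧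
      zdot z t = lagrangianMu 𝓘(ℝ, E) L Φ mu t (velocity 𝓘(ℝ, E) c t, z t) := by
  rw [Fin.forall_fin_succ, and_comm]
  refine and_congr_right fun h => ?_
  rw [lagrangianMu_eq_of_psi_eq_zero h]
  exact sub_eq_zero

/-- The reduced equations are the Herglotz equations of `𝓛_μ` together with the equation of `λ₀`. -/
theorem isReducedSolution_iff_isHerglotzSolution (hlam : ∀ t ∈ Icc (0 : ℝ) 1, lam₀ t ≠ 0) :
    IsReducedSolution 𝓘(ℝ, E) L Φ lam₀ mu c z ↔ IsHerglotzSolution 𝓘(ℝ, E) L Φ mu c z ∧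
      ∀ t ∈ Icc (0 : ℝ) 1, HasDerivWithinAt lam₀
        (-(lam₀ t * lagrangianMuZ 𝓘(ℝ, E) L Φ mu c z t)) (Icc 0 1) t := by
  constructor
  · intro h
    exact ⟨⟨fun e he t ht hs => (hasDerivWithinAt_smul_iff hlam ht (h.eq_z t ht)).1
      (h.eq_q e he t ht hs), h.eq_psi, h.eq_zdot⟩, h.eq_z⟩
  · rintro ⟨h, hz⟩
    exact ⟨fun e he t ht hs => (hasDerivWithinAt_smul_iff hlam ht (hz t ht)).2
      (h.herglotz e he t ht hs), hz, h.eq_psi, h.eq_zdot⟩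

variable [IsManifold 𝓘(ℝ, E) ∞ M]

theorem partialV_lagrangianMu (he : e ∈ atlas E M)
    (hL : ContMDiff (𝓘(ℝ, E).tangent.prod 𝓘(ℝ, ℝ)) 𝓘(ℝ, ℝ) ∞ L)
    (hΦ : ∀ α, ContMDiff (𝓘(ℝ, E).tangent.prod 𝓘(ℝ, ℝ × ℝ)) 𝓘(ℝ, ℝ) ∞ (Φ α))
    (hs : c t ∈ e.source) :
    partialV 𝓘(ℝ, E) e (fun p => lagrangianMu 𝓘(ℝ, E) L Φ mu t (p, z t)) c t =
      -∑ a, (Fin.cons 1 (mu t) : Fin (k + 1) → ℝ) a • partialV 𝓘(ℝ, E) e (fun p =>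
        constraints 𝓘(ℝ, E) L (psiConstraint 𝓘(ℝ, E) L Φ) a (p, (z t, zdot z t))) c t := by
  simp only [lagrangianMu_eq_sub _ _ (zdot z t)]
  exact ((HasFDerivAt.fun_sum fun a _ => (hasFDerivAt_partialV he (contMDiff_constraints hL
    (contMDiff_psiConstraint hL hΦ) a) hs (z t, zdot z t)).const_mul _).const_sub _).fderiv

theorem partialQ_lagrangianMu (he : e ∈ atlas E M)
    (hL : ContMDiff (𝓘(ℝ, E).tangent.prod 𝓘(ℝ, ℝ)) 𝓘(ℝ, ℝ) ∞ L)
    (hΦ : ∀ α, ContMDiff (𝓘(ℝ, E).tangent.prod 𝓘(ℝ, ℝ × ℝ)) 𝓘(ℝ, ℝ) ∞ (Φ α))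
    (hs : c t ∈ e.source) :
    partialQ 𝓘(ℝ, E) e (fun p => lagrangianMu 𝓘(ℝ, E) L Φ mu t (p, z t)) c t =
      -∑ a, (Fin.cons 1 (mu t) : Fin (k + 1) → ℝ) a • partialQ 𝓘(ℝ, E) e (fun p =>
        constraints 𝓘(ℝ, E) L (psiConstraint 𝓘(ℝ, E) L Φ) a (p, (z t, zdot z t))) c t := by
  simp only [lagrangianMu_eq_sub _ _ (zdot z t)]
  exact ((HasFDerivAt.fun_sum fun a _ => (hasFDerivAt_partialQ he (contMDiff_constraints hL
    (contMDiff_psiConstraint hL hΦ) a) hs (z t, zdot z t)).const_mul _).const_sub _).fderiv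

theorem hasDerivAt_partialZ {φ : TangentBundle 𝓘(ℝ, E) M × (ℝ × ℝ) → ℝ}
    (hφ : ContMDiff (𝓘(ℝ, E).tangent.prod 𝓘(ℝ, ℝ × ℝ)) 𝓘(ℝ, ℝ) ∞ φ)
    (hc : ContMDiffOn 𝓘(ℝ, ℝ) 𝓘(ℝ, E) ∞ c (Icc 0 1)) (ht : t ∈ Icc (0 : ℝ) 1) :
    HasDerivAt (fun y => φ (velocity 𝓘(ℝ, E) c t, (y, zdot z t))) (partialZ 𝓘(ℝ, E) φ c z t)
      (z t) := by
  have h1 := hasFDerivAt_parameter (chart_mem_atlas E (c t)) hφ hc ht (mem_chart_source E (c t))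
    (z t, zdot z t)
  exact (HasFDerivAt.comp_hasDerivAt (f := fun y : ℝ => (y, zdot z t)) (z t) h1
    ((hasDerivAt_id (z t)).prodMk (hasDerivAt_const _ _))).differentiableAt.hasDerivAt

theorem lagrangianMuZ_eq
    (hL : ContMDiff (𝓘(ℝ, E).tangent.prod 𝓘(ℝ, ℝ)) 𝓘(ℝ, ℝ) ∞ L)
    (hΦ : ∀ α, ContMDiff (𝓘(ℝ, E).tangent.prod 𝓘(ℝ, ℝ × ℝ)) 𝓘(ℝ, ℝ) ∞ (Φ α))
    (hc : ContMDiffOn 𝓘(ℝ, ℝ) 𝓘(ℝ, E) ∞ c (Icc 0 1)) (ht : t ∈ Icc (0 : ℝ) 1) :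
    lagrangianMuZ 𝓘(ℝ, E) L Φ mu c z t = -∑ a, (Fin.cons 1 (mu t) : Fin (k + 1) → ℝ) a *
      partialZ 𝓘(ℝ, E) (constraints 𝓘(ℝ, E) L (psiConstraint 𝓘(ℝ, E) L Φ) a) c z t := by
  rw [lagrangianMuZ]
  simp only [lagrangianMu_eq_sub _ _ (zdot z t)]
  have h : ∀ a, HasDerivAt (fun y => (Fin.cons 1 (mu t) : Fin (k + 1) → ℝ) a *
      constraints 𝓘(ℝ, E) L (psiConstraint 𝓘(ℝ, E) L Φ) a (velocity 𝓘(ℝ, E) c t, (y, zdot z t)))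
      _ (z t) := fun a => (hasDerivAt_partialZ (contMDiff_constraints hL
    (contMDiff_psiConstraint hL hΦ) a) hc ht).const_mul _
  exact ((HasDerivAt.fun_sum fun a _ => h a).const_sub _).deriv

theorem contDiffOn_lagrangianMuZ
    (hL : ContMDiff (𝓘(ℝ, E).tangent.prod 𝓘(ℝ, ℝ)) 𝓘(ℝ, ℝ) ∞ L)
    (hΦ : ∀ α, ContMDiff (𝓘(ℝ, E).tangent.prod 𝓘(ℝ, ℝ × ℝ)) 𝓘(ℝ, ℝ) ∞ (Φ α))
    (hc : ContMDiffOn 𝓘(ℝ, ℝ) 𝓘(ℝ, E) ∞ c (Icc 0 1)) (hz : ContDiffOn ℝ ∞ z (Icc 0 1))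
    (hmu : ContDiffOn ℝ ∞ mu (Icc 0 1)) :
    ContDiffOn ℝ ∞ (lagrangianMuZ 𝓘(ℝ, E) L Φ mu c z) (Icc 0 1) := by
  refine ContDiffOn.congr ?_ fun t ht => lagrangianMuZ_eq hL hΦ hc ht
  refine (ContDiffOn.sum fun a _ => ContDiffOn.mul ?_ fun t ht => ?_).neg
  · refine Fin.cases contDiffOn_const (fun α => ?_) a
    exact contDiffOn_pi.1 hmu α
  · have he := chart_mem_atlas E (c t)
    have hs := mem_chart_source E (c t)
    have hφ := contMDiff_constraints hL (contMDiff_psiConstraint hL hΦ) a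
    refine ((contDiffWithinAt_fderiv_chartJet he hφ hc hz ht hs).clm_apply
      (contDiffWithinAt_const (c := ((0, 0, 1, 0) : E × E × ℝ × ℝ)))).congr_of_eventuallyEq ?_
      (partialZ_eq he hφ hc ht hs z)
    filter_upwards [eventually_mem_source hc ht hs] with r hr
    exact partialZ_eq he hφ hc hr.1 hr.2 z

/-- The vakonomic equations in terms of `λ₀` and `𝓛_μ`. -/
theorem isVakonomicSolution_iff_isReducedSolution
    (hL : ContMDiff (𝓘(ℝ, E).tangent.prod 𝓘(ℝ, ℝ)) 𝓘(ℝ, ℝ) ∞ L)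
    (hΦ : ∀ α, ContMDiff (𝓘(ℝ, E).tangent.prod 𝓘(ℝ, ℝ × ℝ)) 𝓘(ℝ, ℝ) ∞ (Φ α))
    (hc : ContMDiffOn 𝓘(ℝ, ℝ) 𝓘(ℝ, E) ∞ c (Icc 0 1))
    (hlam : ∀ t ∈ Icc (0 : ℝ) 1, lam t 0 ≠ 0)
    (hmu : ∀ t ∈ Icc (0 : ℝ) 1, ∀ α : Fin k, mu t α = lam t α.succ / lam t 0) :
    IsVakonomicSolution 𝓘(ℝ, E) (constraints 𝓘(ℝ, E) L (psiConstraint 𝓘(ℝ, E) L Φ)) lam c z ↔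
      IsReducedSolution 𝓘(ℝ, E) L Φ (fun t => lam t 0) mu c z := by
  -- Multiplying the weights `(1, μ)` by `λ₀` restores `λ`, so each equation for `λ₀` and `𝓛_μ` is
  -- the negative of one for `λ`, or the same.
  have hw : ∀ t ∈ Icc (0 : ℝ) 1, ∀ a,
      lam t 0 * (Fin.cons 1 (mu t) : Fin (k + 1) → ℝ) a = lam t a := fun t ht a => by
    refine Fin.cases (by simp) (fun α => ?_) a
    rw [Fin.cons_succ, hmu t ht, mul_div_cancel₀ _ (hlam t ht)]
  have hV : ∀ e ∈ atlas E M, ∀ t ∈ Icc (0 : ℝ) 1, c t ∈ e.source →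
      lam t 0 • partialV 𝓘(ℝ, E) e (fun p => lagrangianMu 𝓘(ℝ, E) L Φ mu t (p, z t)) c t =
      -∑ a, lam t a • partialV 𝓘(ℝ, E) e (fun p =>
        constraints 𝓘(ℝ, E) L (psiConstraint 𝓘(ℝ, E) L Φ) a (p, (z t, zdot z t))) c t :=
    fun e he t ht hs => by
      rw [partialV_lagrangianMu he hL hΦ hs, smul_neg, Finset.smul_sum]
      simp only [smul_smul, hw t ht]
  have hQ : ∀ e ∈ atlas E M, ∀ t ∈ Icc (0 : ℝ) 1, c t ∈ e.source →
      lam t 0 • partialQ 𝓘(ℝ, E) e (fun p => lagrangianMu 𝓘(ℝ, E) L Φ mu t (p, z t)) c t =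
      -∑ a, lam t a • partialQ 𝓘(ℝ, E) e (fun p =>
        constraints 𝓘(ℝ, E) L (psiConstraint 𝓘(ℝ, E) L Φ) a (p, (z t, zdot z t))) c t :=
    fun e he t ht hs => by
      rw [partialQ_lagrangianMu he hL hΦ hs, smul_neg, Finset.smul_sum]
      simp only [smul_smul, hw t ht]
  have hVe : ∀ e ∈ atlas E M, ∀ t ∈ Icc (0 : ℝ) 1, c t ∈ e.source →
      (fun s => lam s 0 • partialV 𝓘(ℝ, E) e
        (fun p => lagrangianMu 𝓘(ℝ, E) L Φ mu s (p, z s)) c s) =ᶠ[nhdsWithin t (Icc 0 1)]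
      fun s => -∑ a, lam s a • partialV 𝓘(ℝ, E) e (fun p =>
        constraints 𝓘(ℝ, E) L (psiConstraint 𝓘(ℝ, E) L Φ) a (p, (z s, zdot z s))) c s :=
    fun e he t ht hs => by
      filter_upwards [eventually_mem_source hc ht hs] with r hr using hV e he r hr.1 hr.2
  have hZ : ∀ t ∈ Icc (0 : ℝ) 1, -(lam t 0 * lagrangianMuZ 𝓘(ℝ, E) L Φ mu c z t) =
      ∑ a, lam t a * partialZ 𝓘(ℝ, E)
        (constraints 𝓘(ℝ, E) L (psiConstraint 𝓘(ℝ, E) L Φ) a) c z t := fun t ht => by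
    rw [lagrangianMuZ_eq hL hΦ hc ht, mul_neg, neg_neg, Finset.mul_sum]
    simp only [← mul_assoc, hw t ht]
  have hZd : (fun s => ∑ a, lam s a * partialZdot 𝓘(ℝ, E)
      (constraints 𝓘(ℝ, E) L (psiConstraint 𝓘(ℝ, E) L Φ) a) c z s) = fun s => lam s 0 := by
    ext s
    rw [Fin.sum_univ_succ, partialZdot_constraints_zero]
    simp only [constraints, Fin.cons_succ, partialZdot_psiConstraint]
    simp
  constructor
  · intro h
    refine ⟨fun e he t ht hs => ?_, fun t ht => ?_,
      fun t ht => ((constraints_psiConstraint_eq_zero_iff (mu := mu)).1 (h.eq_constraint t ht)).1,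
      fun t ht => ((constraints_psiConstraint_eq_zero_iff (mu := mu)).1 (h.eq_constraint t ht)).2⟩
    · rw [hQ e he t ht hs]
      exact (h.eq_q e he t ht hs).neg.congr_of_eventuallyEq (hVe e he t ht hs) (hV e he t ht hs)
    · rw [hZ t ht, ← hZd]
      exact h.eq_z t ht
  · intro h
    refine ⟨fun e he t ht hs => ?_, fun t ht => ?_,
      fun t ht => constraints_psiConstraint_eq_zero_iff.2 ⟨h.eq_psi t ht, h.eq_zdot t ht⟩⟩
    · have h1 := ((h.eq_q e he t ht hs).congr_of_eventuallyEq (hVe e he t ht hs).symm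
        (hV e he t ht hs).symm).fun_neg
      rw [hQ e he t ht hs] at h1
      simpa only [neg_neg] using h1
    · rw [hZd, ← hZ t ht]
      exact h.eq_z t ht

/-- The Herglotz equations of `𝓛_μ` are the vakonomic equations for a nowhere zero multiplier `λ₀`. -/
theorem isHerglotzSolution_iff_exists
    (hL : ContMDiff (𝓘(ℝ, E).tangent.prod 𝓘(ℝ, ℝ)) 𝓘(ℝ, ℝ) ∞ L)
    (hΦ : ∀ α, ContMDiff (𝓘(ℝ, E).tangent.prod 𝓘(ℝ, ℝ × ℝ)) 𝓘(ℝ, ℝ) ∞ (Φ α))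
    (hc : ContMDiffOn 𝓘(ℝ, ℝ) 𝓘(ℝ, E) ∞ c (Icc 0 1)) (hz : ContDiffOn ℝ ∞ z (Icc 0 1))
    (hmu : ContDiffOn ℝ ∞ mu (Icc 0 1)) :
    IsHerglotzSolution 𝓘(ℝ, E) L Φ mu c z ↔
      ∃ lam : ℝ → Fin (k + 1) → ℝ, ContDiffOn ℝ ∞ lam (Icc 0 1) ∧
        (∀ t ∈ Icc (0 : ℝ) 1, lam t 0 ≠ 0 ∧ ∀ α : Fin k, mu t α = lam t α.succ / lam t 0) ∧
        IsVakonomicSolution 𝓘(ℝ, E)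
          (constraints 𝓘(ℝ, E) L (psiConstraint 𝓘(ℝ, E) L Φ)) lam c z ∧
        NaturalBoundary 𝓘(ℝ, E)
          (constraints 𝓘(ℝ, E) L (psiConstraint 𝓘(ℝ, E) L Φ)) lam c z := by
  constructor
  swap
  · rintro ⟨lam, -, hlam, hsol, -⟩
    exact ((isReducedSolution_iff_isHerglotzSolution fun t ht => (hlam t ht).1).1
      ((isVakonomicSolution_iff_isReducedSolution hL hΦ hc (fun t ht => (hlam t ht).1)
        fun t ht => (hlam t ht).2).1 hsol)).1
  intro h
  have hl := contDiffOn_lagrangianMuZ hL hΦ hc hz hmu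
  set l := lagrangianMuZ 𝓘(ℝ, E) L Φ mu c z
  set p := primitive (restrictUnit hl.continuousOn)
  -- The positive solution of `λ₀' = -λ₀ ∂𝓛_μ/∂z`, normalised to be `1` at `t = 1` so that (B)
  -- holds.
  set lam₀ : ℝ → ℝ := fun t => Real.exp (p 1 - p t) with hlam₀
  have hder : ∀ t ∈ Icc (0 : ℝ) 1, HasDerivWithinAt lam₀ (-(lam₀ t * l t)) (Icc 0 1) t :=
    fun t ht => by
      have h1 := (hasDerivAt_primitive (restrictUnit hl.continuousOn) t).hasDerivWithinAt
        (s := Icc 0 1)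
      rw [IccExtend_of_mem _ _ ht] at h1
      refine (h1.const_sub (p 1)).exp.congr_deriv ?_
      exact mul_neg _ _
  have hsm : ContDiffOn ℝ ∞ lam₀ (Icc 0 1) := by
    refine contDiffOn_of_linear_ode (A := fun t => -(l t) • ContinuousLinearMap.id ℝ ℝ)
      (g := fun _ => 0) (hl.neg.smul contDiffOn_const) contDiffOn_const fun t ht => ?_
    refine (hder t ht).congr_deriv ?_
    simp [mul_comm]
  have hne : ∀ t, lam₀ t ≠ 0 := fun t => (Real.exp_pos _).ne'
  refine ⟨fun t => Fin.cons (lam₀ t) (lam₀ t • mu t), ?_, fun t ht => ⟨hne t, fun α => ?_⟩, ?_, ?_⟩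
  · refine contDiffOn_pi.2 fun a => ?_
    refine Fin.cases hsm (fun α => ?_) a
    exact hsm.mul (contDiffOn_pi.1 hmu α)
  · simp [hne t]
  · refine (isVakonomicSolution_iff_isReducedSolution (mu := mu) hL hΦ hc (fun t _ => hne t)
      fun t _ α => ?_).2 ((isReducedSolution_iff_isHerglotzSolution fun t _ => hne t).2 ⟨h, hder⟩)
    simp [hne t]
  · rw [naturalBoundary_psiConstraint_iff]
    simp [hlam₀]
end

/-! ### The extended Lagrangian on `M × ℝᵏ`. -/

section
variable {E : Type*} [TopologicalSpace E] {M : Type*} [TopologicalSpace M] [ChartedSpace E M]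
  {k : ℕ}

/-- The product of the chart `e` with the identity chart of `ℝᵏ`. -/
def prodChart (k : ℕ) (e : OpenPartialHomeomorph M E) :
    OpenPartialHomeomorph (M × (Fin k → ℝ)) (ModelProd E (Fin k → ℝ)) :=
  e.prod (OpenPartialHomeomorph.refl (Fin k → ℝ))

/-- The atlas of the vector space `ℝᵏ` consists of the identity chart only, so the equations in all
charts of the product can be compared with those in all charts of `M`. -/
theorem mem_atlas_prod_iff
    {e' : OpenPartialHomeomorph (M × (Fin k → ℝ)) (ModelProd E (Fin k → ℝ))} :
    e' ∈ atlas (ModelProd E (Fin k → ℝ)) (M × (Fin k → ℝ)) ↔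
      ∃ e ∈ atlas E M, e' = prodChart k e := by
  constructor
  · rintro ⟨e, he, e₂, he₂, rfl⟩
    rw [chartedSpaceSelf_atlas] at he₂
    exact ⟨e, he, by rw [he₂]; rfl⟩
  · rintro ⟨e, he, rfl⟩
    exact ⟨e, he, _, chartedSpaceSelf_atlas.2 rfl, rfl⟩

end

section
variable {E : Type*} [NormedAddCommGroup E] [NormedSpace ℝ E]
  {M : Type*} [TopologicalSpace M] [ChartedSpace E M] {k : ℕ}
  {e : OpenPartialHomeomorph M E} {c : ℝ → M} {z : ℝ → ℝ} {t : ℝ}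
  {L : TangentBundle 𝓘(ℝ, E) M × ℝ → ℝ} {Φ : Fin k → TangentBundle 𝓘(ℝ, E) M × (ℝ × ℝ) → ℝ}
  {mu : ℝ → Fin k → ℝ}

theorem extendedLagrangian_eq
    (x : TangentBundle (𝓘(ℝ, E).prod 𝓘(ℝ, Fin k → ℝ)) (M × (Fin k → ℝ)) × ℝ) :
    extendedLagrangian 𝓘(ℝ, E) L Φ x = lagrangianMu 𝓘(ℝ, E) L Φ (fun _ => x.1.proj.2) t
      ((equivTangentBundleProd 𝓘(ℝ, E) M 𝓘(ℝ, Fin k → ℝ) (Fin k → ℝ) x.1).1, x.2) :=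
  rfl

/-- Restrict to the two factors. The momentum has no component along `μ`, so that component of the
equation says `0 = w`; it will be used with `w` given by the values of the `ψ^α`. -/
theorem hasDerivWithinAt_comp_fst_iff {P : ℝ → E →L[ℝ] ℝ} {A : E →L[ℝ] ℝ} {w : Fin k → ℝ}
    (ht : t ∈ Icc (0 : ℝ) 1) :
    HasDerivWithinAt (fun s => (P s).comp (.fst ℝ E (Fin k → ℝ))) (A.comp (.fst ℝ E (Fin k → ℝ)) -
      ∑ α, w α • (ContinuousLinearMap.proj α).comp (.snd ℝ E (Fin k → ℝ))) (Icc 0 1) t ↔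
    HasDerivWithinAt P A (Icc 0 1) t ∧ ∀ α, w α = 0 := by
  constructor
  · intro h
    have h1 := ((ContinuousLinearMap.compL ℝ E (E × (Fin k → ℝ)) ℝ).flip
      (.inl ℝ E (Fin k → ℝ))).hasFDerivAt.comp_hasDerivWithinAt t h
    have h2 := ((ContinuousLinearMap.compL ℝ (Fin k → ℝ) (E × (Fin k → ℝ)) ℝ).flip
      (.inr ℝ E (Fin k → ℝ))).hasFDerivAt.comp_hasDerivWithinAt t h
    refine ⟨(h1.congr (fun s _ => ?_) ?_).congr_deriv ?_, fun α => ?_⟩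
    · ext; simp
    · ext; simp
    · ext; simp [sum_apply]
    · have h3 : HasDerivWithinAt (fun _ : ℝ => (0 : (Fin k → ℝ) →L[ℝ] ℝ)) _ (Icc 0 1) t :=
        h2.congr (fun s _ => by ext; simp) (by ext; simp)
      have h4 := (uniqueDiffWithinAt_unitInterval ht).eq_deriv _ h3 (hasDerivWithinAt_const t _ _)
      have h5 := congrArg (fun D : (Fin k → ℝ) →L[ℝ] ℝ => D (Pi.single α 1)) h4
      simpa [sum_apply, Pi.single_apply] using h5
  · rintro ⟨h, hw⟩
    refine (((ContinuousLinearMap.compL ℝ (E × (Fin k → ℝ)) E ℝ).flip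
      (.fst ℝ E (Fin k → ℝ))).hasFDerivAt.comp_hasDerivWithinAt t h).congr_deriv ?_
    simp [hw]

theorem velocity_prod_fst
    (hc : ContMDiffOn 𝓘(ℝ, ℝ) 𝓘(ℝ, E) ∞ c (Icc 0 1)) (hmu : ContDiffOn ℝ ∞ mu (Icc 0 1))
    (ht : t ∈ Icc (0 : ℝ) 1) :
    (equivTangentBundleProd 𝓘(ℝ, E) M 𝓘(ℝ, Fin k → ℝ) (Fin k → ℝ)
      (velocity (𝓘(ℝ, E).prod 𝓘(ℝ, Fin k → ℝ)) (fun s => (c s, mu s)) t)).1 =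
      velocity 𝓘(ℝ, E) c t := by
  have h1 := mfderivWithin_prodMk ((hc t ht).mdifferentiableWithinAt (by simp))
    ((hmu.contMDiffOn t ht).mdifferentiableWithinAt (by simp))
    (uniqueDiffWithinAt_unitInterval ht).uniqueMDiffWithinAt
  refine Bundle.TotalSpace.ext rfl (heq_of_eq ?_)
  exact congrArg (fun D : ℝ →L[ℝ] E × (Fin k → ℝ) => (D 1).1) h1

theorem extendedLagrangian_velocity
    (hc : ContMDiffOn 𝓘(ℝ, ℝ) 𝓘(ℝ, E) ∞ c (Icc 0 1)) (hmu : ContDiffOn ℝ ∞ mu (Icc 0 1))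
    (ht : t ∈ Icc (0 : ℝ) 1) (y : ℝ) :
    extendedLagrangian 𝓘(ℝ, E) L Φ
        (velocity (𝓘(ℝ, E).prod 𝓘(ℝ, Fin k → ℝ)) (fun s => (c s, mu s)) t, y) =
      lagrangianMu 𝓘(ℝ, E) L Φ mu t (velocity 𝓘(ℝ, E) c t, y) := by
  rw [extendedLagrangian_eq (t := t), velocity_prod_fst hc hmu ht]
  rfl

variable [IsManifold 𝓘(ℝ, E) ∞ M]

theorem contMDiff_psi
    (hL : ContMDiff (𝓘(ℝ, E).tangent.prod 𝓘(ℝ, ℝ)) 𝓘(ℝ, ℝ) ∞ L)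
    (hΦ : ∀ α, ContMDiff (𝓘(ℝ, E).tangent.prod 𝓘(ℝ, ℝ × ℝ)) 𝓘(ℝ, ℝ) ∞ (Φ α)) (α : Fin k) :
    ContMDiff (𝓘(ℝ, E).tangent.prod 𝓘(ℝ, ℝ)) 𝓘(ℝ, ℝ) ∞ (psi 𝓘(ℝ, E) L Φ α) :=
  (hΦ α).comp (contMDiff_fst.prodMk (contMDiff_snd.prodMk_space hL))

theorem chartPoint_prodChart_fst (he : e ∈ atlas E M) {p : E × (Fin k → ℝ)} (hp : p.1 ∈ e.target)
    (v : E × (Fin k → ℝ)) :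
    (equivTangentBundleProd 𝓘(ℝ, E) M 𝓘(ℝ, Fin k → ℝ) (Fin k → ℝ)
      (chartPoint (𝓘(ℝ, E).prod 𝓘(ℝ, Fin k → ℝ)) (prodChart k e) p v)).1 =
      chartPoint 𝓘(ℝ, E) e p.1 v.1 := by
  have h1 := ((contMDiffAt_chart_symm he hp).mdifferentiableAt (by simp)).hasMFDerivAt
  have h2 := HasMFDerivAt.comp (f := fun q : E × (Fin k → ℝ) => q.1) p h1
    (ContinuousLinearMap.fst ℝ E (Fin k → ℝ)).hasMFDerivAt
  have h3 := h2.prodMk (ContinuousLinearMap.snd ℝ E (Fin k → ℝ)).hasMFDerivAt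
  refine Bundle.TotalSpace.ext rfl (heq_of_eq ?_)
  exact congrArg (fun D : E × (Fin k → ℝ) →L[ℝ] E × (Fin k → ℝ) => (D v).1) h3.mfderiv

theorem chartVelocity_prodChart (he : e ∈ atlas E M)
    (hc : ContMDiffOn 𝓘(ℝ, ℝ) 𝓘(ℝ, E) ∞ c (Icc 0 1)) (hmu : ContDiffOn ℝ ∞ mu (Icc 0 1))
    (ht : t ∈ Icc (0 : ℝ) 1) (hs : c t ∈ e.source) :
    chartVelocity (𝓘(ℝ, E).prod 𝓘(ℝ, Fin k → ℝ)) (prodChart k e) (fun s => (c s, mu s)) t =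
      (chartVelocity 𝓘(ℝ, E) e c t, derivWithin mu (Icc 0 1) t) :=
  (((contDiffWithinAt_chart_comp he hc ht hs).differentiableWithinAt
    (by simp)).hasDerivWithinAt.prodMk ((hmu t ht).differentiableWithinAt
      (by simp)).hasDerivWithinAt).derivWithin (uniqueDiffWithinAt_unitInterval ht)

theorem partialV_extendedLagrangian (he : e ∈ atlas E M)
    (hL : ContMDiff (𝓘(ℝ, E).tangent.prod 𝓘(ℝ, ℝ)) 𝓘(ℝ, ℝ) ∞ L)
    (hΦ : ∀ α, ContMDiff (𝓘(ℝ, E).tangent.prod 𝓘(ℝ, ℝ × ℝ)) 𝓘(ℝ, ℝ) ∞ (Φ α))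
    (hc : ContMDiffOn 𝓘(ℝ, ℝ) 𝓘(ℝ, E) ∞ c (Icc 0 1)) (hmu : ContDiffOn ℝ ∞ mu (Icc 0 1))
    (ht : t ∈ Icc (0 : ℝ) 1) (hs : c t ∈ e.source) (y : ℝ) :
    partialV (𝓘(ℝ, E).prod 𝓘(ℝ, Fin k → ℝ)) (prodChart k e)
        (fun p => extendedLagrangian 𝓘(ℝ, E) L Φ (p, y)) (fun s => (c s, mu s)) t =
      (partialV 𝓘(ℝ, E) e (fun p => lagrangianMu 𝓘(ℝ, E) L Φ mu t (p, y)) c t).comp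
        (.fst ℝ E (Fin k → ℝ)) := by
  rw [partialV, chartVelocity_prodChart he hc hmu ht hs]
  have h1 : HasFDerivAt (fun v => lagrangianMu 𝓘(ℝ, E) L Φ mu t
      (chartPoint 𝓘(ℝ, E) e (e (c t)) v, y)) _ (chartVelocity 𝓘(ℝ, E) e c t) :=
    (hasFDerivAt_partialV he hL hs y).sub (HasFDerivAt.fun_sum (u := Finset.univ) fun α _ =>
      (hasFDerivAt_partialV he (contMDiff_psi hL hΦ α) hs y).const_mul (mu t α))
  have h2 := HasFDerivAt.comp (f := fun v : E × (Fin k → ℝ) => v.1)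
    (chartVelocity 𝓘(ℝ, E) e c t, derivWithin mu (Icc 0 1) t) h1.differentiableAt.hasFDerivAt
    hasFDerivAt_fst
  refine (h2.congr_of_eventuallyEq (Filter.Eventually.of_forall fun v => ?_)).fderiv
  rw [extendedLagrangian_eq (t := t), chartPoint_prodChart_fst he (e.map_source hs)]
  rfl

/-- The extended Lagrangian is affine in `μ`, so the product rule adds to the derivative with `μ`
frozen only the covector `-ψ^α dμ_α`. -/
theorem partialQ_extendedLagrangian (he : e ∈ atlas E M)
    (hL : ContMDiff (𝓘(ℝ, E).tangent.prod 𝓘(ℝ, ℝ)) 𝓘(ℝ, ℝ) ∞ L)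
    (hΦ : ∀ α, ContMDiff (𝓘(ℝ, E).tangent.prod 𝓘(ℝ, ℝ × ℝ)) 𝓘(ℝ, ℝ) ∞ (Φ α))
    (hc : ContMDiffOn 𝓘(ℝ, ℝ) 𝓘(ℝ, E) ∞ c (Icc 0 1)) (hmu : ContDiffOn ℝ ∞ mu (Icc 0 1))
    (ht : t ∈ Icc (0 : ℝ) 1) (hs : c t ∈ e.source) (y : ℝ) :
    partialQ (𝓘(ℝ, E).prod 𝓘(ℝ, Fin k → ℝ)) (prodChart k e)
        (fun p => extendedLagrangian 𝓘(ℝ, E) L Φ (p, y)) (fun s => (c s, mu s)) t =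
      (partialQ 𝓘(ℝ, E) e (fun p => lagrangianMu 𝓘(ℝ, E) L Φ mu t (p, y)) c t).comp
        (.fst ℝ E (Fin k → ℝ)) -
      ∑ α, psi 𝓘(ℝ, E) L Φ α (velocity 𝓘(ℝ, E) c t, y) •
        (ContinuousLinearMap.proj α).comp (.snd ℝ E (Fin k → ℝ)) := by
  rw [partialQ, chartVelocity_prodChart he hc hmu ht hs]
  have hpsi := fun α => hasFDerivAt_partialQ he (contMDiff_psi hL hΦ α) hs y
  have h1 : HasFDerivAt (fun x => lagrangianMu 𝓘(ℝ, E) L Φ mu t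
      (chartPoint 𝓘(ℝ, E) e x (chartVelocity 𝓘(ℝ, E) e c t), y)) _ (e (c t)) :=
    (hasFDerivAt_partialQ he hL hs y).sub (HasFDerivAt.fun_sum (u := Finset.univ) fun α _ =>
      (hpsi α).const_mul (mu t α))
  have h2 : HasFDerivAt (fun x : E × (Fin k → ℝ) =>
      L (chartPoint 𝓘(ℝ, E) e x.1 (chartVelocity 𝓘(ℝ, E) e c t), y) - ∑ α, x.2 α *
        psi 𝓘(ℝ, E) L Φ α (chartPoint 𝓘(ℝ, E) e x.1 (chartVelocity 𝓘(ℝ, E) e c t), y)) _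
      (e (c t), mu t) :=
    ((hasFDerivAt_partialQ he hL hs y).comp (f := fun x : E × (Fin k → ℝ) => x.1)
      (e (c t), mu t) hasFDerivAt_fst).sub
    (HasFDerivAt.fun_sum (u := Finset.univ) fun α _ =>
      (((ContinuousLinearMap.proj (R := ℝ) (φ := fun _ : Fin k => ℝ) α).comp
        (.snd ℝ E (Fin k → ℝ))).hasFDerivAt (x := (e (c t), mu t))).mul
      ((hpsi α).comp (f := fun x : E × (Fin k → ℝ) => x.1) (e (c t), mu t) hasFDerivAt_fst))
  have h3 : (fun x : E × (Fin k → ℝ) => extendedLagrangian 𝓘(ℝ, E) L Φ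
      (chartPoint (𝓘(ℝ, E).prod 𝓘(ℝ, Fin k → ℝ)) (prodChart k e) x
        (chartVelocity 𝓘(ℝ, E) e c t, derivWithin mu (Icc 0 1) t), y)) =ᶠ[nhds (e (c t), mu t)]
      fun x => L (chartPoint 𝓘(ℝ, E) e x.1 (chartVelocity 𝓘(ℝ, E) e c t), y) - ∑ α, x.2 α *
        psi 𝓘(ℝ, E) L Φ α (chartPoint 𝓘(ℝ, E) e x.1 (chartVelocity 𝓘(ℝ, E) e c t), y) := by
    filter_upwards [(e.open_target.preimage continuous_fst).mem_nhds (e.map_source hs)] with x hx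
    rw [extendedLagrangian_eq (t := t), chartPoint_prodChart_fst he hx]
    rfl
  refine (h2.congr_of_eventuallyEq h3).fderiv.trans ?_
  have h4 : partialQ 𝓘(ℝ, E) e (fun p => lagrangianMu 𝓘(ℝ, E) L Φ mu t (p, y)) c t = _ := h1.fderiv
  rw [h4]
  refine ContinuousLinearMap.ext fun v => ?_
  have h5 : ∀ α, psi 𝓘(ℝ, E) L Φ α
      (chartPoint 𝓘(ℝ, E) e (e (c t)) (chartVelocity 𝓘(ℝ, E) e c t), y) =
        psi 𝓘(ℝ, E) L Φ α (velocity 𝓘(ℝ, E) c t, y) := fun α => by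
    rw [chartPoint_velocity he hc ht hs]
  simp [h5, sum_apply, Finset.sum_add_distrib, sub_sub]

/-- The Herglotz equations of `𝓛_μ` are those of the extended Lagrangian, in which the multipliers
are additional configuration variables. -/
theorem isHerglotzSolution_iff_extendedLagrangian
    (hL : ContMDiff (𝓘(ℝ, E).tangent.prod 𝓘(ℝ, ℝ)) 𝓘(ℝ, ℝ) ∞ L)
    (hΦ : ∀ α, ContMDiff (𝓘(ℝ, E).tangent.prod 𝓘(ℝ, ℝ × ℝ)) 𝓘(ℝ, ℝ) ∞ (Φ α))
    (hc : ContMDiffOn 𝓘(ℝ, ℝ) 𝓘(ℝ, E) ∞ c (Icc 0 1)) (hmu : ContDiffOn ℝ ∞ mu (Icc 0 1)) :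
    IsHerglotzSolution 𝓘(ℝ, E) L Φ mu c z ↔
      HerglotzEq (𝓘(ℝ, E).prod 𝓘(ℝ, Fin k → ℝ))
          (fun _ => extendedLagrangian 𝓘(ℝ, E) L Φ) (fun t => (c t, mu t)) z ∧
        ∀ t ∈ Icc (0 : ℝ) 1, zdot z t = extendedLagrangian 𝓘(ℝ, E) L Φ
          (velocity (𝓘(ℝ, E).prod 𝓘(ℝ, Fin k → ℝ)) (fun s => (c s, mu s)) t, z t) := by
  have hV : ∀ e ∈ atlas E M, ∀ t ∈ Icc (0 : ℝ) 1, c t ∈ e.source →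
      (fun s => partialV (𝓘(ℝ, E).prod 𝓘(ℝ, Fin k → ℝ)) (prodChart k e)
        (fun p => extendedLagrangian 𝓘(ℝ, E) L Φ (p, z s)) (fun s => (c s, mu s)) s)
      =ᶠ[nhdsWithin t (Icc 0 1)] fun s => (partialV 𝓘(ℝ, E) e
        (fun p => lagrangianMu 𝓘(ℝ, E) L Φ mu s (p, z s)) c s).comp (.fst ℝ E (Fin k → ℝ)) :=
    fun e he t ht hs => by
      filter_upwards [eventually_mem_source hc ht hs] with r hr using
        partialV_extendedLagrangian he hL hΦ hc hmu hr.1 hr.2 (z r)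
  have hkey : ∀ e ∈ atlas E M, ∀ t ∈ Icc (0 : ℝ) 1, c t ∈ e.source →
      (HasDerivWithinAt (fun s => partialV (𝓘(ℝ, E).prod 𝓘(ℝ, Fin k → ℝ)) (prodChart k e)
        (fun p => extendedLagrangian 𝓘(ℝ, E) L Φ (p, z s)) (fun s => (c s, mu s)) s)
        (partialQ (𝓘(ℝ, E).prod 𝓘(ℝ, Fin k → ℝ)) (prodChart k e)
            (fun p => extendedLagrangian 𝓘(ℝ, E) L Φ (p, z t)) (fun s => (c s, mu s)) t +
          deriv (fun y => extendedLagrangian 𝓘(ℝ, E) L Φ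
            (velocity (𝓘(ℝ, E).prod 𝓘(ℝ, Fin k → ℝ)) (fun s => (c s, mu s)) t, y)) (z t) •
          partialV (𝓘(ℝ, E).prod 𝓘(ℝ, Fin k → ℝ)) (prodChart k e)
            (fun p => extendedLagrangian 𝓘(ℝ, E) L Φ (p, z t)) (fun s => (c s, mu s)) t)
        (Icc 0 1) t ↔
      HasDerivWithinAt
        (fun s => partialV 𝓘(ℝ, E) e (fun p => lagrangianMu 𝓘(ℝ, E) L Φ mu s (p, z s)) c s)
        (partialQ 𝓘(ℝ, E) e (fun p => lagrangianMu 𝓘(ℝ, E) L Φ mu t (p, z t)) c t +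
          lagrangianMuZ 𝓘(ℝ, E) L Φ mu c z t •
            partialV 𝓘(ℝ, E) e (fun p => lagrangianMu 𝓘(ℝ, E) L Φ mu t (p, z t)) c t)
        (Icc 0 1) t ∧ ∀ α, psi 𝓘(ℝ, E) L Φ α (velocity 𝓘(ℝ, E) c t, z t) = 0) := by
    intro e he t ht hs
    rw [partialQ_extendedLagrangian he hL hΦ hc hmu ht hs,
      partialV_extendedLagrangian he hL hΦ hc hmu ht hs,
      (hV e he t ht hs).hasDerivWithinAt_iff_of_mem ht]
    simp only [extendedLagrangian_velocity hc hmu ht]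
    rw [← hasDerivWithinAt_comp_fst_iff ht, ContinuousLinearMap.add_comp,
      ContinuousLinearMap.smul_comp, add_sub_right_comm]
    rfl
  constructor
  · intro h
    refine ⟨fun e' he' t ht hs => ?_, fun t ht => ?_⟩
    · obtain ⟨e, he, rfl⟩ := mem_atlas_prod_iff.1 he'
      exact (hkey e he t ht hs.1).2 ⟨h.herglotz e he t ht hs.1, h.eq_psi t ht⟩
    · rw [extendedLagrangian_velocity hc hmu ht]
      exact h.eq_zdot t ht
  · rintro ⟨h, hz⟩
    have h' : ∀ e ∈ atlas E M, ∀ t ∈ Icc (0 : ℝ) 1, c t ∈ e.source → _ := fun e he t ht hs =>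
      (hkey e he t ht hs).1 (h _ (mem_atlas_prod_iff.2 ⟨e, he, rfl⟩) t ht ⟨hs, trivial⟩)
    refine ⟨fun e he t ht hs => (h' e he t ht hs).1, fun t ht =>
      (h' _ (chart_mem_atlas E (c t)) t ht (mem_chart_source E (c t))).2, fun t ht => ?_⟩
    rw [← extendedLagrangian_velocity hc hmu ht]
    exact hz t ht

end

end VakonomicContact

end

/-! ### Assembly of the four assertions. -/

theorem mainTheorem1
    {E : Type*} [NormedAddCommGroup E] [NormedSpace ℝ E] [FiniteDimensional ℝ E]
    {Q : Type*} [TopologicalSpace Q] [T2Space Q] [SecondCountableTopology Q]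
    [ChartedSpace E Q] [IsManifold 𝓘(ℝ, E) ∞ Q]
    (k : ℕ)
    (L : TangentBundle 𝓘(ℝ, E) Q × ℝ → ℝ)
    (hL : ContMDiff (𝓘(ℝ, E).tangent.prod 𝓘(ℝ, ℝ)) 𝓘(ℝ, ℝ) ∞ L)
    (Φ : Fin k → TangentBundle 𝓘(ℝ, E) Q × (ℝ × ℝ) → ℝ)
    (hΦ : ∀ α, ContMDiff (𝓘(ℝ, E).tangent.prod 𝓘(ℝ, ℝ × ℝ)) 𝓘(ℝ, ℝ) ∞ (Φ α))
    (q₀ q₁ : Q) (z₀ : ℝ)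
    (c : ℝ → Q) (z : ℝ → ℝ)
    (hcz : (c, z) ∈ VakonomicContact.pathSpace 𝓘(ℝ, E) q₀ q₁ z₀ univ) :
    -- critical points and multipliers
    ((∀ lam : ℝ → Fin (k + 1) → ℝ,
        VakonomicContact.IsVakonomicSolution 𝓘(ℝ, E)
          (VakonomicContact.constraints 𝓘(ℝ, E) L Φ) lam c z →
        VakonomicContact.NaturalBoundary 𝓘(ℝ, E)
          (VakonomicContact.constraints 𝓘(ℝ, E) L Φ) lam c z →
        VakonomicContact.IsCritical 𝓘(ℝ, E) q₀ q₁ z₀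
          (VakonomicContact.zeroSet 𝓘(ℝ, E) (VakonomicContact.constraints 𝓘(ℝ, E) L Φ)) (c, z)) ∧
      (VakonomicContact.IsRegularCurve 𝓘(ℝ, E)
          (VakonomicContact.constraints 𝓘(ℝ, E) L Φ) q₀ q₁ z₀ (c, z) →
        (VakonomicContact.IsCritical 𝓘(ℝ, E) q₀ q₁ z₀
            (VakonomicContact.zeroSet 𝓘(ℝ, E)
              (VakonomicContact.constraints 𝓘(ℝ, E) L Φ)) (c, z) ↔
          ∃ lam : ℝ → Fin (k + 1) → ℝ, ContDiffOn ℝ ∞ lam (Icc 0 1) ∧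
            VakonomicContact.IsVakonomicSolution 𝓘(ℝ, E)
              (VakonomicContact.constraints 𝓘(ℝ, E) L Φ) lam c z ∧
            VakonomicContact.NaturalBoundary 𝓘(ℝ, E)
              (VakonomicContact.constraints 𝓘(ℝ, E) L Φ) lam c z))) ∧
    -- the constraints other than the first can be replaced by ones that do not involve `ż`
    (VakonomicContact.zeroSet 𝓘(ℝ, E) (VakonomicContact.constraints 𝓘(ℝ, E) L Φ) =
        VakonomicContact.zeroSet 𝓘(ℝ, E) (VakonomicContact.constraints 𝓘(ℝ, E) L
          (VakonomicContact.psiConstraint 𝓘(ℝ, E) L Φ)) ∧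
      ∀ lam lam' : ℝ → Fin (k + 1) → ℝ,
        (∀ t ∈ Icc (0 : ℝ) 1,
          lam' t 0 = ∑ a, lam t a * VakonomicContact.partialZdot 𝓘(ℝ, E)
            (VakonomicContact.constraints 𝓘(ℝ, E) L Φ a) c z t ∧
          ∀ α : Fin k, lam' t α.succ = lam t α.succ) →
        ((VakonomicContact.IsVakonomicSolution 𝓘(ℝ, E)
            (VakonomicContact.constraints 𝓘(ℝ, E) L Φ) lam c z ↔
          VakonomicContact.IsVakonomicSolution 𝓘(ℝ, E)
            (VakonomicContact.constraints 𝓘(ℝ, E) L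
              (VakonomicContact.psiConstraint 𝓘(ℝ, E) L Φ)) lam' c z) ∧
        (VakonomicContact.NaturalBoundary 𝓘(ℝ, E)
            (VakonomicContact.constraints 𝓘(ℝ, E) L Φ) lam c z ↔
          VakonomicContact.NaturalBoundary 𝓘(ℝ, E)
            (VakonomicContact.constraints 𝓘(ℝ, E) L
              (VakonomicContact.psiConstraint 𝓘(ℝ, E) L Φ)) lam' c z))) ∧
    -- the Herglotz form, when `φ¹, …, φᵏ` do not involve `ż`
    ((∀ α x y w w', Φ α (x, (y, w)) = Φ α (x, (y, w'))) →
      (∀ lam : ℝ → Fin (k + 1) → ℝ,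
        VakonomicContact.NaturalBoundary 𝓘(ℝ, E)
          (VakonomicContact.constraints 𝓘(ℝ, E) L Φ) lam c z ↔ lam 1 0 = 1) ∧
      (∀ lam : ℝ → Fin (k + 1) → ℝ, (∀ t ∈ Icc (0 : ℝ) 1, lam t 0 ≠ 0) →
        ∀ mu : ℝ → Fin k → ℝ, (∀ t ∈ Icc (0 : ℝ) 1, ∀ α : Fin k, mu t α = lam t α.succ / lam t 0) →
        (VakonomicContact.IsVakonomicSolution 𝓘(ℝ, E)
            (VakonomicContact.constraints 𝓘(ℝ, E) L Φ) lam c z ↔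
          VakonomicContact.IsReducedSolution 𝓘(ℝ, E) L Φ (fun t => lam t 0) mu c z) ∧
        (VakonomicContact.IsVakonomicSolution 𝓘(ℝ, E)
            (VakonomicContact.constraints 𝓘(ℝ, E) L Φ) lam c z ↔
          VakonomicContact.IsHerglotzSolution 𝓘(ℝ, E) L Φ mu c z ∧
          ∀ t ∈ Icc (0 : ℝ) 1, HasDerivWithinAt (fun s => lam s 0)
            (-(lam t 0 * VakonomicContact.lagrangianMuZ 𝓘(ℝ, E) L Φ mu c z t)) (Icc 0 1) t)) ∧
      (∀ mu : ℝ → Fin k → ℝ, ContDiffOn ℝ ∞ mu (Icc 0 1) →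
        (VakonomicContact.IsHerglotzSolution 𝓘(ℝ, E) L Φ mu c z ↔
          ∃ lam : ℝ → Fin (k + 1) → ℝ, ContDiffOn ℝ ∞ lam (Icc 0 1) ∧
            (∀ t ∈ Icc (0 : ℝ) 1, lam t 0 ≠ 0 ∧ ∀ α : Fin k, mu t α = lam t α.succ / lam t 0) ∧
            VakonomicContact.IsVakonomicSolution 𝓘(ℝ, E)
              (VakonomicContact.constraints 𝓘(ℝ, E) L Φ) lam c z ∧
            VakonomicContact.NaturalBoundary 𝓘(ℝ, E)
              (VakonomicContact.constraints 𝓘(ℝ, E) L Φ) lam c z))) ∧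
    -- these are the Herglotz equations of the extended Lagrangian on `Q × ℝᵏ`
    (∀ mu : ℝ → Fin k → ℝ, ContDiffOn ℝ ∞ mu (Icc 0 1) →
      (VakonomicContact.IsHerglotzSolution 𝓘(ℝ, E) L Φ mu c z ↔
        VakonomicContact.HerglotzEq (𝓘(ℝ, E).prod 𝓘(ℝ, Fin k → ℝ))
            (fun _ => VakonomicContact.extendedLagrangian 𝓘(ℝ, E) L Φ)
            (fun t => (c t, mu t)) z ∧
          ∀ t ∈ Icc (0 : ℝ) 1, VakonomicContact.zdot z t =
            VakonomicContact.extendedLagrangian 𝓘(ℝ, E) L Φ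
              (VakonomicContact.velocity (𝓘(ℝ, E).prod 𝓘(ℝ, Fin k → ℝ))
                (fun s => (c s, mu s)) t, z t))) := by
  have hφ := VakonomicContact.contMDiff_constraints hL hΦ
  have hc := hcz.1
  have hz := hcz.2.1
  refine ⟨⟨fun lam hsol hbd => VakonomicContact.isCritical_of_isVakonomicSolution hφ hcz hsol hbd,
    fun hreg => ⟨fun hcrit =>
      VakonomicContact.exists_isVakonomicSolution_of_isCritical hφ hreg hcrit, ?_⟩⟩,
    ⟨VakonomicContact.zeroSet_psiConstraint, fun lam lam' h =>
      ⟨VakonomicContact.isVakonomicSolution_psiConstraint_iff hL hΦ hc h, ?_⟩⟩, fun hind => ?_,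
    fun mu hmu => VakonomicContact.isHerglotzSolution_iff_extendedLagrangian hL hΦ hc hmu⟩
  · rintro ⟨lam, -, hsol, hbd⟩
    exact VakonomicContact.isCritical_of_isVakonomicSolution hφ hcz hsol hbd
  · rw [VakonomicContact.NaturalBoundary, VakonomicContact.NaturalBoundary,
      VakonomicContact.sum_partialZdot_psiConstraint (h 1 ⟨zero_le_one, le_rfl⟩).1]
  -- When the `φ^α` do not involve `ż` they coincide with the `ψ^α`, so the results proved for the
  -- latter apply verbatim.
  · have hcon : VakonomicContact.constraints 𝓘(ℝ, E) L Φ = VakonomicContact.constraints 𝓘(ℝ, E) L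
        (VakonomicContact.psiConstraint 𝓘(ℝ, E) L Φ) := by
      rw [VakonomicContact.psiConstraint_eq_self hind]
    rw [hcon]
    refine ⟨fun lam => VakonomicContact.naturalBoundary_psiConstraint_iff,
      fun lam hlam mu hmu => ?_,
      fun mu hmu => VakonomicContact.isHerglotzSolution_iff_exists hL hΦ hc hz hmu⟩
    have h := VakonomicContact.isVakonomicSolution_iff_isReducedSolution (z := z) hL hΦ hc hlam hmu
    exact ⟨h, h.trans (VakonomicContact.isReducedSolution_iff_isHerglotzSolution hlam)⟩
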